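/- Let $n\ge 3$, let $M^n$ be a smooth (not necessarily complete) Riemannian manifold with nonnegative sectional curvature, and let $f:M^n\to\mathbb{R}^{n+2}$ be a smooth isometric immersion with second fundamental form $\alpha$. For a normal vector $\zeta$ at $p$ let $A_\zeta$ be the shape operator, $\langle A_\zeta X,Y\rangle=\langle\alpha(X,Y),\zeta\rangle$. A *nonnegative frame* at $p$ is an orthonormal basis $\{\xi,\eta\}$ of the normal space $T_p^\perp M$ such that $A:=A_\xi\ge 0$ and $B:=A_\eta\ge 0$. Assume that $f$ is locally wide, i.e. at every point $p$, for the operators $A,B$ of a nonnegative frame, either $\ker A\cap\ker B\ne 0$, or $\ker A\oplus\ker B=T_pM$ with $A,B\neq 0$. For an integer $k$ with $2\le k\le[n/2]$, let $U_k$ be the set of points $p\in M$ admitting a nonnegative frame $\{\xi,\eta\}$ with $\operatorname{rank}A=n-k$, $\operatorname{rank}B=k$ and $\ker A\cap\ker B=0$; call such an ordered frame a *frame of type $k$* at $p$. Then $f|_{U_k}$ is locally a product immersion of two strictly convex Euclidean hypersurfaces whose respective normal vectors are $\xi$ and $\eta$. Precisely: for every $p\in U_k$ and every frame $(\xi,\eta)$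 of type $k$ at $p$ there exist open sets $W_1\subset\mathbb{R}^{n-k}$, $W_2\subset\mathbb{R}^{k}$, smooth immersions $h_1:W_1\to\mathbb{R}^{n-k+1}$, $h_2:W_2\to\mathbb{R}^{k+1}$ with smooth unit normal fields $N_1,N_2$ with respect to which their second fundamental forms are positive definite, a smooth diffeomorphism $\Phi$ from $W_1\times W_2$ onto an open neighbourhood of $p$ in $M$ contained in $U_k$, and a linear isometry $T:\mathbb{R}^{n-k+1}\times\mathbb{R}^{k+1}\to\mathbb{R}^{n+2}$ such that: $\Phi$ is an isometry for the product of the metrics induced by $h_1$ and $h_2$; $f(\Phi(x,y))=T(h_1(x),h_2(y))$ for all $(x,y)\in W_1\times W_2$; $\big(T(N_1(x),0),\,T(0,N_2(y))\big)$ is a frame of type $k$ at $\Phi(x,y)$ for all $(x,y)$; and this frame is the given $(\xi,\eta)$ at $p$. -/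

import Mathlib

open Bundle Set
open scoped Manifold ContDiff InnerProductSpace

noncomputable section

/-- Euclidean space `ℝᵐ`. -/
abbrev Euc (m : ℕ) : Type := EuclideanSpace ℝ (Fin m)

/-- The standard basis vectors of `ℝᵐ`. -/
def stdVec {m : ℕ} (i : Fin m) : Euc m := EuclideanSpace.single i (1 : ℝ)

/-- The partial derivative `∂ᵢ F`. -/
def partialD {m : ℕ} (i : Fin m) (F : Euc m → ℝ) (y : Euc m) : ℝ := fderiv ℝ F y (stdVec i)

/-- A smooth Riemannian metric on the smooth `n`-manifold `M`. -/
abbrev SmoothMetric (n : ℕ) (M : Type*) [TopologicalSpace M] [ChartedSpace (Euc n) M]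
    [IsManifold (𝓡 n) ∞ M] : Type _ :=
  ContMDiffRiemannianMetric (𝓡 n) ∞ (Euc n) (fun x : M => TangentSpace (𝓡 n) x)

section Intrinsic

variable {n : ℕ} {M : Type*} [TopologicalSpace M] [ChartedSpace (Euc n) M]
  [IsManifold (𝓡 n) ∞ M]

/-- The metric coefficients `g_{ij}` in the preferred chart at `p`, as functions on `ℝⁿ`. -/
def metricCoeff (g : SmoothMetric n M) (p : M) (y : Euc n) : Matrix (Fin n) (Fin n) ℝ :=
  fun i j => g.inner ((extChartAt (𝓡 n) p).symm y)
    (mfderiv 𝓘(ℝ, Euc n) (𝓡 n) (extChartAt (𝓡 n) p).symm y (stdVec i))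
    (mfderiv 𝓘(ℝ, Euc n) (𝓡 n) (extChartAt (𝓡 n) p).symm y (stdVec j))

/-- The Christoffel symbols `Γˡᵢⱼ` of the Levi-Civita connection in the preferred chart at `p`. -/
def christoffel (g : SmoothMetric n M) (p : M) (l i j : Fin n) (y : Euc n) : ℝ :=
  (1 / 2 : ℝ) * ∑ m, (metricCoeff g p y)⁻¹ l m *
    (partialD i (fun z => metricCoeff g p z j m) y
      + partialD j (fun z => metricCoeff g p z i m) y
      - partialD m (fun z => metricCoeff g p z i j) y)

/-- The component `l` of `R(∂ᵢ, ∂ⱼ)∂ₖ` at `p`, where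
`R(X, Y)Z = ∇_X ∇_Y Z - ∇_Y ∇_X Z - ∇_{[X, Y]} Z`, in the preferred chart at `p`. -/
def riemannCoeff (g : SmoothMetric n M) (p : M) (l i j k : Fin n) : ℝ :=
  let y := extChartAt (𝓡 n) p p
  partialD i (christoffel g p l j k) y - partialD j (christoffel g p l i k) y
    + ∑ m, (christoffel g p l i m y * christoffel g p m j k y
      - christoffel g p l j m y * christoffel g p m i k y)

/-- The vector `R(u, v)w ∈ T_pM`. In Mathlib the tangent space `T_pM` is `ℝⁿ`, the coordinates
of a tangent vector being its components in the preferred chart at `p`. -/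
def riemannTensor (g : SmoothMetric n M) (p : M) (u v w : TangentSpace (𝓡 n) p) :
    TangentSpace (𝓡 n) p :=
  let a : Euc n := u
  let b : Euc n := v
  let c : Euc n := w
  WithLp.toLp 2 (fun l => ∑ i, ∑ j, ∑ k, riemannCoeff g p l i j k * a i * b j * c k)

/-- The sectional curvature of the plane spanned by `u, v`
(meaningful for linearly independent `u, v`). -/
def sectionalCurv (g : SmoothMetric n M) (p : M) (u v : TangentSpace (𝓡 n) p) : ℝ :=
  g.inner p (riemannTensor g p u v v) u /
    (g.inner p u u * g.inner p v v - g.inner p u v ^ 2)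

/-- `M` has nonnegative sectional curvature. -/
def NonnegSectionalCurv (g : SmoothMetric n M) : Prop :=
  ∀ (p : M) (u v : TangentSpace (𝓡 n) p), LinearIndependent ℝ ![u, v] →
    0 ≤ sectionalCurv g p u v

end Intrinsic

section Extrinsic

variable {n : ℕ} {M : Type*} [TopologicalSpace M] [ChartedSpace (Euc n) M]
  [IsManifold (𝓡 n) ∞ M]

/-- The differential `df_p : T_pM → ℝᵈ`. -/
def diffAt {d : ℕ} (f : M → Euc d) (p : M) : TangentSpace (𝓡 n) p →L[ℝ] Euc d :=
  mfderiv (𝓡 n) 𝓘(ℝ, Euc d) f p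

/-- A smooth isometric immersion into Euclidean space. -/
structure IsIsometricImmersion (g : SmoothMetric n M) {d : ℕ} (f : M → Euc d) : Prop where
  smooth : ContMDiff (𝓡 n) 𝓘(ℝ, Euc d) ∞ f
  isometric : ∀ (p : M) (u v : TangentSpace (𝓡 n) p),
    ⟪diffAt f p u, diffAt f p v⟫_ℝ = g.inner p u v

/-- The normal space `T_p^⊥M`. -/
def normalSpaceAt {d : ℕ} (f : M → Euc d) (p : M) : Submodule ℝ (Euc d) :=
  (LinearMap.range (diffAt (n := n) f p).toLinearMap)ᗮ

/-- The second derivative of `f` at `p` in the preferred chart at `p`. -/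
def secondDeriv {d : ℕ} (f : M → Euc d) (p : M) : Euc n →L[ℝ] Euc n →L[ℝ] Euc d :=
  fderiv ℝ (fderiv ℝ (f ∘ (extChartAt (𝓡 n) p).symm)) (extChartAt (𝓡 n) p p)

/-- The second fundamental form `α(X, Y)`: the normal component of the second derivative. -/
def secondFF {d : ℕ} (f : M → Euc d) (p : M) (X Y : TangentSpace (𝓡 n) p) : Euc d :=
  (normalSpaceAt (n := n) f p).starProjection (secondDeriv (n := n) f p X Y)

/-- The bilinear form `⟨α(X, Y), ζ⟩` on `T_pM`. -/
def secondFFAlong {d : ℕ} (f : M → Euc d) (p : M) (ζ : Euc d) :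
    LinearMap.BilinForm ℝ (TangentSpace (𝓡 n) p) :=
  LinearMap.mk₂ ℝ (fun X Y => ⟪secondFF (n := n) f p X Y, ζ⟫_ℝ)
    (fun X X' Y => by
      have h : secondFF (n := n) f p (X + X') Y
          = secondFF (n := n) f p X Y + secondFF (n := n) f p X' Y := by
        unfold secondFF
        rw [← map_add]
        congr 1
        exact congrArg (fun L : Euc n →L[ℝ] Euc d => L Y) (map_add (secondDeriv (n := n) f p) X X')
      rw [h, inner_add_left])
    (fun c X Y => by
      have h : secondFF (n := n) f p (c • X) Y = c • secondFF (n := n) f p X Y := by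
        unfold secondFF
        rw [← map_smul]
        congr 1
        exact congrArg (fun L : Euc n →L[ℝ] Euc d => L Y) (map_smul (secondDeriv (n := n) f p) c X)
      rw [h, real_inner_smul_left, smul_eq_mul])
    (fun X Y Y' => by
      have h : secondFF (n := n) f p X (Y + Y')
          = secondFF (n := n) f p X Y + secondFF (n := n) f p X Y' := by
        unfold secondFF
        rw [← map_add]
        congr 1
        exact map_add (secondDeriv (n := n) f p X) Y Y'
      rw [h, inner_add_left])
    (fun c X Y => by
      have h : secondFF (n := n) f p X (c • Y) = c • secondFF (n := n) f p X Y := by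
        unfold secondFF
        rw [← map_smul]
        congr 1
        exact map_smul (secondDeriv (n := n) f p X) c Y
      rw [h, real_inner_smul_left, smul_eq_mul])

/-- The metric at `p` as a bilinear form. -/
def metricForm (g : SmoothMetric n M) (p : M) :
    LinearMap.BilinForm ℝ (TangentSpace (𝓡 n) p) :=
  LinearMap.mk₂ ℝ (fun u v => g.inner p u v)
    (fun u u' v => by simp) (fun c u v => by simp)
    (fun u v v' => by simp) (fun c u v => by simp)

theorem metricForm_nondegenerate (g : SmoothMetric n M) (p : M) :
    (metricForm g p).Nondegenerate := by
  have key : ∀ u : TangentSpace (𝓡 n) p, g.inner p u u = 0 → u = 0 := by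
    intro u hu
    by_contra h
    exact absurd hu (g.pos p u h).ne'
  exact ⟨fun u hu => key u (hu u), fun u hu => key u (hu u)⟩

instance tangentSpace_finiteDimensional (p : M) :
    FiniteDimensional ℝ (TangentSpace (𝓡 n) p) :=
  inferInstanceAs (FiniteDimensional ℝ (Euc n))

/-- The shape operator `A_ζ : T_pM → T_pM` in the normal direction `ζ`: the operator with
`g(A_ζ X, Y) = ⟨α(X, Y), ζ⟩`, see `metric_shapeOp`. -/
def shapeOp (g : SmoothMetric n M) {d : ℕ} (f : M → Euc d) (p : M) (ζ : Euc d) :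
    TangentSpace (𝓡 n) p →ₗ[ℝ] TangentSpace (𝓡 n) p :=
  ((metricForm g p).toDual (metricForm_nondegenerate g p)).symm.toLinearMap.comp
    (secondFFAlong f p ζ)

theorem metric_shapeOp (g : SmoothMetric n M) {d : ℕ} (f : M → Euc d) (p : M) (ζ : Euc d)
    (X Y : TangentSpace (𝓡 n) p) :
    g.inner p (shapeOp g f p ζ X) Y = ⟪secondFF f p X Y, ζ⟫_ℝ :=
  LinearMap.BilinForm.apply_toDual_symm_apply (hB := metricForm_nondegenerate g p)
    (f := secondFFAlong f p ζ X) Y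

/-- `{ξ, η}` is an orthonormal basis of the (two-dimensional) normal space at `p`, and the
operators `A = A_ξ` and `B = A_η` are nonnegative. -/
structure IsNonnegFrame (g : SmoothMetric n M) (f : M → Euc (n + 2)) (p : M)
    (ξ η : Euc (n + 2)) : Prop where
  mem_ξ : ξ ∈ normalSpaceAt (n := n) f p
  mem_η : η ∈ normalSpaceAt (n := n) f p
  norm_ξ : ‖ξ‖ = 1
  norm_η : ‖η‖ = 1
  orth : ⟪ξ, η⟫_ℝ = 0
  nonneg_ξ : ∀ X : TangentSpace (𝓡 n) p, 0 ≤ g.inner p (shapeOp g f p ξ X) X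
  nonneg_η : ∀ X : TangentSpace (𝓡 n) p, 0 ≤ g.inner p (shapeOp g f p η X) X

/-- `f` is locally wide: for the operators `A`, `B` of any nonnegative frame, at every point
either `ker A ∩ ker B ≠ 0`, or `ker A ⊕ ker B = T_pM` with `A, B ≠ 0`. -/
def IsLocallyWide (g : SmoothMetric n M) (f : M → Euc (n + 2)) : Prop :=
  ∀ (p : M) (ξ η : Euc (n + 2)), IsNonnegFrame g f p ξ η →
    LinearMap.ker (shapeOp g f p ξ) ⊓ LinearMap.ker (shapeOp g f p η) ≠ ⊥ ∨
    (IsCompl (LinearMap.ker (shapeOp g f p ξ)) (LinearMap.ker (shapeOp g f p η)) ∧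
      shapeOp g f p ξ ≠ 0 ∧ shapeOp g f p η ≠ 0)

/-- A nonnegative frame at `p` with `rank A = n - k`, `rank B = k` and `ker A ∩ ker B = 0`. -/
structure IsFrameOfType (g : SmoothMetric n M) (f : M → Euc (n + 2)) (k : ℕ) (p : M)
    (ξ η : Euc (n + 2)) : Prop extends IsNonnegFrame g f p ξ η where
  rank_ξ : Module.finrank ℝ (LinearMap.range (shapeOp g f p ξ)) = n - k
  rank_η : Module.finrank ℝ (LinearMap.range (shapeOp g f p η)) = k
  ker_inf : LinearMap.ker (shapeOp g f p ξ) ⊓ LinearMap.ker (shapeOp g f p η) = ⊥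

/-- The set `U_k`. -/
def stratumU (g : SmoothMetric n M) (f : M → Euc (n + 2)) (k : ℕ) : Set M :=
  {p | ∃ ξ η : Euc (n + 2), IsFrameOfType g f k p ξ η}

end Extrinsic

/-- `h`, restricted to the open set `W ⊆ ℝᵐ`, is a strictly convex (immersed, smooth)
hypersurface of `ℝᵐ⁺¹` with unit normal field `N`: its second fundamental form with respect to
`N` is positive definite. -/
structure IsStrictlyConvexHypersurface {m : ℕ} (W : Set (Euc m)) (h N : Euc m → Euc (m + 1)) :
    Prop where
  isOpen : IsOpen W
  smooth : ContDiffOn ℝ ∞ h W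
  immersion : ∀ x ∈ W, Function.Injective (fderiv ℝ h x)
  normal_smooth : ContDiffOn ℝ ∞ N W
  normal_unit : ∀ x ∈ W, ‖N x‖ = 1
  normal_orth : ∀ x ∈ W, ∀ u : Euc m, ⟪fderiv ℝ h x u, N x⟫_ℝ = 0
  posDef : ∀ x ∈ W, ∀ u : Euc m, u ≠ 0 → 0 < ⟪fderiv ℝ (fderiv ℝ h) x u u, N x⟫_ℝ

end

/-! By the Gauss equation, nonnegative curvature gives `⟨α(u,u), α(v,v)⟩ ≥ |α(u,v)|² ≥ 0` for all
`u, v`. If some normal vector pairs positively with every `α(u,u)`, `u ≠ 0`, these vectors lie in an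
open half plane of the normal plane and make angles at most π/2, so they fit in a quadrant, whose
axes form a nonnegative frame (`exists_quadrant_frame`, `exists_nonnegPair`). At a point with a
frame of type `k`, the vector `ξ + η` is positive in this sense, and positivity persists nearby. So
neighbouring points carry nonnegative frames with `ker A ∩ ker B = 0`, and wideness makes the
kernels complementary. Such a frame is unique up to order, hence close to the given one by
compactness. Since kernels cannot jump up in dimension and their dimensions add up to `n`, the ranks
are locally constant (`AdaptedPair.eventually_exists`). The vector `ξ` is a simple zero of a Gram
determinant on the unit circle of the normal plane, so it varies smoothly
(`AdaptedPair.exists_contDiffAt`).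

The geometric core is `IsAdaptedFrame.fderiv_left_eq_zero`: `ξ` is constant along `ker A`. For `w, u
∈ ker A` the Codazzi equation reads `⟨α(u,u), ∇⊥_w ξ⟩ = ⟨α(w,u), ∇⊥_u ξ⟩`, where `∇⊥ξ` is a multiple
of `η`. As `dim ker A ≥ 2`, some `u ≠ 0` in `ker A` has `⟨α(w,u), η⟩ = 0`, while `⟨α(u,u), η⟩ > 0`
because `B` is definite on `ker A`. Hence `∇⊥_w ξ = 0`, and the tangential part of the derivative
vanishes because `A w = 0`. By symmetry `η` is constant along `ker B`. The bounds `2 ≤ k ≤ n/2` make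
both kernels large enough.

Consequently suitable components of `ξ` and of `η` serve together as coordinates `(x, z)` in which
`ξ` depends on `x` only and `η` on `z` only (`IsAdaptedFrame.exists_coordinates`); no integrability
theorem is needed. The spans of the values of `ξ` and of `η` are orthogonal and have dimensions at
least `n - k + 1` and `k + 1`, so they split the ambient space. The `x`-derivatives of the immersion
lie in the first span and the `z`-derivatives in the second (`IsSplitFrame.exists_splitting`), which
makes the immersion a product. Each factor is strictly convex because `A` is definite on `ker B` and
`B` on `ker A`.

The analysis takes place in one chart around `p`, on the 1-jet `L` and the second derivative `Q` of
the immersion. Pairing `Q` with normal vectors gives the second fundamental form, so tangential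
terms never matter. -/

noncomputable section

/-! ### Linear algebra of nonnegative pairs at a point -/

section Jets

open Topology Filter

variable {E V : Type*} [NormedAddCommGroup E] [InnerProductSpace ℝ E]
  [NormedAddCommGroup V] [InnerProductSpace ℝ V]

/-- The null space of the bilinear form `⟨Q(u, v), ζ⟩`. -/
def nullSpace (Q : E →L[ℝ] E →L[ℝ] V) (ζ : V) : Submodule ℝ E where
  carrier := {u | ∀ v, ⟪Q u v, ζ⟫_ℝ = 0}
  add_mem' := by
    intro a b ha hb v
    simp only [mem_ofPred_eq] at ha hb
    simp [inner_add_left, ha v, hb v]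
  zero_mem' := by simp
  smul_mem' := by
    intro c a ha v
    simp only [mem_ofPred_eq] at ha
    simp [inner_smul_left, ha v]

/-- Orthonormal vectors `ξ`, `η`, orthogonal to the range of `L`, along which the symmetric
bilinear form `Q` is nonnegative. -/
structure NonnegPair (L : E →L[ℝ] V) (Q : E →L[ℝ] E →L[ℝ] V) (ξ η : V) : Prop where
  normal_left : ∀ u, ⟪L u, ξ⟫_ℝ = 0
  normal_right : ∀ u, ⟪L u, η⟫_ℝ = 0
  norm_left : ‖ξ‖ = 1
  norm_right : ‖η‖ = 1
  orth : ⟪ξ, η⟫_ℝ = 0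
  nonneg_left : ∀ u, 0 ≤ ⟪Q u u, ξ⟫_ℝ
  nonneg_right : ∀ u, 0 ≤ ⟪Q u u, η⟫_ℝ

theorem NonnegPair.swap {L : E →L[ℝ] V} {Q : E →L[ℝ] E →L[ℝ] V} {ξ η : V}
    (h : NonnegPair L Q ξ η) : NonnegPair L Q η ξ :=
  ⟨h.normal_right, h.normal_left, h.norm_right, h.norm_left,
    by rw [real_inner_comm]; exact h.orth, h.nonneg_right, h.nonneg_left⟩

/-- A nonnegative pair whose null spaces are complementary. -/
structure AdaptedPair (L : E →L[ℝ] V) (Q : E →L[ℝ] E →L[ℝ] V) (ξ η : V) : Prop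
    extends NonnegPair L Q ξ η where
  compl : IsCompl (nullSpace Q ξ) (nullSpace Q η)

theorem AdaptedPair.swap {L : E →L[ℝ] V} {Q : E →L[ℝ] E →L[ℝ] V} {ξ η : V}
    (h : AdaptedPair L Q ξ η) : AdaptedPair L Q η ξ :=
  ⟨h.toNonnegPair.swap, h.compl.symm⟩

/-- A nonnegative symmetric form annihilates its isotropic vectors. -/
theorem mem_nullSpace_of_isotropic {Q : E →L[ℝ] E →L[ℝ] V} {ζ : V}
    (hQ : ∀ u v, Q u v = Q v u) (hpos : ∀ u, 0 ≤ ⟪Q u u, ζ⟫_ℝ) {u : E}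
    (hu : ⟪Q u u, ζ⟫_ℝ = 0) : u ∈ nullSpace Q ζ := by
  intro v
  have hc := hpos v
  set b := ⟪Q u v, ζ⟫_ℝ with hb
  set c := ⟪Q v v, ζ⟫_ℝ with hc'
  have key : ∀ t : ℝ, 0 ≤ 2 * t * b + t ^ 2 * c := by
    intro t
    have h := hpos (u + t • v)
    simp only [map_add, map_smul, add_apply, smul_apply,
      inner_add_left, real_inner_smul_left, hQ v u, hu, ← hb, ← hc'] at h
    linarith
  -- The quadratic in `t` is smallest at `-b / c`; the denominator `c + 1` also works when `c = 0`
  -- and still gives a negative value unless `b = 0`.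
  have h := key (-b / (c + 1))
  have h1 : 2 * (-b / (c + 1)) * b + (-b / (c + 1)) ^ 2 * c = -(b ^ 2 * (c + 2)) / (c + 1) ^ 2 := by
    field_simp
    ring
  rw [h1, le_div_iff₀ (by positivity)] at h
  have : b ^ 2 ≤ 0 := by nlinarith [sq_nonneg b]
  exact pow_eq_zero_iff two_ne_zero |>.1 (le_antisymm this (sq_nonneg b))

/-- An isotropic vector for `ξ` would lie in both null spaces, which meet only in `0`. Thus each
form is definite on the null space of the other. -/
theorem AdaptedPair.pos_left {L : E →L[ℝ] V} {Q : E →L[ℝ] E →L[ℝ] V} {ξ η : V}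
    (h : AdaptedPair L Q ξ η) (hQ : ∀ u v, Q u v = Q v u) {u : E} (hu : u ∈ nullSpace Q η)
    (hu0 : u ≠ 0) : 0 < ⟪Q u u, ξ⟫_ℝ := by
  refine lt_of_le_of_ne (h.nonneg_left u) fun h0 => hu0 ?_
  have := mem_nullSpace_of_isotropic hQ h.nonneg_left h0.symm
  exact (Submodule.disjoint_def.1 h.compl.disjoint) u this hu

theorem AdaptedPair.pos_right {L : E →L[ℝ] V} {Q : E →L[ℝ] E →L[ℝ] V} {ξ η : V}
    (h : AdaptedPair L Q ξ η) (hQ : ∀ u v, Q u v = Q v u) {u : E} (hu : u ∈ nullSpace Q ξ)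
    (hu0 : u ≠ 0) : 0 < ⟪Q u u, η⟫_ℝ :=
  h.swap.pos_left hQ hu hu0

/-- A nonnegative pair with disjoint null spaces: the form is positive along `ξ + η`. -/
theorem NonnegPair.pos_add {L : E →L[ℝ] V} {Q : E →L[ℝ] E →L[ℝ] V} {ξ η : V}
    (h : NonnegPair L Q ξ η) (hd : Disjoint (nullSpace Q ξ) (nullSpace Q η))
    (hQ : ∀ u v, Q u v = Q v u) {u : E} (hu0 : u ≠ 0) : 0 < ⟪Q u u, ξ + η⟫_ℝ := by
  rw [inner_add_right]
  have h1 := h.nonneg_left u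
  have h2 := h.nonneg_right u
  refine lt_of_le_of_ne (by linarith) fun h0 => hu0 ?_
  exact (Submodule.disjoint_def.1 hd) u
    (mem_nullSpace_of_isotropic hQ h.nonneg_left (by linarith))
    (mem_nullSpace_of_isotropic hQ h.nonneg_right (by linarith))

/-- Vectors of a compact set in a half plane making pairwise angles at most `π / 2` lie in a
quadrant. -/
theorem exists_quadrant_frame {N : Submodule ℝ V} {K : Set V} (hK : IsCompact K)
    (hne : K.Nonempty) (hKN : K ⊆ N) (hpair : ∀ a ∈ K, ∀ b ∈ K, 0 ≤ ⟪a, b⟫_ℝ) {e e' : V}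
    (he : e ∈ N) (he' : e' ∈ N) (he'0 : e' ≠ 0) (hee' : ⟪e, e'⟫_ℝ = 0)
    (hpos : ∀ a ∈ K, 0 < ⟪a, e⟫_ℝ) :
    ∃ ξ ∈ N, ∃ η ∈ N, ‖ξ‖ = 1 ∧ ‖η‖ = 1 ∧ ⟪ξ, η⟫_ℝ = 0 ∧
      ∀ a ∈ K, 0 ≤ ⟪a, ξ⟫_ℝ ∧ 0 ≤ ⟪a, η⟫_ℝ := by
  -- The first axis points along the vector `a` of least slope with respect to `e`, `e'`, and the
  -- second along a vector `b` orthogonal to `a`, on the side of larger slopes. For `c ∈ K` the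
  -- angle condition gives `⟪c, a⟫ ≥ 0` and minimality of the slope gives `⟪c, b⟫ ≥ 0`.
  obtain ⟨a, haK, hmin⟩ := hK.exists_isMinOn (f := fun a => ⟪a, e'⟫_ℝ / ⟪a, e⟫_ℝ) hne
    (ContinuousOn.div (by fun_prop) (by fun_prop) fun a ha => (hpos a ha).ne')
  have ha0 : a ≠ 0 := by
    rintro rfl
    simpa using hpos 0 haK
  set b : V := ⟪a, e⟫_ℝ • e' - ⟪a, e'⟫_ℝ • e with hb
  have hb0 : b ≠ 0 := by
    intro h0
    have h1 : ⟪b, e'⟫_ℝ = ⟪a, e⟫_ℝ * ‖e'‖ ^ 2 := by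
      rw [hb, inner_sub_left, real_inner_smul_left, real_inner_smul_left, hee',
        real_inner_self_eq_norm_sq]
      ring
    rw [h0, inner_zero_left] at h1
    have := mul_pos (hpos a haK) (pow_pos (norm_pos_iff.2 he'0) 2)
    linarith
  have hab : ⟪a, b⟫_ℝ = 0 := by
    rw [hb, inner_sub_right, real_inner_smul_right, real_inner_smul_right]
    ring
  refine ⟨‖a‖⁻¹ • a, N.smul_mem _ (hKN haK), ‖b‖⁻¹ • b,
    N.smul_mem _ (N.sub_mem (N.smul_mem _ he') (N.smul_mem _ he)), ?_, ?_, ?_, ?_⟩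
  · rw [norm_smul, norm_inv, norm_norm, inv_mul_cancel₀ (norm_ne_zero_iff.2 ha0)]
  · rw [norm_smul, norm_inv, norm_norm, inv_mul_cancel₀ (norm_ne_zero_iff.2 hb0)]
  · rw [real_inner_smul_left, real_inner_smul_right, hab]
    ring
  · intro c hc
    rw [real_inner_smul_right, real_inner_smul_right]
    refine ⟨mul_nonneg (by positivity) (hpair c hc a haK), mul_nonneg (by positivity) ?_⟩
    have := hmin hc
    simp only [mem_ofPred_eq] at this
    rw [div_le_div_iff₀ (hpos a haK) (hpos c hc)] at this
    rw [hb, inner_sub_right, real_inner_smul_right, real_inner_smul_right]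
    linarith

variable [FiniteDimensional ℝ E] [FiniteDimensional ℝ V]

/-- Two orthonormal normal vectors span the normal space when it is two-dimensional. -/
theorem normal_expansion (hdim : Module.finrank ℝ V = Module.finrank ℝ E + 2) {L : E →L[ℝ] V}
    (hL : Function.Injective L) {ξ η : V} (h1 : ∀ u, ⟪L u, ξ⟫_ℝ = 0) (h2 : ∀ u, ⟪L u, η⟫_ℝ = 0)
    (hξ : ‖ξ‖ = 1) (hη : ‖η‖ = 1) (hξη : ⟪ξ, η⟫_ℝ = 0) {ζ : V} (hζ : ∀ u, ⟪L u, ζ⟫_ℝ = 0) :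
    ζ = ⟪ξ, ζ⟫_ℝ • ξ + ⟪η, ζ⟫_ℝ • η := by
  let Λ : (ℝ × ℝ) × E →ₗ[ℝ] V :=
    ((LinearMap.toSpanSingleton ℝ V ξ).coprod (LinearMap.toSpanSingleton ℝ V η)).coprod
      L.toLinearMap
  have hΛ : ∀ c d u, Λ ((c, d), u) = c • ξ + d • η + L u := fun c d u => by simp [Λ]
  have hηξ : ⟪η, ξ⟫_ℝ = 0 := by rw [real_inner_comm]; exact hξη
  have hxx : ⟪ξ, ξ⟫_ℝ = 1 := by rw [real_inner_self_eq_norm_sq, hξ]; norm_num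
  have hyy : ⟪η, η⟫_ℝ = 1 := by rw [real_inner_self_eq_norm_sq, hη]; norm_num
  have hinj : Function.Injective Λ := by
    rw [← LinearMap.ker_eq_bot, LinearMap.ker_eq_bot']
    rintro ⟨⟨c, d⟩, u⟩ h
    rw [hΛ] at h
    have hc := congrArg (fun w => ⟪w, ξ⟫_ℝ) h
    have hd := congrArg (fun w => ⟪w, η⟫_ℝ) h
    simp only [inner_add_left, real_inner_smul_left, h1, h2, hxx, hyy, hξη, hηξ, inner_zero_left,
      mul_zero, mul_one, add_zero, zero_add] at hc hd
    subst hc hd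
    simp only [zero_smul, zero_add] at h
    have := hL (h.trans (map_zero L).symm)
    simp [this]
  have hsurj : Function.Surjective Λ := by
    have hfr : Module.finrank ℝ ((ℝ × ℝ) × E) = Module.finrank ℝ V := by
      rw [Module.finrank_prod, Module.finrank_prod, Module.finrank_self, hdim]
      ring
    exact (LinearMap.injective_iff_surjective_of_finrank_eq_finrank hfr).1 hinj
  -- The remainder is itself of the form `c • ξ + d • η + L u`, yet it is orthogonal to `ξ`, `η` and
  -- the range of `L`, hence to itself.
  obtain ⟨⟨⟨c, d⟩, u⟩, hw⟩ := hsurj (ζ - (⟪ξ, ζ⟫_ℝ • ξ + ⟪η, ζ⟫_ℝ • η))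
  rw [hΛ] at hw
  set w := ζ - (⟪ξ, ζ⟫_ℝ • ξ + ⟪η, ζ⟫_ℝ • η) with hwdef
  have w1 : ⟪ξ, w⟫_ℝ = 0 := by
    simp [hwdef, inner_sub_right, inner_add_right, real_inner_smul_right, hξ, hξη]
  have w2 : ⟪η, w⟫_ℝ = 0 := by
    simp [hwdef, inner_sub_right, inner_add_right, real_inner_smul_right, hη, hηξ]
  have w3 : ∀ u, ⟪L u, w⟫_ℝ = 0 := by
    intro u
    simp [hwdef, inner_sub_right, inner_add_right, real_inner_smul_right, h1, h2, hζ]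
  have hww : ⟪w, w⟫_ℝ = 0 := by
    nth_rewrite 1 [← hw]
    simp [inner_add_left, real_inner_smul_left, w1, w2, w3]
  exact sub_eq_zero.1 (inner_self_eq_zero.1 hww)

/-- An adapted pair with nonzero null spaces is, up to order, the only nonnegative pair. -/
theorem AdaptedPair.eq_or_swap (hdim : Module.finrank ℝ V = Module.finrank ℝ E + 2)
    {L : E →L[ℝ] V} (hL : Function.Injective L) {Q : E →L[ℝ] E →L[ℝ] V}
    (hQ : ∀ u v, Q u v = Q v u) {ξ η ξ' η' : V} (h : AdaptedPair L Q ξ η)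
    (hξ : nullSpace Q ξ ≠ ⊥) (hη : nullSpace Q η ≠ ⊥) (h' : NonnegPair L Q ξ' η') :
    (ξ' = ξ ∧ η' = η) ∨ (ξ' = η ∧ η' = ξ) := by
  have hexp := fun {ζ : V} => normal_expansion hdim hL h.normal_left h.normal_right h.norm_left
    h.norm_right h.orth (ζ := ζ)
  have ex := hexp h'.normal_left
  have ey := hexp h'.normal_right
  obtain ⟨x, hx, hx0⟩ := Submodule.exists_mem_ne_zero_of_ne_bot hη
  obtain ⟨y, hy, hy0⟩ := Submodule.exists_mem_ne_zero_of_ne_bot hξ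
  have px := h.pos_left hQ hx hx0
  have py := h.pos_right hQ hy hy0
  have hηξ : ⟪η, ξ⟫_ℝ = 0 := by rw [real_inner_comm]; exact h.orth
  have hxx : ⟪ξ, ξ⟫_ℝ = 1 := by rw [real_inner_self_eq_norm_sq, h.norm_left]; norm_num
  have hyy : ⟪η, η⟫_ℝ = 1 := by rw [real_inner_self_eq_norm_sq, h.norm_right]; norm_num
  have hn1 : ⟪ξ', ξ'⟫_ℝ = 1 := by rw [real_inner_self_eq_norm_sq, h'.norm_left]; norm_num
  have hn2 : ⟪η', η'⟫_ℝ = 1 := by rw [real_inner_self_eq_norm_sq, h'.norm_right]; norm_num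
  have ho := h'.orth
  have q1 := h'.nonneg_left x
  have q2 := h'.nonneg_left y
  have q3 := h'.nonneg_right x
  have q4 := h'.nonneg_right y
  set a := ⟪ξ, ξ'⟫_ℝ
  set b := ⟪η, ξ'⟫_ℝ
  set c := ⟪ξ, η'⟫_ℝ
  set d := ⟪η, η'⟫_ℝ
  rw [ex] at hn1 ho q1 q2 ⊢
  rw [ey] at hn2 ho q3 q4 ⊢
  simp only [inner_add_left, inner_add_right, real_inner_smul_left, real_inner_smul_right,
    h.orth, hηξ, hxx, hyy, mul_zero, mul_one, add_zero, zero_add, hx x, hy y] at *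
  -- In `ξ' = aξ + bη`, `η' = cξ + dη`, the vector `x` only sees the `ξ`-coefficients and `y` only
  -- the `η`-coefficients, so all four are nonnegative. Orthogonality, `ac + bd = 0`, then forces
  -- `ac = bd = 0`.
  have ha : 0 ≤ a := nonneg_of_mul_nonneg_left q1 px
  have hb : 0 ≤ b := nonneg_of_mul_nonneg_left q2 py
  have hc : 0 ≤ c := nonneg_of_mul_nonneg_left q3 px
  have hd : 0 ≤ d := nonneg_of_mul_nonneg_left q4 py
  have hac : a * c = 0 := by nlinarith [mul_nonneg ha hc, mul_nonneg hb hd]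
  have hbd : b * d = 0 := by nlinarith [mul_nonneg ha hc, mul_nonneg hb hd]
  rcases mul_eq_zero.1 hac with h0 | h0
  · have hb1 : b = 1 := by nlinarith
    have hd0 : d = 0 := by simpa [hb1] using hbd
    have hc1 : c = 1 := by nlinarith
    right
    simp [h0, hb1, hd0, hc1]
  · have hd1 : d = 1 := by nlinarith
    have hb0 : b = 0 := by simpa [hd1] using hbd
    have ha1 : a = 1 := by nlinarith
    left
    simp [h0, hb0, hd1, ha1]

end Jets

/-! ### Persistence of adapted pairs under perturbation of the jet -/

section Openness

open Topology Filter

variable {E V : Type*} [NormedAddCommGroup E] [InnerProductSpace ℝ E]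
  [NormedAddCommGroup V] [InnerProductSpace ℝ V]

/-- The form `⟨α(u, u), α(v, v)⟩` of the normal part `α` of `Q` is nonnegative. -/
def NonnegGauss (L : E →L[ℝ] V) (Q : E →L[ℝ] E →L[ℝ] V) [L.range.HasOrthogonalProjection] : Prop :=
  ∀ u v, 0 ≤ ⟪L.rangeᗮ.starProjection (Q u u), L.rangeᗮ.starProjection (Q v v)⟫_ℝ

/-- The null spaces of a nonnegative pair intersect or are complementary. -/
def WideJet (L : E →L[ℝ] V) (Q : E →L[ℝ] E →L[ℝ] V) : Prop :=
  ∀ ξ η, NonnegPair L Q ξ η →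
    nullSpace Q ξ ⊓ nullSpace Q η ≠ ⊥ ∨ IsCompl (nullSpace Q ξ) (nullSpace Q η)

/-- Every clause of `NonnegPair` is a closed condition on the jet and the pair jointly. This is what
allows a compactness argument for the pairs of nearby jets. -/
theorem isClosed_setOf_nonnegPair :
    IsClosed {z : ((E →L[ℝ] V) × (E →L[ℝ] E →L[ℝ] V)) × (V × V) |
      NonnegPair z.1.1 z.1.2 z.2.1 z.2.2} := by
  have h : {z : ((E →L[ℝ] V) × (E →L[ℝ] E →L[ℝ] V)) × (V × V) |
      NonnegPair z.1.1 z.1.2 z.2.1 z.2.2} =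
      {z | (∀ u, ⟪z.1.1 u, z.2.1⟫_ℝ = 0) ∧ (∀ u, ⟪z.1.1 u, z.2.2⟫_ℝ = 0) ∧ ‖z.2.1‖ = 1 ∧
        ‖z.2.2‖ = 1 ∧ ⟪z.2.1, z.2.2⟫_ℝ = 0 ∧ (∀ u, 0 ≤ ⟪z.1.2 u u, z.2.1⟫_ℝ) ∧
        (∀ u, 0 ≤ ⟪z.1.2 u u, z.2.2⟫_ℝ)} := by
    ext z
    exact ⟨fun h => ⟨h.1, h.2, h.3, h.4, h.5, h.6, h.7⟩,
      fun ⟨h1, h2, h3, h4, h5, h6, h7⟩ => ⟨h1, h2, h3, h4, h5, h6, h7⟩⟩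
  rw [h]
  simp only [ofPred_and, ofPred_forall]
  refine IsClosed.inter (isClosed_iInter fun u => isClosed_eq (by fun_prop) continuous_const) <|
    IsClosed.inter (isClosed_iInter fun u => isClosed_eq (by fun_prop) continuous_const) <|
    IsClosed.inter (isClosed_eq (by fun_prop) continuous_const) <|
    IsClosed.inter (isClosed_eq (by fun_prop) continuous_const) <|
    IsClosed.inter (isClosed_eq (by fun_prop) continuous_const) <|
    IsClosed.inter (isClosed_iInter fun u => isClosed_le continuous_const (by fun_prop))
      (isClosed_iInter fun u => isClosed_le continuous_const (by fun_prop))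

variable [FiniteDimensional ℝ E] [FiniteDimensional ℝ V]

/-- The nonnegative pairs of a nearby jet are close to the adapted pair, up to order. -/
theorem AdaptedPair.eventually_mem_or_swap
    (hdim : Module.finrank ℝ V = Module.finrank ℝ E + 2)
    {L : E →L[ℝ] V} (hL : Function.Injective L) {Q : E →L[ℝ] E →L[ℝ] V}
    (hQ : ∀ u v, Q u v = Q v u) {ξ η : V} (h : AdaptedPair L Q ξ η)
    (hξ : nullSpace Q ξ ≠ ⊥) (hη : nullSpace Q η ≠ ⊥) {O : Set (V × V)} (hO : O ∈ 𝓝 (ξ, η)) :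
    ∀ᶠ j : (E →L[ℝ] V) × (E →L[ℝ] E →L[ℝ] V) in 𝓝 (L, Q), ∀ ξ' η' : V,
      NonnegPair j.1 j.2 ξ' η' → (ξ', η') ∈ O ∨ (η', ξ') ∈ O := by
  -- Pairs of unit vectors away from `(ξ, η)` and `(η, ξ)` form a compact set. By uniqueness it
  -- contains no nonnegative pair of `(L, Q)`, so by closedness none of a nearby jet.
  let C : Set (V × V) := Metric.sphere 0 1 ×ˢ Metric.sphere 0 1 \
    (interior O ∪ Prod.swap ⁻¹' interior O)
  have hC : IsCompact C := ((isCompact_sphere 0 1).prod (isCompact_sphere 0 1)).diff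
    (isOpen_interior.union (isOpen_interior.preimage continuous_swap))
  have hO' : (ξ, η) ∈ interior O := mem_interior_iff_mem_nhds.2 hO
  have key : ∀ᶠ j : (E →L[ℝ] V) × (E →L[ℝ] E →L[ℝ] V) in 𝓝 (L, Q), ∀ z ∈ C,
      ¬ NonnegPair j.1 j.2 z.1 z.2 := by
    refine hC.eventually_forall_of_forall_eventually fun z hz => ?_
    have hz' : ¬ NonnegPair L Q z.1 z.2 := by
      intro hn
      rcases h.eq_or_swap hdim hL hQ hξ hη hn with ⟨h1, h2⟩ | ⟨h1, h2⟩
      · refine hz.2 (Or.inl ?_)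
        have : z = (ξ, η) := Prod.ext h1 h2
        rwa [this]
      · refine hz.2 (Or.inr ?_)
        have : z = (η, ξ) := Prod.ext h1 h2
        rw [this]
        exact hO'
    exact isClosed_setOf_nonnegPair.isOpen_compl.mem_nhds hz'
  filter_upwards [key] with j hj ξ' η' hn
  by_contra! hcon
  refine hj (ξ', η') ⟨⟨?_, ?_⟩, ?_⟩ hn
  · simpa using hn.norm_left
  · simpa using hn.norm_right
  · rintro (h1 | h1)
    · exact hcon.1 (interior_subset h1)
    · exact hcon.2 (interior_subset h1)

/-- The null space does not jump up near a form which is positive on a complement. -/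
theorem eventually_finrank_nullSpace_le {Q : E →L[ℝ] E →L[ℝ] V} {ξ : V} {W : Submodule ℝ E}
    (hW : IsCompl (nullSpace Q ξ) W) (hpos : ∀ u ∈ W, u ≠ 0 → 0 < ⟪Q u u, ξ⟫_ℝ) :
    ∀ᶠ z : (E →L[ℝ] E →L[ℝ] V) × V in 𝓝 (Q, ξ),
      Module.finrank ℝ (nullSpace z.1 z.2) ≤ Module.finrank ℝ (nullSpace Q ξ) := by
  have hK : IsCompact (Metric.sphere (0 : E) 1 ∩ W) :=
    (isCompact_sphere 0 1).inter_right W.closed_of_finiteDimensional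
  -- Positivity on the compact unit sphere of `W` is an open condition; it keeps the null space of a
  -- nearby form disjoint from `W` and so bounds its dimension.
  have key : ∀ᶠ z : (E →L[ℝ] E →L[ℝ] V) × V in 𝓝 (Q, ξ),
      ∀ u ∈ Metric.sphere (0 : E) 1 ∩ W, 0 < ⟪z.1 u u, z.2⟫_ℝ := by
    refine hK.eventually_forall_of_forall_eventually fun u hu => ?_
    have hc : Continuous fun z : ((E →L[ℝ] E →L[ℝ] V) × V) × E => ⟪z.1.1 z.2 z.2, z.1.2⟫_ℝ := by
      fun_prop
    refine hc.continuousAt.eventually_const_lt ?_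
    refine hpos u hu.2 ?_
    rintro rfl
    simpa using hu.1
  filter_upwards [key] with z hz
  have hd : Disjoint (nullSpace z.1 z.2) W := by
    rw [Submodule.disjoint_def]
    intro u hu huW
    by_contra hu0
    have := hz (‖u‖⁻¹ • u) ⟨by simp [norm_smul, hu0], W.smul_mem _ huW⟩
    simp only [map_smul, smul_apply, real_inner_smul_left, hu u, mul_zero] at this
    exact lt_irrefl _ this
  have h1 := Submodule.finrank_add_finrank_le_of_disjoint hd
  have h2 := Submodule.finrank_add_eq_of_isCompl hW
  omega

/-- A normal vector extends continuously to a normal field. -/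
theorem exists_continuousAt_normal {L : E →L[ℝ] V} (hL : Function.Injective L) {e : V}
    (he : ∀ u, ⟪L u, e⟫_ℝ = 0) :
    ∃ ν : (E →L[ℝ] V) → V, ContinuousAt ν L ∧ ν L = e ∧
      ∀ᶠ L' in 𝓝 L, ∀ u, ⟪L' u, ν L'⟫_ℝ = 0 := by
  let S : (E →L[ℝ] V) → (E →L[ℝ] E) := fun L' => L'.adjoint ∘L L'
  have hS : Continuous S :=
    (ContinuousLinearMap.adjoint.continuous).clm_comp continuous_id
  have hadj : L.adjoint e = 0 := by
    refine ext_inner_left ℝ fun u => ?_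
    rw [ContinuousLinearMap.adjoint_inner_right, he, inner_zero_right]
  have hinj : Function.Injective (S L).toLinearMap := by
    rw [← LinearMap.ker_eq_bot, LinearMap.ker_eq_bot']
    intro u hu
    have h1 : ⟪L u, L u⟫_ℝ = 0 := by
      rw [← ContinuousLinearMap.adjoint_inner_right]
      have : L.adjoint (L u) = 0 := hu
      rw [this, inner_zero_right]
    exact hL ((inner_self_eq_zero.1 h1).trans (map_zero L).symm)
  let Λ : E ≃L[ℝ] E := (LinearEquiv.ofInjectiveEndo _ hinj).toContinuousLinearEquiv
  have hΛ : (Λ : E →L[ℝ] E) = S L := by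
    ext u
    rfl
  have hinv : ContinuousAt (ContinuousLinearMap.inverse (R := ℝ) (M := E) (M₂ := E)) (S L) := by
    rw [← hΛ]
    exact (contDiffAt_map_inverse (𝕜 := ℝ) (n := 0) Λ).continuousAt
  -- The field is the orthogonal projection of `e` to the complement of the range of `L'`, written
  -- with the Gram operator `L'* L'`, which is invertible at `L` and hence near it.
  refine ⟨fun L' => e - L' ((S L').inverse (L'.adjoint e)), ?_, ?_, ?_⟩
  · have h1 : ContinuousAt (fun L' => (S L').inverse) L :=
      ContinuousAt.comp (f := S) hinv hS.continuousAt
    have h2 : Continuous fun L' : E →L[ℝ] V => L'.adjoint e :=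
      (ContinuousLinearMap.adjoint.continuous).clm_apply continuous_const
    exact continuousAt_const.sub (continuousAt_id.clm_apply (h1.clm_apply h2.continuousAt))
  · simp [hadj]
  · have hev : ∀ᶠ L' in 𝓝 L, (S L').IsInvertible := by
      have : {T : E →L[ℝ] E | T.IsInvertible} ∈ 𝓝 (S L) := by
        rw [← hΛ]
        exact ContinuousLinearEquiv.nhds Λ
      exact hS.continuousAt.eventually this
    filter_upwards [hev] with L' hL' u
    rw [← ContinuousLinearMap.adjoint_inner_right, map_sub]
    have : L'.adjoint (L' ((S L').inverse (L'.adjoint e))) = L'.adjoint e := by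
      obtain ⟨M, hM⟩ := hL'
      change S L' ((S L').inverse (L'.adjoint e)) = _
      rw [← hM, ContinuousLinearMap.inverse_equiv]
      exact M.apply_symm_apply _
    rw [this, sub_self, inner_zero_right]

/-- A form with nonnegative curvature which is positive along a normal vector has a nonnegative
pair. -/
theorem exists_nonnegPair (hdim : Module.finrank ℝ V = Module.finrank ℝ E + 2)
    {L : E →L[ℝ] V} {Q : E →L[ℝ] E →L[ℝ] V} (hL : Function.Injective L) (hG : NonnegGauss L Q)
    (hEne : (Metric.sphere (0 : E) 1).Nonempty) {e : V} (hn : ∀ u, ⟪L u, e⟫_ℝ = 0)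
    (hj : ∀ u ∈ Metric.sphere (0 : E) 1, 0 < ⟪Q u u, e⟫_ℝ) :
    ∃ ξ η : V, NonnegPair L Q ξ η ∧ nullSpace Q ξ ⊓ nullSpace Q η = ⊥ := by
  set N := L.rangeᗮ with hN
  have memN : ∀ {w}, (∀ u, ⟪L u, w⟫_ℝ = 0) → w ∈ N := by
    intro w hw
    rw [hN, Submodule.mem_orthogonal]
    rintro _ ⟨u, rfl⟩
    exact hw u
  have memN' : ∀ {w}, w ∈ N → ∀ u, ⟪L u, w⟫_ℝ = 0 := by
    intro w hw u
    exact (Submodule.mem_orthogonal _ _).1 hw _ ⟨u, rfl⟩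
  have hinner : ∀ {w}, w ∈ N → ∀ x, ⟪N.starProjection x, w⟫_ℝ = ⟪x, w⟫_ℝ := by
    intro w hw x
    rw [Submodule.inner_starProjection_left_eq_right, Submodule.starProjection_eq_self_iff.2 hw]
  -- The second normal direction: the range of `L` and `e` span at most `dim E + 1` of the `dim E +
  -- 2` dimensions.
  obtain ⟨e', he', he'0⟩ : ∃ e' ∈ (L.range ⊔ Submodule.span ℝ {e})ᗮ, e' ≠ 0 := by
    refine Submodule.exists_mem_ne_zero_of_ne_bot ?_
    rw [Ne, Submodule.orthogonal_eq_bot_iff]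
    intro htop
    have h1 := Submodule.finrank_add_le_finrank_add_finrank L.range (Submodule.span ℝ {e})
    rw [htop, finrank_top] at h1
    have h2 := LinearMap.finrank_range_le L.toLinearMap
    have h3 := finrank_span_le_card (R := ℝ) ({e} : Set V)
    rw [toFinset_singleton, Finset.card_singleton] at h3
    change Module.finrank ℝ L.range ≤ _ at h2
    omega
  have he'N : e' ∈ N := Submodule.orthogonal_le le_sup_left he'
  have he'e : ⟪e, e'⟫_ℝ = 0 := (Submodule.mem_orthogonal _ _).1 he' _
    (Submodule.mem_sup_right (Submodule.mem_span_singleton_self _))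
  -- `K` consists of the values `α(u, u)` on unit vectors: the curvature condition bounds the angles
  -- between them, and positivity along `e` puts them in an open half plane.
  obtain ⟨ξ', hξ', η', hη', n1, n2, ho, hq⟩ := exists_quadrant_frame (N := N)
    (K := (fun u => N.starProjection (Q u u)) '' Metric.sphere (0 : E) 1)
    ((isCompact_sphere 0 1).image (by fun_prop)) (hEne.image _)
    (by rintro _ ⟨u, -, rfl⟩; exact Submodule.starProjection_apply_mem _ _)
    (by rintro _ ⟨u, -, rfl⟩ _ ⟨v, -, rfl⟩; exact hG u v)
    (memN hn) he'N he'0 he'e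
    (by rintro _ ⟨u, hu, rfl⟩; rw [hinner (memN hn)]; exact hj u hu)
  have hq' : ∀ u, 0 ≤ ⟪Q u u, ξ'⟫_ℝ ∧ 0 ≤ ⟪Q u u, η'⟫_ℝ := by
    intro u
    by_cases hu0 : u = 0
    · simp [hu0]
    have h1 := hq _ ⟨‖u‖⁻¹ • u, by simp [norm_smul, hu0], rfl⟩
    simp only [hinner hξ', hinner hη', map_smul, smul_apply, real_inner_smul_left] at h1
    have hp : 0 < ‖u‖⁻¹ := inv_pos.2 (norm_pos_iff.2 hu0)
    exact ⟨by simpa [hp] using h1.1, by simpa [hp] using h1.2⟩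
  have hpair : NonnegPair L Q ξ' η' := ⟨memN' hξ', memN' hη', n1, n2, ho,
    fun u => (hq' u).1, fun u => (hq' u).2⟩
  refine ⟨ξ', η', hpair, ?_⟩
  rw [eq_bot_iff]
  rintro u ⟨hu1, hu2⟩
  by_contra hu0
  have hu0' : u ≠ 0 := hu0
  have h1 := hj (‖u‖⁻¹ • u) (by simp [norm_smul, hu0'])
  -- Since `e` is a combination of `ξ'` and `η'`, a common null vector would be isotropic along `e`.
  rw [normal_expansion hdim hL hpair.normal_left hpair.normal_right n1 n2 ho hn] at h1
  simp only [inner_add_right, real_inner_smul_right, map_smul, smul_apply, real_inner_smul_left,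
    hu1 u, hu2 u, mul_zero, add_zero] at h1
  exact lt_irrefl _ h1

/-- Existence of adapted pairs close to a given one for nearby jets. -/
theorem AdaptedPair.eventually_exists
    (hdim : Module.finrank ℝ V = Module.finrank ℝ E + 2)
    {L : E →L[ℝ] V} (hL : Function.Injective L) {Q : E →L[ℝ] E →L[ℝ] V}
    (hQ : ∀ u v, Q u v = Q v u) {ξ η : V} (h : AdaptedPair L Q ξ η)
    (hξ : nullSpace Q ξ ≠ ⊥) (hη : nullSpace Q η ≠ ⊥) {O : Set (V × V)} (hO : O ∈ 𝓝 (ξ, η)) :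
    ∀ᶠ j : (E →L[ℝ] V) × (E →L[ℝ] E →L[ℝ] V) in 𝓝 (L, Q), Function.Injective j.1 →
      (∀ u v, j.2 u v = j.2 v u) → NonnegGauss j.1 j.2 → WideJet j.1 j.2 →
      ∃ ξ' η' : V, (ξ', η') ∈ O ∧ AdaptedPair j.1 j.2 ξ' η' ∧
        Module.finrank ℝ (nullSpace j.2 ξ') = Module.finrank ℝ (nullSpace Q ξ) ∧
        Module.finrank ℝ (nullSpace j.2 η') = Module.finrank ℝ (nullSpace Q η) := by
  have hEne : (Metric.sphere (0 : E) 1).Nonempty := by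
    obtain ⟨x, -, hx0⟩ := Submodule.exists_mem_ne_zero_of_ne_bot hη
    exact ⟨‖x‖⁻¹ • x, by simp [norm_smul, hx0]⟩
  -- The form along `ξ + η` is positive definite, and remains so along the nearby normal vectors
  -- extending `ξ + η`.
  obtain ⟨ν, hνc, hν0, hνn⟩ := exists_continuousAt_normal hL (e := ξ + η)
    (fun u => by rw [inner_add_right, h.normal_left, h.normal_right, add_zero])
  have hpos : ∀ᶠ j : (E →L[ℝ] V) × (E →L[ℝ] E →L[ℝ] V) in 𝓝 (L, Q),
      ∀ u ∈ Metric.sphere (0 : E) 1, 0 < ⟪j.2 u u, ν j.1⟫_ℝ := by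
    refine (isCompact_sphere (0 : E) 1).eventually_forall_of_forall_eventually fun u hu => ?_
    have h1 : ContinuousAt (fun z : ((E →L[ℝ] V) × (E →L[ℝ] E →L[ℝ] V)) × E => ν z.1.1)
        ((L, Q), u) := ContinuousAt.comp (f := fun z : ((E →L[ℝ] V) × (E →L[ℝ] E →L[ℝ] V)) × E =>
          z.1.1) hνc (by fun_prop)
    have hc : ContinuousAt (fun z : ((E →L[ℝ] V) × (E →L[ℝ] E →L[ℝ] V)) × E =>
        ⟪z.1.2 z.2 z.2, ν z.1.1⟫_ℝ) ((L, Q), u) := by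
      refine ContinuousAt.inner ?_ h1
      have : Continuous fun z : ((E →L[ℝ] V) × (E →L[ℝ] E →L[ℝ] V)) × E => z.1.2 z.2 z.2 := by
        fun_prop
      exact this.continuousAt
    refine hc.eventually_const_lt ?_
    simp only [hν0]
    refine h.toNonnegPair.pos_add h.compl.disjoint hQ ?_
    rintro rfl
    simp at hu
  have hfst : Tendsto (fun j : (E →L[ℝ] V) × (E →L[ℝ] E →L[ℝ] V) => j.1) (𝓝 (L, Q)) (𝓝 L) :=
    continuous_fst.tendsto _
  have hr1 := eventually_finrank_nullSpace_le h.compl fun u hu hu0 => h.pos_left hQ hu hu0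
  have hr2 := eventually_finrank_nullSpace_le h.compl.symm fun u hu hu0 => h.pos_right hQ hu hu0
  rw [nhds_prod_eq] at hr1 hr2
  obtain ⟨A1, hA1, B1, hB1, hAB1⟩ := eventually_prod_iff.1 hr1
  obtain ⟨A2, hA2, B2, hB2, hAB2⟩ := eventually_prod_iff.1 hr2
  have hsnd : Tendsto (fun j : (E →L[ℝ] V) × (E →L[ℝ] E →L[ℝ] V) => j.2) (𝓝 (L, Q)) (𝓝 Q) :=
    continuous_snd.tendsto _
  -- `O` is shrunk so that the dimension bounds hold for every pair found in it.
  have hO2 : {z : V × V | z ∈ O ∧ B1 z.1 ∧ B2 z.2} ∈ 𝓝 (ξ, η) := by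
    refine inter_mem hO ?_
    rw [nhds_prod_eq]
    exact hB1.prod_mk hB2
  filter_upwards [hpos, hfst.eventually hνn, hsnd.eventually hA1,
    hsnd.eventually hA2,
    h.eventually_mem_or_swap hdim hL hQ hξ hη hO2] with j hj hn hj1 hj2 hswap hinj hsymm hG hwide
  obtain ⟨ξ', η', hpair, hdisj⟩ := exists_nonnegPair hdim hinj hG hEne hn hj
  have hcompl := (hwide _ _ hpair).resolve_left fun hne => hne hdisj
  have final : ∀ ξ' η' : V, ((ξ', η') ∈ O ∧ B1 ξ' ∧ B2 η') → AdaptedPair j.1 j.2 ξ' η' →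
      ∃ ξ' η' : V, (ξ', η') ∈ O ∧ AdaptedPair j.1 j.2 ξ' η' ∧
        Module.finrank ℝ (nullSpace j.2 ξ') = Module.finrank ℝ (nullSpace Q ξ) ∧
        Module.finrank ℝ (nullSpace j.2 η') = Module.finrank ℝ (nullSpace Q η) := by
    intro ξ' η' hm ha
    -- Neither null space can grow, and in both jets the two dimensions add up to `dim E`; hence
    -- both are unchanged.
    have l1 : Module.finrank ℝ (nullSpace j.2 ξ') ≤ Module.finrank ℝ (nullSpace Q ξ) :=
      hAB1 hj1 hm.2.1
    have l2 : Module.finrank ℝ (nullSpace j.2 η') ≤ Module.finrank ℝ (nullSpace Q η) :=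
      hAB2 hj2 hm.2.2
    have s1 := Submodule.finrank_add_eq_of_isCompl h.compl
    have s2 := Submodule.finrank_add_eq_of_isCompl ha.compl
    exact ⟨ξ', η', hm.1, ha, by omega, by omega⟩
  have hadp : AdaptedPair j.1 j.2 ξ' η' := ⟨hpair, hcompl⟩
  rcases hswap ξ' η' hpair with hm | hm
  · exact final _ _ hm hadp
  · exact final _ _ hm hadp.swap

end Openness

/-! ### Smooth dependence of the frame on the jet -/

section SmoothFrame

open Topology Filter

variable {E V : Type*} [NormedAddCommGroup E] [InnerProductSpace ℝ E]
  [NormedAddCommGroup V] [InnerProductSpace ℝ V]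

/-- The Gram matrix of the form `⟨Q(u, v), ζ⟩` with respect to a family of vectors. -/
def formMatrix {ι : Type*} (b : ι → E) (Q : E →L[ℝ] E →L[ℝ] V) (ζ : V) : Matrix ι ι ℝ :=
  Matrix.of fun i j => ⟪Q (b i) (b j), ζ⟫_ℝ

theorem vecMul_formMatrix {ι : Type*} [Fintype ι] (b : ι → E) (Q : E →L[ℝ] E →L[ℝ] V) (ζ : V)
    (c : ι → ℝ) (j : ι) :
    Matrix.vecMul c (formMatrix b Q ζ) j = ⟪Q (∑ i, c i • b i) (b j), ζ⟫_ℝ := by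
  simp [Matrix.vecMul, dotProduct, formMatrix, map_sum, sum_inner, real_inner_smul_left]

/-- There are more vectors than the codimension of the null space, so some nontrivial combination of
coefficients is sent into it. -/
theorem det_formMatrix_eq_zero {ι : Type*} [Fintype ι] [DecidableEq ι] [FiniteDimensional ℝ E]
    (b : ι → E) (Q : E →L[ℝ] E →L[ℝ] V) (ζ : V)
    (h : Module.finrank ℝ E < Fintype.card ι + Module.finrank ℝ (nullSpace Q ζ)) :
    (formMatrix b Q ζ).det = 0 := by
  let Λ : (ι → ℝ) →ₗ[ℝ] E ⧸ nullSpace Q ζ :=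
    (nullSpace Q ζ).mkQ.comp (Fintype.linearCombination ℝ b)
  have hlt : Module.finrank ℝ (E ⧸ nullSpace Q ζ) < Module.finrank ℝ (ι → ℝ) := by
    have := Submodule.finrank_quotient_add_finrank (nullSpace Q ζ)
    rw [Module.finrank_fintype_fun_eq_card]
    omega
  obtain ⟨c, hc, hc0⟩ := Submodule.exists_mem_ne_zero_of_ne_bot
    (LinearMap.ker_ne_bot_of_finrank_lt hlt)
  rw [← Matrix.exists_vecMul_eq_zero_iff]
  refine ⟨c, hc0, ?_⟩
  ext j
  rw [vecMul_formMatrix]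
  have : (Fintype.linearCombination ℝ b) c ∈ nullSpace Q ζ := by
    have h0 : Λ c = 0 := hc
    exact (Submodule.Quotient.mk_eq_zero _).1 h0
  exact this (b j)

/-- A null vector of the matrix would give a nonzero `w` in the span with `⟪Q w w, ζ⟫ = 0`. -/
theorem det_formMatrix_ne_zero {ι : Type*} [Fintype ι] [DecidableEq ι]
    (b : ι → E) (hb : LinearIndependent ℝ b) (Q : E →L[ℝ] E →L[ℝ] V) (ζ : V)
    (h : ∀ u ∈ Submodule.span ℝ (range b), u ≠ 0 → 0 < ⟪Q u u, ζ⟫_ℝ) :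
    (formMatrix b Q ζ).det ≠ 0 := by
  rw [Ne, ← Matrix.exists_vecMul_eq_zero_iff]
  rintro ⟨c, hc0, hc⟩
  set w := ∑ i, c i • b i with hw
  have hw0 : w ≠ 0 := by
    intro h0
    exact hc0 (funext fun i => Fintype.linearIndependent_iff.1 hb c h0 i)
  have hwm : w ∈ Submodule.span ℝ (range b) :=
    Submodule.sum_mem _ fun i _ => Submodule.smul_mem _ _ (Submodule.subset_span ⟨i, rfl⟩)
  have h1 := h w hwm hw0
  have h2 : ⟪Q w w, ζ⟫_ℝ = ∑ j, c j * ⟪Q w (b j), ζ⟫_ℝ := by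
    conv_lhs => enter [2, 2]; rw [hw]
    simp [map_sum, sum_inner, real_inner_smul_left]
  rw [h2, Finset.sum_eq_zero] at h1
  · exact lt_irrefl _ h1
  · intro j _
    rw [hw, ← vecMul_formMatrix, hc]
    simp

/-- The mixed entries vanish, because the `b i` are null for `η` and `v` is null for `ξ`; the matrix
is block diagonal. The resulting linearity in `t` shows that the determinant has a simple zero at
`ξ` in the direction `η`, when the other two factors are nonzero. -/
theorem det_formMatrix_sum {ι : Type*} [Fintype ι] [DecidableEq ι]
    {Q : E →L[ℝ] E →L[ℝ] V} {ξ η : V} (hQ : ∀ u v, Q u v = Q v u) (b : ι → E)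
    (hb : ∀ i, b i ∈ nullSpace Q η) {v : E} (hv : v ∈ nullSpace Q ξ) (t : ℝ) :
    (formMatrix (Sum.elim b fun _ : Unit => v) Q (ξ + t • η)).det =
      (formMatrix b Q ξ).det * (t * ⟪Q v v, η⟫_ℝ) := by
  have hM : formMatrix (Sum.elim b fun _ : Unit => v) Q (ξ + t • η) =
      Matrix.fromBlocks (formMatrix b Q ξ) 0 0 (Matrix.of fun _ _ => t * ⟪Q v v, η⟫_ℝ) := by
    ext i j
    rcases i with i | i <;> rcases j with j | j
    · simp [formMatrix, inner_add_right, real_inner_smul_right, hb i (b j)]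
    · simp [formMatrix, inner_add_right, real_inner_smul_right, hQ (b i) v, hv (b i)]
      right
      rw [hQ v (b i)]
      exact hb i v
    · simp [formMatrix, inner_add_right, real_inner_smul_right, hQ v (b j), hb j v]
      rw [hQ (b j) v]
      exact hv (b j)
    · simp [formMatrix, inner_add_right, real_inner_smul_right, hv v]
  rw [hM, Matrix.det_fromBlocks_zero₁₂, Matrix.det_unique (n := Unit)]
  rfl

theorem contDiff_det_formMatrix {ι : Type*} [Fintype ι] [DecidableEq ι] (b : ι → E) :
    ContDiff ℝ ∞ fun z : (E →L[ℝ] E →L[ℝ] V) × V => (formMatrix b z.1 z.2).det := by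
  simp only [Matrix.det_apply, formMatrix, Matrix.of_apply]
  refine ContDiff.sum fun σ _ => ContDiff.const_smul _ (contDiff_prod fun i _ => ?_)
  refine ContDiff.inner ℝ ?_ contDiff_snd
  exact (contDiff_fst.clm_apply contDiff_const).clm_apply contDiff_const

variable [FiniteDimensional ℝ E] [FiniteDimensional ℝ V]

/-- The implicit function theorem in finite dimensions, the invertibility of the partial
derivative being tested on lines. -/
theorem exists_implicitFunction {J X F : Type*} [NormedAddCommGroup J] [NormedSpace ℝ J]
    [CompleteSpace J] [NormedAddCommGroup X] [NormedSpace ℝ X] [FiniteDimensional ℝ X]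
    [NormedAddCommGroup F] [NormedSpace ℝ F] [FiniteDimensional ℝ F]
    (hfr : Module.finrank ℝ X = Module.finrank ℝ F) {H : J × X → F} (hH : ContDiff ℝ ∞ H)
    (j₀ : J) (x₀ : X)
    (hline : ∀ ζ : X, HasDerivAt (fun t : ℝ => H (j₀, x₀ + t • ζ)) 0 0 → ζ = 0) :
    ∃ φ : J → X, ContDiffAt ℝ ∞ φ j₀ ∧ φ j₀ = x₀ ∧ ∃ O ∈ 𝓝 x₀, ∀ᶠ j in 𝓝 j₀, ∀ x ∈ O,
      H (j, x) = H (j₀, x₀) → φ j = x := by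
  have := FiniteDimensional.complete ℝ X
  have := FiniteDimensional.complete ℝ F
  have hHat : ContDiffAt ℝ ∞ H (j₀, x₀) := hH.contDiffAt
  let T : X →L[ℝ] F := fderiv ℝ H (j₀, x₀) ∘L .inr ℝ J X
  have hTinj : Function.Injective T.toLinearMap := by
    rw [← LinearMap.ker_eq_bot, LinearMap.ker_eq_bot']
    intro ζ hζ
    refine hline ζ ?_
    have h1 : HasFDerivAt H (fderiv ℝ H (j₀, x₀)) ((j₀, x₀ + (0 : ℝ) • ζ)) := by
      rw [zero_smul, add_zero]
      exact (hH.differentiable (by simp)).differentiableAt.hasFDerivAt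
    have h2 : HasDerivAt (fun t : ℝ => (j₀, x₀ + t • ζ)) (0, ζ) 0 := by
      refine (hasDerivAt_const (0 : ℝ) j₀).prodMk ?_
      simpa using ((hasDerivAt_id (0 : ℝ)).smul_const ζ).const_add x₀
    have h3 := h1.comp_hasDerivAt (0 : ℝ) h2
    have h4 : fderiv ℝ H (j₀, x₀) (0, ζ) = 0 := hζ
    rw [h4] at h3
    exact h3
  have hTinv : T.IsInvertible :=
    ⟨(LinearEquiv.ofInjectiveOfFinrankEq T.toLinearMap hTinj hfr).toContinuousLinearEquiv, by
      ext x; rfl⟩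
  refine ⟨hHat.implicitFunction (by simp) hTinv, hHat.contDiffAt_implicitFunction (by simp) hTinv,
    hHat.implicitFunction_apply_self (by simp) hTinv, ?_⟩
  have hev := hHat.eventually_apply_eq_iff_implicitFunction (by simp) hTinv
  rw [nhds_prod_eq] at hev
  obtain ⟨A, hA, B, hB, hAB⟩ := eventually_prod_iff.1 hev
  refine ⟨{x | B x}, hB, ?_⟩
  filter_upwards [hA] with j hj x hx
  exact (hAB hj hx).1

set_option synthInstance.maxHeartbeats 200000 in
/-- The first vector of an adapted pair is a smooth function of the jet. -/
theorem AdaptedPair.exists_contDiffAt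
    (hdim : Module.finrank ℝ V = Module.finrank ℝ E + 2)
    {L : E →L[ℝ] V} (hL : Function.Injective L) {Q : E →L[ℝ] E →L[ℝ] V}
    (hQ : ∀ u v, Q u v = Q v u) {ξ η : V} (h : AdaptedPair L Q ξ η)
    (hξ : nullSpace Q ξ ≠ ⊥) :
    ∃ φ : (E →L[ℝ] V) × (E →L[ℝ] E →L[ℝ] V) → V, ContDiffAt ℝ ∞ φ (L, Q) ∧ φ (L, Q) = ξ ∧
      ∃ O : Set V, O ∈ 𝓝 ξ ∧ ∀ᶠ j : (E →L[ℝ] V) × (E →L[ℝ] E →L[ℝ] V) in 𝓝 (L, Q),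
        ∀ ξ' ∈ O, (∀ u, ⟪j.1 u, ξ'⟫_ℝ = 0) → ‖ξ'‖ = 1 →
          Module.finrank ℝ (nullSpace j.2 ξ') = Module.finrank ℝ (nullSpace Q ξ) → φ j = ξ' := by
  obtain ⟨v, hv, hv0⟩ := Submodule.exists_mem_ne_zero_of_ne_bot hξ
  let b := Module.finBasis ℝ (nullSpace Q η)
  -- A basis of the null space of `η`, where the form along `ξ` is definite, enlarged by one null
  -- vector of `ξ`: one vector more than the rank along `ξ`, so the Gram determinant vanishes there.
  let b' : Fin (Module.finrank ℝ (nullSpace Q η)) ⊕ Unit → E :=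
    Sum.elim (fun i => (b i : E)) fun _ => v
  have hcard : Module.finrank ℝ E < Fintype.card (Fin (Module.finrank ℝ (nullSpace Q η)) ⊕ Unit) +
      Module.finrank ℝ (nullSpace Q ξ) := by
    have := Submodule.finrank_add_eq_of_isCompl h.compl
    simp
    omega
  have hdet : (formMatrix (fun i => (b i : E)) Q ξ).det ≠ 0 := by
    refine det_formMatrix_ne_zero _ ?_ Q ξ fun u hu hu0 => ?_
    · exact b.linearIndependent.map' (nullSpace Q η).subtype (Submodule.ker_subtype _)
    · refine h.pos_left hQ ?_ hu0
      refine Submodule.span_le.2 ?_ hu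
      rintro _ ⟨i, rfl⟩
      exact (b i).2
  have hvv := h.pos_right hQ hv hv0
  -- The equations for the vector: orthogonal to the range of the jet, of given length, with
  -- degenerate Gram matrix. Their number `dim E + 1 + 1` is `dim V`. Vanishing of the determinant
  -- is only a necessary consequence of the null space having the prescribed dimension, which is
  -- enough for uniqueness.
  let H : ((E →L[ℝ] V) × (E →L[ℝ] E →L[ℝ] V)) × V → (E →L[ℝ] ℝ) × ℝ × ℝ := fun z =>
    ((innerSL ℝ z.2) ∘L z.1.1, ⟪z.2, z.2⟫_ℝ, (formMatrix b' z.1.2 z.2).det)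
  have hH : ContDiff ℝ ∞ H := by
    refine ContDiff.prodMk ?_ (ContDiff.prodMk ?_ ?_)
    · exact ((innerSL ℝ).contDiff.comp contDiff_snd).clm_comp (contDiff_fst.comp contDiff_fst)
    · exact contDiff_snd.inner ℝ contDiff_snd
    · exact (contDiff_det_formMatrix b').comp
        ((contDiff_snd.comp contDiff_fst).prodMk contDiff_snd)
  have hfr : Module.finrank ℝ V = Module.finrank ℝ ((E →L[ℝ] ℝ) × ℝ × ℝ) := by
    rw [Module.finrank_prod, Module.finrank_prod, Module.finrank_self, hdim,
      ← (LinearMap.toContinuousLinearMap (𝕜 := ℝ) (E := E) (F' := ℝ)).finrank_eq]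
    rw [show Module.finrank ℝ (E →ₗ[ℝ] ℝ) = Module.finrank ℝ E from Subspace.dual_finrank_eq]
  have hline : ∀ ζ, HasDerivAt (fun t : ℝ => H ((L, Q), ξ + t • ζ)) 0 0 → ζ = 0 := by
    intro ζ hl
    have l1 : ∀ u, ⟪L u, ζ⟫_ℝ = 0 := by
      intro u
      have d1 := (((ContinuousLinearMap.apply ℝ ℝ u).comp
        (ContinuousLinearMap.fst ℝ (E →L[ℝ] ℝ) (ℝ × ℝ))).hasFDerivAt).comp_hasDerivAt (0 : ℝ) hl
      have d2 : HasDerivAt (fun t : ℝ => ⟪ξ, L u⟫_ℝ + t * ⟪ζ, L u⟫_ℝ) (1 * ⟪ζ, L u⟫_ℝ) 0 :=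
        ((hasDerivAt_id (0 : ℝ)).mul_const _).const_add _
      have e : (fun t : ℝ => ⟪ξ, L u⟫_ℝ + t * ⟪ζ, L u⟫_ℝ) =
          ((ContinuousLinearMap.apply ℝ ℝ u).comp
            (ContinuousLinearMap.fst ℝ (E →L[ℝ] ℝ) (ℝ × ℝ))) ∘
            fun t : ℝ => H ((L, Q), ξ + t • ζ) := by
        funext t
        simp [H]
      rw [e] at d2
      have := d2.unique d1
      rw [one_mul, map_zero] at this
      rw [real_inner_comm]
      exact this
    have l2 : ⟪ξ, ζ⟫_ℝ = 0 := by
      have d1 := (((ContinuousLinearMap.fst ℝ ℝ ℝ).comp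
        (ContinuousLinearMap.snd ℝ (E →L[ℝ] ℝ) (ℝ × ℝ))).hasFDerivAt).comp_hasDerivAt (0 : ℝ) hl
      have d2 : HasDerivAt (fun t : ℝ => ⟪ξ + t • ζ, ξ + t • ζ⟫_ℝ)
          (⟪ξ + (0 : ℝ) • ζ, (1 : ℝ) • ζ⟫_ℝ + ⟪(1 : ℝ) • ζ, ξ + (0 : ℝ) • ζ⟫_ℝ) 0 :=
        HasDerivAt.inner ℝ (((hasDerivAt_id (0 : ℝ)).smul_const ζ).const_add ξ)
          (((hasDerivAt_id (0 : ℝ)).smul_const ζ).const_add ξ)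
      have := d2.unique d1
      rw [map_zero, one_smul, zero_smul, add_zero, real_inner_comm ξ ζ] at this
      linarith
    -- The first two equations leave only the direction `η`, in which the determinant has nonzero
    -- derivative.
    have l3 : ζ = ⟪η, ζ⟫_ℝ • η := by
      have := normal_expansion hdim hL h.normal_left h.normal_right h.norm_left h.norm_right h.orth
        l1
      rwa [l2, zero_smul, zero_add] at this
    set c := ⟪η, ζ⟫_ℝ
    have d1 := (((ContinuousLinearMap.snd ℝ ℝ ℝ).comp
        (ContinuousLinearMap.snd ℝ (E →L[ℝ] ℝ) (ℝ × ℝ))).hasFDerivAt).comp_hasDerivAt (0 : ℝ) hl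
    have d2 : HasDerivAt (fun t : ℝ => t * ((formMatrix (fun i => (b i : E)) Q ξ).det *
        (c * ⟪Q v v, η⟫_ℝ))) (1 * ((formMatrix (fun i => (b i : E)) Q ξ).det *
        (c * ⟪Q v v, η⟫_ℝ))) 0 := (hasDerivAt_id (0 : ℝ)).mul_const _
    have e : (fun t : ℝ => t * ((formMatrix (fun i => (b i : E)) Q ξ).det *
        (c * ⟪Q v v, η⟫_ℝ))) = ((ContinuousLinearMap.snd ℝ ℝ ℝ).comp
        (ContinuousLinearMap.snd ℝ (E →L[ℝ] ℝ) (ℝ × ℝ))) ∘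
            fun t : ℝ => H ((L, Q), ξ + t • ζ) := by
      funext t
      have := det_formMatrix_sum (ξ := ξ) (η := η) hQ (fun i => (b i : E))
        (fun i => (b i).2) hv (t * c)
      simp only [Function.comp_apply, ContinuousLinearMap.comp_apply, H, b',
        ContinuousLinearMap.coe_snd']
      rw [l3, smul_smul, this]
      ring
    rw [e] at d2
    have := d2.unique d1
    rw [map_zero, one_mul] at this
    have hc : c = 0 := by
      simpa [hdet, hvv.ne'] using this
    rw [l3, hc, zero_smul]
  obtain ⟨φ, hφ, hφ0, O, hO, hev⟩ := exists_implicitFunction hfr hH (L, Q) ξ hline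
  refine ⟨φ, hφ, hφ0, O, hO, ?_⟩
  filter_upwards [hev] with j hj ξ' hξ' hn h1 hk
  refine hj ξ' hξ' ?_
  have e1 : (formMatrix b' j.2 ξ').det = 0 := det_formMatrix_eq_zero _ _ _ (by rw [hk]; exact hcard)
  have e2 : (formMatrix b' Q ξ).det = 0 := det_formMatrix_eq_zero _ _ _ hcard
  have e3 : (innerSL ℝ ξ') ∘L j.1 = (innerSL ℝ ξ) ∘L L := by
    ext u
    change ⟪ξ', j.1 u⟫_ℝ = ⟪ξ, L u⟫_ℝ
    rw [real_inner_comm, hn u, real_inner_comm, h.normal_left u]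
  simp only [H, e1, e2, e3, real_inner_self_eq_norm_sq, h1, h.norm_left]

end SmoothFrame

/-! ### Weingarten and Codazzi equations along a smooth adapted frame -/

section Codazzi

open Topology Filter

variable {E V : Type*} [NormedAddCommGroup E] [InnerProductSpace ℝ E]
  [NormedAddCommGroup V] [InnerProductSpace ℝ V]

/-- The Weingarten formula. -/
theorem inner_fderiv_fderiv_eq_neg {X : Type*} [NormedAddCommGroup X] [NormedSpace ℝ X]
    {G ξ : X → V} {y : X}
    (hG : DifferentiableAt ℝ (fderiv ℝ G) y) (hξ : DifferentiableAt ℝ ξ y)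
    (h : ∀ᶠ z in 𝓝 y, ∀ v, ⟪fderiv ℝ G z v, ξ z⟫_ℝ = 0) (u v : X) :
    ⟪fderiv ℝ (fderiv ℝ G) y u v, ξ y⟫_ℝ = -⟪fderiv ℝ G y v, fderiv ℝ ξ y u⟫_ℝ := by
  have h1 : (fun z => ⟪fderiv ℝ G z v, ξ z⟫_ℝ) =ᶠ[𝓝 y] fun _ => 0 := h.mono fun z hz => hz v
  have h2 := congrArg (fun T : X →L[ℝ] ℝ => T u) h1.fderiv_eq
  rw [fderiv_inner_apply ℝ (hG.clm_apply (differentiableAt_const v)) hξ,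
    fderiv_clm_apply hG (differentiableAt_const v)] at h2
  simp at h2
  linarith

theorem inner_fderiv_self_eq_zero {X : Type*} [NormedAddCommGroup X] [NormedSpace ℝ X]
    {ξ : X → V} {y : X} (hξ : DifferentiableAt ℝ ξ y)
    (h : ∀ᶠ z in 𝓝 y, ‖ξ z‖ = 1) (u : X) : ⟪ξ y, fderiv ℝ ξ y u⟫_ℝ = 0 := by
  have h1 : (fun z => ⟪ξ z, ξ z⟫_ℝ) =ᶠ[𝓝 y] fun _ => 1 :=
    h.mono fun z hz => by simp [hz]
  have h2 := congrArg (fun T : X →L[ℝ] ℝ => T u) h1.fderiv_eq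
  rw [fderiv_inner_apply ℝ hξ hξ, real_inner_comm] at h2
  simp only [fderiv_fun_const, Pi.zero_apply, zero_apply] at h2
  rw [real_inner_comm]
  linarith

/-- The second derivatives of a smooth map are symmetric. -/
theorem fderiv_fderiv_symm {F X : Type*} [NormedAddCommGroup F] [NormedSpace ℝ F]
    [NormedAddCommGroup X] [NormedSpace ℝ X] {G : X → F} {y : X} (hG : ContDiffAt ℝ ∞ G y)
    (u v : X) : fderiv ℝ (fderiv ℝ G) y u v = fderiv ℝ (fderiv ℝ G) y v u :=
  (hG.isSymmSndFDerivAt (by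
    rw [minSmoothness_of_isRCLikeNormedField]
    exact WithTop.coe_le_coe.2 (le_top : (2 : ℕ∞) ≤ ⊤))) u v

theorem ContDiffOn.fderiv_infty {F X : Type*} [NormedAddCommGroup F] [NormedSpace ℝ F]
    [NormedAddCommGroup X] [NormedSpace ℝ X] {G : X → F} {Ω : Set X} (hG : ContDiffOn ℝ ∞ G Ω)
    (hΩ : IsOpen Ω) : ContDiffOn ℝ ∞ (fderiv ℝ G) Ω :=
  hG.fderiv_of_isOpen hΩ (by simp)

/-- The form `⟨Q(u, v), ξ⟩` is stationary on its null space, if it is nonnegative nearby. -/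
theorem fderiv_form_eq_zero {Q : E → (E →L[ℝ] E →L[ℝ] V)} {ξ : E → V} {y : E}
    (hQd : DifferentiableAt ℝ Q y) (hξd : DifferentiableAt ℝ ξ y)
    (hQ : ∀ᶠ z in 𝓝 y, ∀ u v, Q z u v = Q z v u)
    (hpos : ∀ᶠ z in 𝓝 y, ∀ u, 0 ≤ ⟪Q z u u, ξ z⟫_ℝ) {u v : E}
    (hu : u ∈ nullSpace (Q y) (ξ y)) (hv : v ∈ nullSpace (Q y) (ξ y)) (w : E) :
    ⟪fderiv ℝ Q y w u v, ξ y⟫_ℝ = -⟪Q y u v, fderiv ℝ ξ y w⟫_ℝ := by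
  have hd : ∀ a b, DifferentiableAt ℝ (fun z => ⟪Q z a b, ξ z⟫_ℝ) y := fun a b =>
    ((hQd.clm_apply (differentiableAt_const a)).clm_apply (differentiableAt_const b)).inner ℝ hξd
  -- For a null vector `a` the nonnegative function `z ↦ ⟪Q z a a, ξ z⟫` vanishes at `y`, so `y` is
  -- a minimum. Polarization extends stationarity to pairs `u, v` of null vectors.
  have hmin : ∀ a ∈ nullSpace (Q y) (ξ y), fderiv ℝ (fun z => ⟪Q z a a, ξ z⟫_ℝ) y = 0 := by
    intro a ha
    refine IsLocalMin.fderiv_eq_zero ?_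
    filter_upwards [hpos] with z hz
    rw [ha a]
    exact hz a
  have heq : (fun z => ⟪Q z (u + v) (u + v), ξ z⟫_ℝ) =ᶠ[𝓝 y]
      fun z => ⟪Q z u u, ξ z⟫_ℝ + ⟪Q z v v, ξ z⟫_ℝ + (2 : ℝ) * ⟪Q z u v, ξ z⟫_ℝ := by
    filter_upwards [hQ] with z hz
    simp only [map_add, add_apply, inner_add_left, hz v u]
    ring
  have h1 := heq.fderiv_eq (𝕜 := ℝ)
  rw [hmin _ ((nullSpace (Q y) (ξ y)).add_mem hu hv),
    fderiv_fun_add ((hd u u).fun_add (hd v v)) ((hd u v).const_mul 2),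
    fderiv_fun_add (hd u u) (hd v v), hmin u hu, hmin v hv, fderiv_const_mul (hd u v), zero_add,
    zero_add] at h1
  have h2 : fderiv ℝ (fun z => ⟪Q z u v, ξ z⟫_ℝ) y w = 0 := by
    have := congrArg (fun T : E →L[ℝ] ℝ => T w) h1
    simpa using this.symm
  rw [fderiv_inner_apply ℝ ((hQd.clm_apply (differentiableAt_const u)).clm_apply
    (differentiableAt_const v)) hξd, fderiv_clm_apply (hQd.clm_apply (differentiableAt_const u))
    (differentiableAt_const v), fderiv_clm_apply hQd (differentiableAt_const u)] at h2
  simp at h2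
  linarith

/-- A smooth adapted frame along an immersion `G`, on an open set `Ω`. -/
structure IsAdaptedFrame (G ξ η : E → V) (Ω : Set E) : Prop where
  isOpen : IsOpen Ω
  smooth : ContDiffOn ℝ ∞ G Ω
  smooth_left : ContDiffOn ℝ ∞ ξ Ω
  smooth_right : ContDiffOn ℝ ∞ η Ω
  immersion : ∀ y ∈ Ω, Function.Injective (fderiv ℝ G y)
  adapted : ∀ y ∈ Ω, AdaptedPair (fderiv ℝ G y) (fderiv ℝ (fderiv ℝ G) y) (ξ y) (η y)
  two_le_left : ∀ y ∈ Ω, 2 ≤ Module.finrank ℝ (nullSpace (fderiv ℝ (fderiv ℝ G) y) (ξ y))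
  two_le_right : ∀ y ∈ Ω, 2 ≤ Module.finrank ℝ (nullSpace (fderiv ℝ (fderiv ℝ G) y) (η y))

theorem IsAdaptedFrame.swap {G ξ η : E → V} {Ω : Set E} (h : IsAdaptedFrame G ξ η Ω) :
    IsAdaptedFrame G η ξ Ω :=
  ⟨h.isOpen, h.smooth, h.smooth_right, h.smooth_left, h.immersion,
    fun y hy => (h.adapted y hy).swap, h.two_le_right, h.two_le_left⟩

/-- A vector in the kernel of the derivative of a normal field is a null vector of the form. -/
theorem IsAdaptedFrame.mem_nullSpace_of_fderiv {G ξ η : E → V} {Ω : Set E}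
    (h : IsAdaptedFrame G ξ η Ω) {y : E} (hy : y ∈ Ω) {w : E} (hw : fderiv ℝ ξ y w = 0) :
    w ∈ nullSpace (fderiv ℝ (fderiv ℝ G) y) (ξ y) := by
  have hΩ : ∀ᶠ z in 𝓝 y, z ∈ Ω := h.isOpen.mem_nhds hy
  intro v
  rw [inner_fderiv_fderiv_eq_neg
    (((h.smooth.fderiv_infty h.isOpen).contDiffAt hΩ).differentiableAt (by simp))
    ((h.smooth_left.contDiffAt hΩ).differentiableAt (by simp))
    (hΩ.mono fun z hz => (h.adapted z hz).normal_left) w v, hw, inner_zero_right, neg_zero]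

variable [FiniteDimensional ℝ E] [FiniteDimensional ℝ V]

/-- The null space of the form along a vector of an adapted frame consists of directions in which
this vector is constant: the Codazzi equation. -/
theorem IsAdaptedFrame.fderiv_left_eq_zero (hdim : Module.finrank ℝ V = Module.finrank ℝ E + 2)
    {G ξ η : E → V} {Ω : Set E} (h : IsAdaptedFrame G ξ η Ω) {y : E} (hy : y ∈ Ω) {w : E}
    (hw : w ∈ nullSpace (fderiv ℝ (fderiv ℝ G) y) (ξ y)) : fderiv ℝ ξ y w = 0 := by
  have hΩ : ∀ᶠ z in 𝓝 y, z ∈ Ω := h.isOpen.mem_nhds hy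
  have hG1 := h.smooth.fderiv_infty h.isOpen
  have hG2 := hG1.fderiv_infty h.isOpen
  have hd1 : DifferentiableAt ℝ (fderiv ℝ G) y :=
    (hG1.contDiffAt hΩ).differentiableAt (by simp)
  have hd2 : DifferentiableAt ℝ (fderiv ℝ (fderiv ℝ G)) y :=
    (hG2.contDiffAt hΩ).differentiableAt (by simp)
  have hξd : DifferentiableAt ℝ ξ y := (h.smooth_left.contDiffAt hΩ).differentiableAt (by simp)
  have hsymm : ∀ᶠ z in 𝓝 y, ∀ u v, fderiv ℝ (fderiv ℝ G) z u v = fderiv ℝ (fderiv ℝ G) z v u := by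
    filter_upwards [hΩ] with z hz u v
    exact fderiv_fderiv_symm (h.smooth.contDiffAt (h.isOpen.mem_nhds hz)) u v
  have hP := h.adapted y hy
  set Q := fderiv ℝ (fderiv ℝ G) y with hQ
  have hwein := fun u v => inner_fderiv_fderiv_eq_neg hd1 hξd
    (hΩ.mono fun z hz => (h.adapted z hz).normal_left) u v
  have hunit := inner_fderiv_self_eq_zero hξd (hΩ.mono fun z hz => (h.adapted z hz).norm_left)
  -- Along a null direction the derivative of `ξ` has no tangential part by Weingarten and no
  -- `ξ`-part since `ξ` is a unit field.
  have hnull : ∀ u ∈ nullSpace Q (ξ y), fderiv ℝ ξ y u = ⟪η y, fderiv ℝ ξ y u⟫_ℝ • η y := by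
    intro u hu
    have := normal_expansion hdim (h.immersion y hy) hP.normal_left hP.normal_right hP.norm_left
      hP.norm_right hP.orth (ζ := fderiv ℝ ξ y u) (fun v => by
        have := hwein u v
        rw [← hQ, hu v] at this
        linarith)
    rwa [hunit, zero_smul, zero_add] at this
  -- Codazzi: stationarity of the form expresses both sides by third derivatives of `G`, which are
  -- symmetric in the first two arguments `w`, `u`.
  have hcod : ∀ u ∈ nullSpace Q (ξ y),
      ⟪Q u u, fderiv ℝ ξ y w⟫_ℝ = ⟪Q w u, fderiv ℝ ξ y u⟫_ℝ := by
    intro u hu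
    have e1 := fderiv_form_eq_zero hd2 hξd hsymm
      (hΩ.mono fun z hz => (h.adapted z hz).nonneg_left) hu hu w
    have e2 := fderiv_form_eq_zero hd2 hξd hsymm
      (hΩ.mono fun z hz => (h.adapted z hz).nonneg_left) hw hu u
    rw [fderiv_fderiv_symm (hG1.contDiffAt hΩ) w u] at e1
    rw [← hQ] at e1 e2
    linarith
  -- A linear functional on a space of dimension at least two has a nonzero kernel; this is the only
  -- place where the dimension bound enters the Codazzi argument.
  obtain ⟨u, hu, hu0⟩ : ∃ u : nullSpace Q (ξ y), ⟪Q w u, η y⟫_ℝ = 0 ∧ u ≠ 0 := by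
    let Λ : nullSpace Q (ξ y) →ₗ[ℝ] ℝ :=
      ((innerSL ℝ (η y)).comp (Q w)).toLinearMap.comp (nullSpace Q (ξ y)).subtype
    have hlt : Module.finrank ℝ ℝ < Module.finrank ℝ (nullSpace Q (ξ y)) := by
      rw [Module.finrank_self]
      exact h.two_le_left y hy
    obtain ⟨u, hu, hu0⟩ := Submodule.exists_mem_ne_zero_of_ne_bot
      (LinearMap.ker_ne_bot_of_finrank_lt hlt (f := Λ))
    refine ⟨u, ?_, hu0⟩
    rw [real_inner_comm]
    exact hu
  have hpos : 0 < ⟪Q u u, η y⟫_ℝ :=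
    hP.pos_right (fun a b => hsymm.self_of_nhds a b) u.2 (by simpa using hu0)
  have := hcod u u.2
  rw [hnull w hw, hnull u u.2, real_inner_smul_right, real_inner_smul_right, hu, mul_zero] at this
  rw [hnull w hw, (mul_eq_zero.1 this).resolve_right hpos.ne', zero_smul]

/-- An adapted pair at a point extends to a smooth adapted frame nearby. -/
theorem exists_isAdaptedFrame (hdim : Module.finrank ℝ V = Module.finrank ℝ E + 2)
    {G : E → V} {Ω : Set E} (hΩ : IsOpen Ω) (hG : ContDiffOn ℝ ∞ G Ω)
    (hinj : ∀ y ∈ Ω, Function.Injective (fderiv ℝ G y))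
    (hgauss : ∀ y ∈ Ω, NonnegGauss (fderiv ℝ G y) (fderiv ℝ (fderiv ℝ G) y))
    (hwide : ∀ y ∈ Ω, WideJet (fderiv ℝ G y) (fderiv ℝ (fderiv ℝ G) y))
    {y₀ : E} (hy₀ : y₀ ∈ Ω) {ξ₀ η₀ : V}
    (h : AdaptedPair (fderiv ℝ G y₀) (fderiv ℝ (fderiv ℝ G) y₀) ξ₀ η₀)
    (h2ξ : 2 ≤ Module.finrank ℝ (nullSpace (fderiv ℝ (fderiv ℝ G) y₀) ξ₀))
    (h2η : 2 ≤ Module.finrank ℝ (nullSpace (fderiv ℝ (fderiv ℝ G) y₀) η₀)) :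
    ∃ (ξ η : E → V) (Ω' : Set E), IsAdaptedFrame G ξ η Ω' ∧ Ω' ⊆ Ω ∧ y₀ ∈ Ω' ∧ ξ y₀ = ξ₀ ∧
      η y₀ = η₀ ∧
      (∀ y ∈ Ω', Module.finrank ℝ (nullSpace (fderiv ℝ (fderiv ℝ G) y) (ξ y)) =
        Module.finrank ℝ (nullSpace (fderiv ℝ (fderiv ℝ G) y₀) ξ₀)) ∧
      (∀ y ∈ Ω', Module.finrank ℝ (nullSpace (fderiv ℝ (fderiv ℝ G) y) (η y)) =
        Module.finrank ℝ (nullSpace (fderiv ℝ (fderiv ℝ G) y₀) η₀)) := by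
  have hneb : ∀ {S : Submodule ℝ E}, 2 ≤ Module.finrank ℝ S → S ≠ ⊥ := by
    rintro S hS rfl
    simp at hS
  let j : E → (E →L[ℝ] V) × (E →L[ℝ] E →L[ℝ] V) := fun y =>
    (fderiv ℝ G y, fderiv ℝ (fderiv ℝ G) y)
  have hj : ∀ y ∈ Ω, ContDiffAt ℝ ∞ j y := fun y hy =>
    ((hG.fderiv_infty hΩ).contDiffAt (hΩ.mem_nhds hy)).prodMk
      (((hG.fderiv_infty hΩ).fderiv_infty hΩ).contDiffAt (hΩ.mem_nhds hy))
  have hsymm : ∀ y ∈ Ω, ∀ u v, fderiv ℝ (fderiv ℝ G) y u v = fderiv ℝ (fderiv ℝ G) y v u :=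
    fun y hy => fderiv_fderiv_symm (hG.contDiffAt (hΩ.mem_nhds hy))
  obtain ⟨φ, hφ, hφ0, O, hO, hev⟩ :=
    h.exists_contDiffAt hdim (hinj y₀ hy₀) (hsymm y₀ hy₀) (hneb h2ξ)
  obtain ⟨ψ, hψ, hψ0, O', hO', hev'⟩ :=
    h.swap.exists_contDiffAt hdim (hinj y₀ hy₀) (hsymm y₀ hy₀) (hneb h2η)
  have hex := h.eventually_exists hdim (hinj y₀ hy₀) (hsymm y₀ hy₀) (hneb h2ξ) (hneb h2η)
    (O := O ×ˢ O') (by rw [nhds_prod_eq]; exact prod_mem_prod hO hO')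
  have hjc : Tendsto j (𝓝 y₀) (𝓝 (j y₀)) := (hj y₀ hy₀).continuousAt
  have hφj : ContDiffAt ℝ ∞ (φ ∘ j) y₀ := ContDiffAt.comp y₀ hφ (hj y₀ hy₀)
  have hψj : ContDiffAt ℝ ∞ (ψ ∘ j) y₀ := ContDiffAt.comp y₀ hψ (hj y₀ hy₀)
  -- Smoothness of order `∞` at the single point `y₀` does not by itself give one neighbourhood of
  -- smoothness. At this stage only continuity nearby is kept, which follows from order 1.
  have hcont : ∀ {f : E → V}, ContDiffAt ℝ ∞ f y₀ → ∀ᶠ y in 𝓝 y₀, ContinuousAt f y := by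
    intro f hf
    have h1 : ContDiffAt ℝ 1 f y₀ := hf.of_le (by simp)
    exact (h1.eventually (by simp)).mono fun y hy => hy.continuousAt
  have hall : ∀ᶠ y in 𝓝 y₀, y ∈ Ω ∧ ContinuousAt (φ ∘ j) y ∧ ContinuousAt (ψ ∘ j) y ∧
      AdaptedPair (fderiv ℝ G y) (fderiv ℝ (fderiv ℝ G) y) (φ (j y)) (ψ (j y)) ∧
      Module.finrank ℝ (nullSpace (fderiv ℝ (fderiv ℝ G) y) (φ (j y))) =
        Module.finrank ℝ (nullSpace (fderiv ℝ (fderiv ℝ G) y₀) ξ₀) ∧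
      Module.finrank ℝ (nullSpace (fderiv ℝ (fderiv ℝ G) y) (ψ (j y))) =
        Module.finrank ℝ (nullSpace (fderiv ℝ (fderiv ℝ G) y₀) η₀) := by
    filter_upwards [hΩ.mem_nhds hy₀, hcont hφj, hcont hψj, hjc.eventually hev,
      hjc.eventually hev', hjc.eventually hex] with y hy c1 c2 e1 e2 e3
    obtain ⟨ξ', η', hm, ha, f1, f2⟩ := e3 (hinj y hy) (hsymm y hy) (hgauss y hy) (hwide y hy)
    rw [e1 ξ' hm.1 ha.normal_left ha.norm_left f1, e2 η' hm.2 ha.normal_right ha.norm_right f2]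
    exact ⟨hy, c1, c2, ha, f1, f2⟩
  obtain ⟨Ω', hΩ'sub, hΩ'o, hy₀'⟩ := eventually_nhds_iff.1 hall
  -- Smoothness at another point `y` comes from solving the implicit equations afresh at the jet of
  -- `y`: by continuity the values of `f` stay in the uniqueness neighbourhood, so `f` agrees with
  -- the new solution near `y`.
  have smooth_of : ∀ (f : E → V) (m : ℕ), 2 ≤ m → (∀ y ∈ Ω', ContinuousAt f y) →
      (∀ y ∈ Ω', ∃ g : V, AdaptedPair (fderiv ℝ G y) (fderiv ℝ (fderiv ℝ G) y) (f y) g ∧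
        Module.finrank ℝ (nullSpace (fderiv ℝ (fderiv ℝ G) y) (f y)) = m) →
      ContDiffOn ℝ ∞ f Ω' := by
    intro f m hm hc hf y hy
    obtain ⟨g, hg, hgm⟩ := hf y hy
    have hyΩ := (hΩ'sub y hy).1
    obtain ⟨χ, hχ, -, U, hU, hevχ⟩ := hg.exists_contDiffAt hdim (hinj y hyΩ) (hsymm y hyΩ)
      (hneb (by omega))
    have hjy : Tendsto j (𝓝 y) (𝓝 (j y)) := (hj y hyΩ).continuousAt
    have heq : f =ᶠ[𝓝 y] χ ∘ j := by
      filter_upwards [hjy.eventually hevχ, (hc y hy).eventually hU, hΩ'o.mem_nhds hy]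
        with z hz hzU hzΩ
      obtain ⟨g', hg', hgm'⟩ := hf z hzΩ
      exact (hz _ hzU hg'.normal_left hg'.norm_left (hgm'.trans hgm.symm)).symm
    exact ((ContDiffAt.comp y hχ (hj y hyΩ)).congr_of_eventuallyEq heq).contDiffWithinAt
  refine ⟨φ ∘ j, ψ ∘ j, Ω', ⟨hΩ'o, hG.mono fun y hy => (hΩ'sub y hy).1,
    smooth_of _ _ h2ξ (fun y hy => (hΩ'sub y hy).2.1)
      fun y hy => ⟨_, (hΩ'sub y hy).2.2.2.1, (hΩ'sub y hy).2.2.2.2.1⟩,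
    smooth_of _ _ h2η (fun y hy => (hΩ'sub y hy).2.2.1)
      fun y hy => ⟨_, (hΩ'sub y hy).2.2.2.1.swap, (hΩ'sub y hy).2.2.2.2.2⟩,
    fun y hy => hinj y (hΩ'sub y hy).1, fun y hy => (hΩ'sub y hy).2.2.2.1,
    fun y hy => h2ξ.trans_eq (hΩ'sub y hy).2.2.2.2.1.symm,
    fun y hy => h2η.trans_eq (hΩ'sub y hy).2.2.2.2.2.symm⟩, fun y hy => (hΩ'sub y hy).1, hy₀',
    hφ0, hψ0, fun y hy => (hΩ'sub y hy).2.2.2.2.1, fun y hy => (hΩ'sub y hy).2.2.2.2.2⟩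

end Codazzi

/-! ### Orthogonal splitting of the ambient space -/

section ProductSplitting

open Topology Filter

variable {X Z V : Type*} [NormedAddCommGroup X] [NormedSpace ℝ X] [NormedAddCommGroup Z]
  [NormedSpace ℝ Z] [NormedAddCommGroup V] [InnerProductSpace ℝ V]

/-- The shape operator of a normal field is symmetric. -/
theorem inner_fderiv_comm_of_normal {Γ N : X → V} {y : X} (hΓ : ContDiffAt ℝ ∞ Γ y)
    (hN : DifferentiableAt ℝ N y) (h : ∀ᶠ z in 𝓝 y, ∀ v, ⟪fderiv ℝ Γ z v, N z⟫_ℝ = 0) (a b : X) :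
    ⟪fderiv ℝ Γ y a, fderiv ℝ N y b⟫_ℝ = ⟪fderiv ℝ Γ y b, fderiv ℝ N y a⟫_ℝ := by
  have hd : DifferentiableAt ℝ (fderiv ℝ Γ) y :=
    (hΓ.fderiv_right (m := ∞) (by simp)).differentiableAt (by simp)
  have h1 := inner_fderiv_fderiv_eq_neg hd hN h a b
  have h2 := inner_fderiv_fderiv_eq_neg hd hN h b a
  rw [fderiv_fderiv_symm hΓ] at h1
  linarith

/-- An immersion of a product with orthonormal normal fields, each depending on one factor only,
along which the second fundamental form is definite on that factor. -/
structure IsSplitFrame (Γ : X × Z → V) (ξ : X → V) (η : Z → V) (W₁ : Set X) (W₂ : Set Z) :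
    Prop where
  isOpen_left : IsOpen W₁
  isOpen_right : IsOpen W₂
  preconnected_left : IsPreconnected W₁
  preconnected_right : IsPreconnected W₂
  smooth : ContDiffOn ℝ ∞ Γ (W₁ ×ˢ W₂)
  smooth_left : ContDiffOn ℝ ∞ ξ W₁
  smooth_right : ContDiffOn ℝ ∞ η W₂
  normal_left : ∀ x ∈ W₁, ∀ z ∈ W₂, ∀ q, ⟪fderiv ℝ Γ (x, z) q, ξ x⟫_ℝ = 0
  normal_right : ∀ x ∈ W₁, ∀ z ∈ W₂, ∀ q, ⟪fderiv ℝ Γ (x, z) q, η z⟫_ℝ = 0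
  unit_left : ∀ x ∈ W₁, ‖ξ x‖ = 1
  unit_right : ∀ z ∈ W₂, ‖η z‖ = 1
  orth : ∀ x ∈ W₁, ∀ z ∈ W₂, ⟪ξ x, η z⟫_ℝ = 0
  neg_left : ∀ x ∈ W₁, ∀ z ∈ W₂, ∀ u, u ≠ 0 →
    ⟪fderiv ℝ Γ (x, z) (u, 0), fderiv ℝ ξ x u⟫_ℝ < 0
  neg_right : ∀ x ∈ W₁, ∀ z ∈ W₂, ∀ w, w ≠ 0 →
    ⟪fderiv ℝ Γ (x, z) (0, w), fderiv ℝ η z w⟫_ℝ < 0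

/-- The derivative of a map with values in a subspace has values in this subspace. -/
theorem fderiv_mem_of_eventually_mem [FiniteDimensional ℝ V] {S : Submodule ℝ V} {ξ : X → V}
    {x : X} (hξ : DifferentiableAt ℝ ξ x) (h : ∀ᶠ y in 𝓝 x, ξ y ∈ S) (u : X) :
    fderiv ℝ ξ x u ∈ S := by
  rw [← Submodule.orthogonal_orthogonal S, Submodule.mem_orthogonal]
  intro b hb
  have h1 : (fun y => ⟪b, ξ y⟫_ℝ) =ᶠ[𝓝 x] fun _ => 0 := by
    filter_upwards [h] with y hy
    exact Submodule.inner_left_of_mem_orthogonal hy hb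
  have h2 := congrArg (fun T : X →L[ℝ] ℝ => T u) h1.fderiv_eq
  rw [fderiv_inner_apply ℝ (differentiableAt_const b) hξ] at h2
  simpa using h2

/-- The span of a unit field along an immersed hypersurface with injective Gauss map. -/
theorem span_unit_field [FiniteDimensional ℝ V] [FiniteDimensional ℝ X] {ξ : X → V} {W : Set X}
    (hW : IsOpen W) (hξ : ContDiffOn ℝ ∞ ξ W) (hunit : ∀ x ∈ W, ‖ξ x‖ = 1) {x : X} (hx : x ∈ W)
    (hinj : ∀ u, fderiv ℝ ξ x u = 0 → u = 0) :
    ∃ Λ : (ℝ × X) →ₗ[ℝ] V, Function.Injective Λ ∧ (∀ c u, Λ (c, u) = c • ξ x + fderiv ℝ ξ x u) ∧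
      LinearMap.range Λ ≤ Submodule.span ℝ (ξ '' W) := by
  have hd : DifferentiableAt ℝ ξ x :=
    (hξ.contDiffAt (hW.mem_nhds hx)).differentiableAt (by simp)
  let Λ : (ℝ × X) →ₗ[ℝ] V :=
    (LinearMap.toSpanSingleton ℝ V (ξ x)).coprod (fderiv ℝ ξ x).toLinearMap
  have hΛ : ∀ c u, Λ (c, u) = c • ξ x + fderiv ℝ ξ x u := fun c u => by simp [Λ]
  refine ⟨Λ, ?_, hΛ, ?_⟩
  · rw [← LinearMap.ker_eq_bot, LinearMap.ker_eq_bot']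
    rintro ⟨c, u⟩ h
    rw [hΛ] at h
    have h1 := inner_fderiv_self_eq_zero hd
      ((hW.eventually_mem hx).mono fun y hy => hunit y hy) u
    have h2 : ⟪ξ x, c • ξ x + fderiv ℝ ξ x u⟫_ℝ = 0 := by rw [h, inner_zero_right]
    rw [inner_add_right, h1, real_inner_smul_right, real_inner_self_eq_norm_sq, hunit x hx] at h2
    -- The derivative of a unit field is orthogonal to the field, so pairing with `ξ x` isolates
    -- `c`.
    have hc : c = 0 := by simpa using h2
    subst hc
    rw [zero_smul, zero_add] at h
    rw [hinj u h]
    rfl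
  · rintro _ ⟨⟨c, u⟩, rfl⟩
    rw [hΛ]
    refine Submodule.add_mem _ (Submodule.smul_mem _ _ (Submodule.subset_span ⟨x, hx, rfl⟩)) ?_
    exact fderiv_mem_of_eventually_mem hd
      ((hW.eventually_mem hx).mono fun y hy =>
        Submodule.subset_span (mem_image_of_mem ξ hy)) u

namespace IsSplitFrame

variable {Γ : X × Z → V} {ξ : X → V} {η : Z → V} {W₁ : Set X} {W₂ : Set Z}

theorem eventually_mem (h : IsSplitFrame Γ ξ η W₁ W₂) {x : X} (hx : x ∈ W₁) {z : Z}
    (hz : z ∈ W₂) : ∀ᶠ q in 𝓝 (x, z), q ∈ W₁ ×ˢ W₂ :=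
  (h.isOpen_left.prod h.isOpen_right).mem_nhds ⟨hx, hz⟩

theorem differentiableAt_left (h : IsSplitFrame Γ ξ η W₁ W₂) {x : X} (hx : x ∈ W₁) :
    DifferentiableAt ℝ ξ x :=
  (h.smooth_left.contDiffAt (h.isOpen_left.mem_nhds hx)).differentiableAt (by simp)

theorem differentiableAt_right (h : IsSplitFrame Γ ξ η W₁ W₂) {z : Z} (hz : z ∈ W₂) :
    DifferentiableAt ℝ η z :=
  (h.smooth_right.contDiffAt (h.isOpen_right.mem_nhds hz)).differentiableAt (by simp)

/-- The shape operator of `η`, seen as a field on the product, is symmetric, and the derivative of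
this field in the directions of the first factor is zero. -/
theorem inner_mixed_right (h : IsSplitFrame Γ ξ η W₁ W₂) {x : X} (hx : x ∈ W₁) {z : Z}
    (hz : z ∈ W₂) (u : X) (w : Z) : ⟪fderiv ℝ Γ (x, z) (u, 0), fderiv ℝ η z w⟫_ℝ = 0 := by
  have hd : HasFDerivAt (fun q : X × Z => η q.2)
      ((fderiv ℝ η z).comp (ContinuousLinearMap.snd ℝ X Z)) (x, z) :=
    HasFDerivAt.comp (x, z) (h.differentiableAt_right hz).hasFDerivAt hasFDerivAt_snd
  have := inner_fderiv_comm_of_normal (h.smooth.contDiffAt (h.eventually_mem hx hz))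
    hd.differentiableAt ((h.eventually_mem hx hz).mono fun q hq =>
      h.normal_right q.1 hq.1 q.2 hq.2) (u, 0) (0, w)
  rw [hd.fderiv] at this
  simpa using this

theorem inner_mixed_left (h : IsSplitFrame Γ ξ η W₁ W₂) {x : X} (hx : x ∈ W₁) {z : Z}
    (hz : z ∈ W₂) (u : X) (w : Z) : ⟪fderiv ℝ Γ (x, z) (0, w), fderiv ℝ ξ x u⟫_ℝ = 0 := by
  have hd : HasFDerivAt (fun q : X × Z => ξ q.1)
      ((fderiv ℝ ξ x).comp (ContinuousLinearMap.fst ℝ X Z)) (x, z) :=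
    HasFDerivAt.comp (x, z) (h.differentiableAt_left hx).hasFDerivAt hasFDerivAt_fst
  have := inner_fderiv_comm_of_normal (h.smooth.contDiffAt (h.eventually_mem hx hz))
    hd.differentiableAt ((h.eventually_mem hx hz).mono fun q hq =>
      h.normal_left q.1 hq.1 q.2 hq.2) (0, w) (u, 0)
  rw [hd.fderiv] at this
  simpa using this

/-- The constant orthogonal splitting of the ambient space. -/
theorem exists_splitting [FiniteDimensional ℝ X] [FiniteDimensional ℝ Z] [FiniteDimensional ℝ V]
    (h : IsSplitFrame Γ ξ η W₁ W₂)
    (hdim : Module.finrank ℝ V = Module.finrank ℝ X + Module.finrank ℝ Z + 2)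
    (h₁ : W₁.Nonempty) (h₂ : W₂.Nonempty) :
    ∃ S : Submodule ℝ V, Module.finrank ℝ S = Module.finrank ℝ X + 1 ∧
      Module.finrank ℝ Sᗮ = Module.finrank ℝ Z + 1 ∧ (∀ x ∈ W₁, ξ x ∈ S) ∧
      (∀ z ∈ W₂, η z ∈ Sᗮ) ∧
      (∀ x ∈ W₁, ∀ z ∈ W₂, ∀ u, fderiv ℝ Γ (x, z) (u, 0) ∈ S) ∧
      (∀ x ∈ W₁, ∀ z ∈ W₂, ∀ w, fderiv ℝ Γ (x, z) (0, w) ∈ Sᗮ) := by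
  obtain ⟨x₀, hx₀⟩ := h₁
  obtain ⟨z₀, hz₀⟩ := h₂
  set S := Submodule.span ℝ (ξ '' W₁) with hS
  set R := Submodule.span ℝ (η '' W₂) with hR
  have hexS : ∀ x ∈ W₁, _ := fun x hx =>
    span_unit_field h.isOpen_left h.smooth_left h.unit_left hx (fun u hu => by
      by_contra hu0
      have := h.neg_left x hx z₀ hz₀ u hu0
      rw [hu, inner_zero_right] at this
      exact lt_irrefl _ this)
  have hexR : ∀ z ∈ W₂, _ := fun z hz =>
    span_unit_field h.isOpen_right h.smooth_right h.unit_right hz (fun w hw => by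
      by_contra hw0
      have := h.neg_right x₀ hx₀ z hz w hw0
      rw [hw, inner_zero_right] at this
      exact lt_irrefl _ this)
  have hRS : R ≤ Sᗮ := by
    rw [hR, Submodule.span_le]
    rintro _ ⟨z, hz, rfl⟩
    rw [SetLike.mem_coe, Submodule.mem_orthogonal]
    intro s hs
    induction hs using Submodule.span_induction with
    | mem s hs =>
      obtain ⟨x, hx, rfl⟩ := hs
      exact h.orth x hx z hz
    | zero => simp
    | add a b _ _ ha hb => rw [inner_add_left, ha, hb, add_zero]
    | smul c a _ ha => rw [real_inner_smul_left, ha, mul_zero]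
  have fS : ∀ {Λ : (ℝ × X) →ₗ[ℝ] V}, Function.Injective Λ →
      Module.finrank ℝ (LinearMap.range Λ) = Module.finrank ℝ X + 1 := by
    intro Λ hΛ
    rw [LinearMap.finrank_range_of_inj hΛ, Module.finrank_prod, Module.finrank_self, add_comm]
  have fR : ∀ {Λ : (ℝ × Z) →ₗ[ℝ] V}, Function.Injective Λ →
      Module.finrank ℝ (LinearMap.range Λ) = Module.finrank ℝ Z + 1 := by
    intro Λ hΛ
    rw [LinearMap.finrank_range_of_inj hΛ, Module.finrank_prod, Module.finrank_self, add_comm]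
  obtain ⟨Λ₁, i1, -, r1⟩ := hexS x₀ hx₀
  obtain ⟨Λ₂, i2, -, r2⟩ := hexR z₀ hz₀
  have g1 := Submodule.finrank_mono r1
  have g2 := Submodule.finrank_mono r2
  rw [fS i1] at g1
  rw [fR i2] at g2
  have g3 := Submodule.finrank_mono hRS
  have g4 := Submodule.finrank_add_finrank_orthogonal S
  rw [← hS] at g1
  rw [← hR] at g2
  -- The lower bounds `dim X + 1` and `dim Z + 1` for the orthogonal spaces `S` and `R` already add
  -- up to `dim V`; all inequalities are equalities.
  have e1 : Module.finrank ℝ S = Module.finrank ℝ X + 1 := by omega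
  have e2 : Module.finrank ℝ R = Module.finrank ℝ Z + 1 := by omega
  have e3 : R = Sᗮ := Submodule.eq_of_le_of_finrank_eq hRS (by omega)
  refine ⟨S, e1, by omega, fun x hx => Submodule.subset_span ⟨x, hx, rfl⟩,
    fun z hz => hRS (Submodule.subset_span ⟨z, hz, rfl⟩), ?_, ?_⟩
  · intro x hx z hz u
    obtain ⟨Λ, i, hΛ, r⟩ := hexR z hz
    -- For each `z` the vector `η z` and the derivatives of `η` at `z` already span `R`, so
    -- orthogonality to them is membership in `Rᗮ = S`.
    have hΛR : LinearMap.range Λ = R := Submodule.eq_of_le_of_finrank_eq r (by rw [fR i, e2])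
    rw [← Submodule.orthogonal_orthogonal S, ← e3, ← hΛR, Submodule.mem_orthogonal']
    rintro _ ⟨⟨c, w⟩, rfl⟩
    rw [hΛ, inner_add_right, real_inner_smul_right, h.normal_right x hx z hz,
      h.inner_mixed_right hx hz, mul_zero, add_zero]
  · intro x hx z hz w
    obtain ⟨Λ, i, hΛ, r⟩ := hexS x hx
    have hΛS : LinearMap.range Λ = S := Submodule.eq_of_le_of_finrank_eq r (by rw [fS i, e1])
    rw [← hΛS, Submodule.mem_orthogonal']
    rintro _ ⟨⟨c, u⟩, rfl⟩
    rw [hΛ, inner_add_right, real_inner_smul_right, h.normal_left x hx z hz,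
      h.inner_mixed_left hx hz, mul_zero, add_zero]

end IsSplitFrame

/-- Coordinates adapted to an orthogonal splitting. -/
theorem exists_isometry_of_splitting [FiniteDimensional ℝ V] (S : Submodule ℝ V) {a b : ℕ}
    (ha : Module.finrank ℝ S = a) (hb : Module.finrank ℝ Sᗮ = b) :
    ∃ (T : WithLp 2 (Euc a × Euc b) ≃ₗᵢ[ℝ] V) (C₁ : V →L[ℝ] Euc a) (C₂ : V →L[ℝ] Euc b),
      (∀ v, T (WithLp.toLp 2 (C₁ v, C₂ v)) = v) ∧ (∀ v ∈ S, C₂ v = 0) ∧ (∀ v ∈ Sᗮ, C₁ v = 0) := by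
  let ι₁ : S ≃ₗᵢ[ℝ] Euc a := ((stdOrthonormalBasis ℝ S).reindex (finCongr ha)).repr
  let ι₂ : Sᗮ ≃ₗᵢ[ℝ] Euc b := ((stdOrthonormalBasis ℝ Sᗮ).reindex (finCongr hb)).repr
  let T : WithLp 2 (Euc a × Euc b) ≃ₗᵢ[ℝ] V :=
    (S.orthogonalDecomposition.trans (LinearIsometryEquiv.withLpProdCongr 2 ι₁ ι₂)).symm
  refine ⟨T, (ι₁ : S →L[ℝ] Euc a) ∘L S.orthogonalProjectionOnto,
    (ι₂ : Sᗮ →L[ℝ] Euc b) ∘L Sᗮ.orthogonalProjectionOnto, ?_, ?_, ?_⟩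
  · intro v
    rw [← T.symm.injective.eq_iff, LinearIsometryEquiv.symm_apply_apply]
    simp [T]
  · intro v hv
    have : Sᗮ.orthogonalProjectionOnto v = 0 :=
      Submodule.orthogonalProjectionOnto_orthogonal_apply_eq_zero hv
    simp [this]
  · intro v hv
    have : S.orthogonalProjectionOnto v = 0 :=
      Submodule.orthogonalProjectionOnto_apply_of_mem_orthogonal hv
    simp [this]

end ProductSplitting

/-! ### From a split frame to a product of hypersurfaces -/

section ProductImmersion

open Topology Filter

theorem hasFDerivAt_partial_left {X Z V : Type*} [NormedAddCommGroup X] [NormedSpace ℝ X]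
    [NormedAddCommGroup Z] [NormedSpace ℝ Z] [NormedAddCommGroup V] [NormedSpace ℝ V]
    {Γ : X × Z → V} {x : X} {z : Z} (h : DifferentiableAt ℝ Γ (x, z)) :
    HasFDerivAt (fun x' => Γ (x', z)) ((fderiv ℝ Γ (x, z)).comp (.inl ℝ X Z)) x :=
  HasFDerivAt.comp (f := fun x' => (x', z)) x h.hasFDerivAt (hasFDerivAt_prodMk_left x z)

theorem hasFDerivAt_partial_right {X Z V : Type*} [NormedAddCommGroup X] [NormedSpace ℝ X]
    [NormedAddCommGroup Z] [NormedSpace ℝ Z] [NormedAddCommGroup V] [NormedSpace ℝ V]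
    {Γ : X × Z → V} {x : X} {z : Z} (h : DifferentiableAt ℝ Γ (x, z)) :
    HasFDerivAt (fun z' => Γ (x, z')) ((fderiv ℝ Γ (x, z)).comp (.inr ℝ X Z)) z :=
  HasFDerivAt.comp (f := fun z' => (x, z')) z h.hasFDerivAt (hasFDerivAt_prodMk_right x z)

/-- A hypersurface whose shape operator is definite is strictly convex. -/
theorem isStrictlyConvexHypersurface_of_shape {m : ℕ} {W : Set (Euc m)} {h N : Euc m → Euc (m + 1)}
    (hW : IsOpen W) (hh : ContDiffOn ℝ ∞ h W) (hN : ContDiffOn ℝ ∞ N W)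
    (himm : ∀ x ∈ W, Function.Injective (fderiv ℝ h x)) (hunit : ∀ x ∈ W, ‖N x‖ = 1)
    (horth : ∀ x ∈ W, ∀ u : Euc m, ⟪fderiv ℝ h x u, N x⟫_ℝ = 0)
    (hneg : ∀ x ∈ W, ∀ u : Euc m, u ≠ 0 → ⟪fderiv ℝ h x u, fderiv ℝ N x u⟫_ℝ < 0) :
    IsStrictlyConvexHypersurface W h N := by
  refine ⟨hW, hh, himm, hN, hunit, horth, fun x hx u hu => ?_⟩
  rw [inner_fderiv_fderiv_eq_neg
    (((hh.fderiv_infty hW).contDiffAt (hW.mem_nhds hx)).differentiableAt (by simp))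
    ((hN.contDiffAt (hW.mem_nhds hx)).differentiableAt (by simp))
    ((hW.eventually_mem hx).mono fun y hy => horth y hy)]
  linarith [hneg x hx u hu]

/-- A split frame makes the immersion a product of strictly convex hypersurfaces. -/
theorem IsSplitFrame.exists_product {a b : ℕ} {V : Type*} [NormedAddCommGroup V]
    [InnerProductSpace ℝ V] [FiniteDimensional ℝ V] {Γ : Euc a × Euc b → V} {ξ : Euc a → V}
    {η : Euc b → V} {W₁ : Set (Euc a)} {W₂ : Set (Euc b)} (h : IsSplitFrame Γ ξ η W₁ W₂)
    (hdim : Module.finrank ℝ V = a + b + 2) (h₁ : W₁.Nonempty) (h₂ : W₂.Nonempty)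
    (hinj : ∀ x ∈ W₁, ∀ z ∈ W₂, Function.Injective (fderiv ℝ Γ (x, z))) :
    ∃ (h₁ N₁ : Euc a → Euc (a + 1)) (h₂ N₂ : Euc b → Euc (b + 1))
      (T : WithLp 2 (Euc (a + 1) × Euc (b + 1)) ≃ₗᵢ[ℝ] V),
      IsStrictlyConvexHypersurface W₁ h₁ N₁ ∧ IsStrictlyConvexHypersurface W₂ h₂ N₂ ∧
      (∀ x ∈ W₁, ∀ z ∈ W₂, ∀ u v : Euc a × Euc b,
        ⟪fderiv ℝ Γ (x, z) u, fderiv ℝ Γ (x, z) v⟫_ℝ =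
          ⟪fderiv ℝ h₁ x u.1, fderiv ℝ h₁ x v.1⟫_ℝ + ⟪fderiv ℝ h₂ z u.2, fderiv ℝ h₂ z v.2⟫_ℝ) ∧
      (∀ x ∈ W₁, ∀ z ∈ W₂, Γ (x, z) = T (WithLp.toLp 2 (h₁ x, h₂ z))) ∧
      (∀ x ∈ W₁, T (WithLp.toLp 2 (N₁ x, 0)) = ξ x) ∧
      (∀ z ∈ W₂, T (WithLp.toLp 2 (0, N₂ z)) = η z) := by
  obtain ⟨S, fS, fS', mξ, mη, mx, mz⟩ := h.exists_splitting (by simpa using hdim) h₁ h₂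
  obtain ⟨x₀, hx₀⟩ := h₁
  obtain ⟨z₀, hz₀⟩ := h₂
  rw [finrank_euclideanSpace_fin] at fS fS'
  obtain ⟨T, C₁, C₂, hT, hC₂, hC₁⟩ := exists_isometry_of_splitting S fS fS'
  have hinner : ∀ v w, ⟪v, w⟫_ℝ = ⟪C₁ v, C₁ w⟫_ℝ + ⟪C₂ v, C₂ w⟫_ℝ := by
    intro v w
    conv_lhs => rw [← hT v, ← hT w, T.inner_map_map]
    simp [WithLp.prod_inner_apply]
  have hsm : ∀ x ∈ W₁, ∀ z ∈ W₂, DifferentiableAt ℝ Γ (x, z) := fun x hx z hz =>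
    (h.smooth.contDiffAt (h.eventually_mem hx hz)).differentiableAt (by simp)
  have d1 : ∀ x ∈ W₁, ∀ z ∈ W₂, HasFDerivAt (fun x' => C₁ (Γ (x', z)))
      (C₁.comp ((fderiv ℝ Γ (x, z)).comp (.inl ℝ _ _))) x := fun x hx z hz =>
    C₁.hasFDerivAt.comp x (hasFDerivAt_partial_left (hsm x hx z hz))
  have d2 : ∀ x ∈ W₁, ∀ z ∈ W₂, HasFDerivAt (fun z' => C₂ (Γ (x, z')))
      (C₂.comp ((fderiv ℝ Γ (x, z)).comp (.inr ℝ _ _))) z := fun x hx z hz =>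
    C₂.hasFDerivAt.comp z (hasFDerivAt_partial_right (hsm x hx z hz))
  have d1' : ∀ x ∈ W₁, ∀ z ∈ W₂, HasFDerivAt (fun z' => C₁ (Γ (x, z')))
      (C₁.comp ((fderiv ℝ Γ (x, z)).comp (.inr ℝ _ _))) z := fun x hx z hz =>
    C₁.hasFDerivAt.comp z (hasFDerivAt_partial_right (hsm x hx z hz))
  have d2' : ∀ x ∈ W₁, ∀ z ∈ W₂, HasFDerivAt (fun x' => C₂ (Γ (x', z)))
      (C₂.comp ((fderiv ℝ Γ (x, z)).comp (.inl ℝ _ _))) x := fun x hx z hz =>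
    C₂.hasFDerivAt.comp x (hasFDerivAt_partial_left (hsm x hx z hz))
  -- The `z`-derivatives of `Γ` lie in `Sᗮ`, which `C₁` kills, and `W₂` is connected.
  have c1 : ∀ x ∈ W₁, ∀ z ∈ W₂, C₁ (Γ (x, z)) = C₁ (Γ (x, z₀)) := by
    intro x hx z hz
    refine h.isOpen_right.is_const_of_fderiv_eq_zero (𝕜 := ℝ) (f := fun z' => C₁ (Γ (x, z')))
      h.preconnected_right (fun z hz => (d1' x hx z hz).differentiableAt.differentiableWithinAt)
      (fun z hz => ?_) hz hz₀
    rw [(d1' x hx z hz).fderiv]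
    ext1 w
    exact hC₁ _ (mz x hx z hz w)
  have c2 : ∀ x ∈ W₁, ∀ z ∈ W₂, C₂ (Γ (x, z)) = C₂ (Γ (x₀, z)) := by
    intro x hx z hz
    refine h.isOpen_left.is_const_of_fderiv_eq_zero (𝕜 := ℝ) (f := fun x' => C₂ (Γ (x', z)))
      h.preconnected_left (fun x hx => (d2' x hx z hz).differentiableAt.differentiableWithinAt)
      (fun x hx => ?_) hx hx₀
    rw [(d2' x hx z hz).fderiv]
    ext1 u
    exact hC₂ _ (mx x hx z hz u)
  have f1 : ∀ x ∈ W₁, ∀ z ∈ W₂, ∀ u, fderiv ℝ (fun x' => C₁ (Γ (x', z₀))) x u =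
      C₁ (fderiv ℝ Γ (x, z) (u, 0)) := by
    intro x hx z hz u
    have : (fun x' => C₁ (Γ (x', z₀))) =ᶠ[𝓝 x] fun x' => C₁ (Γ (x', z)) :=
      (h.isOpen_left.eventually_mem hx).mono fun x' hx' => (c1 x' hx' z hz).symm
    rw [this.fderiv_eq, (d1 x hx z hz).fderiv]
    rfl
  have f2 : ∀ x ∈ W₁, ∀ z ∈ W₂, ∀ w, fderiv ℝ (fun z' => C₂ (Γ (x₀, z'))) z w =
      C₂ (fderiv ℝ Γ (x, z) (0, w)) := by
    intro x hx z hz w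
    have : (fun z' => C₂ (Γ (x₀, z'))) =ᶠ[𝓝 z] fun z' => C₂ (Γ (x, z')) :=
      (h.isOpen_right.eventually_mem hz).mono fun z' hz' => (c2 x hx z' hz').symm
    rw [this.fderiv_eq, (d2 x hx z hz).fderiv]
    rfl
  have n1 : ∀ x ∈ W₁, ∀ u, fderiv ℝ (fun x' => C₁ (ξ x')) x u = C₁ (fderiv ℝ ξ x u) := by
    intro x hx u
    have := (C₁.hasFDerivAt.comp x (h.differentiableAt_left hx).hasFDerivAt).fderiv
    exact congrArg (fun T : Euc a →L[ℝ] Euc (a + 1) => T u) this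
  have n2 : ∀ z ∈ W₂, ∀ u, fderiv ℝ (fun z' => C₂ (η z')) z u = C₂ (fderiv ℝ η z u) := by
    intro z hz u
    have := (C₂.hasFDerivAt.comp z (h.differentiableAt_right hz).hasFDerivAt).fderiv
    exact congrArg (fun T : Euc b →L[ℝ] Euc (b + 1) => T u) this
  have inner1 : ∀ v ∈ S, ∀ w, ⟪C₁ v, C₁ w⟫_ℝ = ⟪v, w⟫_ℝ := by
    intro v hv w
    rw [hinner v w, hC₂ v hv, inner_zero_left, add_zero]
  have inner2 : ∀ v ∈ Sᗮ, ∀ w, ⟪C₂ v, C₂ w⟫_ℝ = ⟪v, w⟫_ℝ := by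
    intro v hv w
    rw [hinner v w, hC₁ v hv, inner_zero_left, zero_add]
  have norm1 : ∀ v ∈ S, ‖C₁ v‖ = ‖v‖ := by
    intro v hv
    rw [norm_eq_sqrt_real_inner, inner1 v hv, ← norm_eq_sqrt_real_inner]
  have norm2 : ∀ v ∈ Sᗮ, ‖C₂ v‖ = ‖v‖ := by
    intro v hv
    rw [norm_eq_sqrt_real_inner, inner2 v hv, ← norm_eq_sqrt_real_inner]
  -- The factors are the components of `Γ` on the slices through `(x₀, z₀)`; the choice of slice
  -- does not affect these components.
  refine ⟨fun x => C₁ (Γ (x, z₀)), fun x => C₁ (ξ x), fun z => C₂ (Γ (x₀, z)), fun z => C₂ (η z), T,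
    isStrictlyConvexHypersurface_of_shape h.isOpen_left ?_ ?_ ?_ ?_ ?_ ?_,
    isStrictlyConvexHypersurface_of_shape h.isOpen_right ?_ ?_ ?_ ?_ ?_ ?_, ?_, ?_, ?_, ?_⟩
  · exact C₁.contDiff.comp_contDiffOn (h.smooth.comp (by fun_prop) fun x hx => ⟨hx, hz₀⟩)
  · exact C₁.contDiff.comp_contDiffOn h.smooth_left
  · intro x hx
    rw [injective_iff_map_eq_zero]
    intro u hu
    rw [f1 x hx z₀ hz₀, ← norm_eq_zero, norm1 _ (mx x hx z₀ hz₀ u), norm_eq_zero] at hu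
    have := hinj x hx z₀ hz₀ (hu.trans (map_zero _).symm)
    exact congrArg Prod.fst this
  · intro x hx
    rw [norm1 _ (mξ x hx), h.unit_left x hx]
  · intro x hx u
    rw [f1 x hx z₀ hz₀, inner1 _ (mx x hx z₀ hz₀ u), h.normal_left x hx z₀ hz₀]
  · intro x hx u hu
    rw [f1 x hx z₀ hz₀, n1 x hx, inner1 _ (mx x hx z₀ hz₀ u)]
    exact h.neg_left x hx z₀ hz₀ u hu
  · exact C₂.contDiff.comp_contDiffOn (h.smooth.comp (by fun_prop) fun z hz => ⟨hx₀, hz⟩)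
  · exact C₂.contDiff.comp_contDiffOn h.smooth_right
  · intro z hz
    rw [injective_iff_map_eq_zero]
    intro w hw
    rw [f2 x₀ hx₀ z hz, ← norm_eq_zero, norm2 _ (mz x₀ hx₀ z hz w), norm_eq_zero] at hw
    have := hinj x₀ hx₀ z hz (hw.trans (map_zero _).symm)
    exact congrArg Prod.snd this
  · intro z hz
    rw [norm2 _ (mη z hz), h.unit_right z hz]
  · intro z hz w
    rw [f2 x₀ hx₀ z hz, inner2 _ (mz x₀ hx₀ z hz w), h.normal_right x₀ hx₀ z hz]
  · intro z hz w hw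
    rw [f2 x₀ hx₀ z hz, n2 z hz, inner2 _ (mz x₀ hx₀ z hz w)]
    exact h.neg_right x₀ hx₀ z hz w hw
  · intro x hx z hz u v
    have key1 : ∀ u : Euc a × Euc b,
        C₁ (fderiv ℝ Γ (x, z) u) = C₁ (fderiv ℝ Γ (x, z) (u.1, 0)) := by
      intro u
      have : u = (u.1, 0) + (0, u.2) := by simp
      conv_lhs => rw [this, map_add, map_add, hC₁ _ (mz x hx z hz u.2), add_zero]
    have key2 : ∀ u : Euc a × Euc b,
        C₂ (fderiv ℝ Γ (x, z) u) = C₂ (fderiv ℝ Γ (x, z) (0, u.2)) := by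
      intro u
      have : u = (u.1, 0) + (0, u.2) := by simp
      conv_lhs => rw [this, map_add, map_add, hC₂ _ (mx x hx z hz u.1), zero_add]
    rw [hinner, key1 u, key1 v, key2 u, key2 v, f1 x hx z hz, f1 x hx z hz, f2 x hx z hz,
      f2 x hx z hz]
  · intro x hx z hz
    simp only
    rw [← c1 x hx z hz, ← c2 x hx z hz, hT]
  · intro x hx
    have := hT (ξ x)
    rwa [hC₂ _ (mξ x hx)] at this
  · intro z hz
    have := hT (η z)
    rwa [hC₁ _ (mη z hz)] at this

/-- A linear map to a Euclidean space which is injective on a given subspace. -/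
theorem exists_linearMap_injOn_range {V : Type*} [NormedAddCommGroup V] [InnerProductSpace ℝ V]
    [FiniteDimensional ℝ V] (S : Submodule ℝ V) {a : ℕ} (ha : Module.finrank ℝ S = a) :
    ∃ P : V →L[ℝ] Euc a, ∀ v ∈ S, P v = 0 → v = 0 := by
  obtain ⟨T, C₁, C₂, hT, hC₂, -⟩ := exists_isometry_of_splitting S ha rfl
  refine ⟨C₁, fun v hv h0 => ?_⟩
  rw [← hT v, h0, hC₂ v hv]
  exact map_zero T

end ProductImmersion

/-! ### Coordinates separating the two normal fields -/

section AdaptedCoordinates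

open Topology Filter

variable {E V : Type*} [NormedAddCommGroup E] [InnerProductSpace ℝ E]
  [NormedAddCommGroup V] [InnerProductSpace ℝ V] [FiniteDimensional ℝ E] [FiniteDimensional ℝ V]

theorem IsAdaptedFrame.differentiableAt_left {G ξ η : E → V} {Ω : Set E}
    (h : IsAdaptedFrame G ξ η Ω) {y : E} (hy : y ∈ Ω) : DifferentiableAt ℝ ξ y :=
  (h.smooth_left.contDiffAt (h.isOpen.mem_nhds hy)).differentiableAt (by simp)

/-- There is a linear map to a Euclidean space detecting the derivative of `ξ` at a point. -/
theorem IsAdaptedFrame.exists_linearMap (hdim : Module.finrank ℝ V = Module.finrank ℝ E + 2)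
    {G ξ η : E → V} {Ω : Set E} (h : IsAdaptedFrame G ξ η Ω) {y : E} (hy : y ∈ Ω) {a : ℕ}
    (ha : Module.finrank ℝ (nullSpace (fderiv ℝ (fderiv ℝ G) y) (η y)) = a) :
    ∃ P : V →L[ℝ] Euc a, ∀ u, P (fderiv ℝ ξ y u) = 0 →
      u ∈ nullSpace (fderiv ℝ (fderiv ℝ G) y) (ξ y) := by
  have hker : LinearMap.ker (fderiv ℝ ξ y).toLinearMap =
      nullSpace (fderiv ℝ (fderiv ℝ G) y) (ξ y) := by
    ext u
    exact ⟨fun hu => h.mem_nullSpace_of_fderiv hy hu, fun hu => h.fderiv_left_eq_zero hdim hy hu⟩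
  -- The rank of the derivative of `ξ` is the codimension of the null space of `ξ`, which is the
  -- dimension of its complement, the null space of `η`.
  have hfr : Module.finrank ℝ (LinearMap.range (fderiv ℝ ξ y).toLinearMap) = a := by
    have h1 := LinearMap.finrank_range_add_finrank_ker (fderiv ℝ ξ y).toLinearMap
    have h2 := Submodule.finrank_add_eq_of_isCompl (h.adapted y hy).compl
    rw [hker] at h1
    omega
  obtain ⟨P, hP⟩ := exists_linearMap_injOn_range _ hfr
  exact ⟨P, fun u hu => h.mem_nullSpace_of_fderiv hy (hP _ ⟨u, rfl⟩ hu)⟩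

/-- A local diffeomorphism, defined on a product of balls, inverting `Ψ` near a point. -/
theorem exists_inverse_on_product {a b : ℕ} {Ψ : E → Euc a × Euc b} {Ω : Set E} (hΩ : IsOpen Ω)
    (hΨ : ContDiffOn ℝ ∞ Ψ Ω) {y₀ : E} (hy₀ : y₀ ∈ Ω) (hinj : Function.Injective (fderiv ℝ Ψ y₀))
    (hfr : Module.finrank ℝ E = a + b) :
    ∃ (e : OpenPartialHomeomorph (Euc a × Euc b) E) (r : ℝ), 0 < r ∧
      e.source = Metric.ball (Ψ y₀).1 r ×ˢ Metric.ball (Ψ y₀).2 r ∧ y₀ ∈ e.target ∧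
      e.target ⊆ Ω ∧ ContDiffOn ℝ ∞ e e.source ∧ ContDiffOn ℝ ∞ e.symm e.target ∧
      (∀ q ∈ e.source, ∀ v, fderiv ℝ Ψ (e q) (fderiv ℝ e q v) = v) ∧
      (∀ y ∈ e.target, Function.Injective (fderiv ℝ Ψ y)) := by
  have hΨat : ContDiffAt ℝ ∞ Ψ y₀ := hΨ.contDiffAt (hΩ.mem_nhds hy₀)
  have hfr' : Module.finrank ℝ E = Module.finrank ℝ (Euc a × Euc b) := by
    rw [Module.finrank_prod, finrank_euclideanSpace_fin, finrank_euclideanSpace_fin, hfr]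
  let L₀ : E ≃L[ℝ] Euc a × Euc b := (LinearEquiv.ofInjectiveOfFinrankEq
    (fderiv ℝ Ψ y₀).toLinearMap hinj hfr').toContinuousLinearEquiv
  have hL₀ : (L₀ : E →L[ℝ] Euc a × Euc b) = fderiv ℝ Ψ y₀ := by
    ext1 v
    rfl
  have hd₀ : HasFDerivAt Ψ (L₀ : E →L[ℝ] Euc a × Euc b) y₀ := by
    rw [hL₀]
    exact (hΨat.differentiableAt (by simp)).hasFDerivAt
  let e₁ := hΨat.toOpenPartialHomeomorph Ψ hd₀ (by simp)
  have he₁ : ∀ y, e₁ y = Ψ y := fun y => rfl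
  let R : Set (E →L[ℝ] Euc a × Euc b) := range fun M : E ≃L[ℝ] Euc a × Euc b => (M : E →L[ℝ] _)
  have hR : IsOpen R := ContinuousLinearEquiv.isOpen
  -- Restricting to points where the derivative of `Ψ` is invertible, an open set, makes the inverse
  -- smooth on its whole domain and not just at `Ψ y₀`.
  let Ω₁ := Ω ∩ fderiv ℝ Ψ ⁻¹' R
  have hΩ₁ : IsOpen Ω₁ := (hΨ.fderiv_infty hΩ).continuousOn.isOpen_inter_preimage hΩ hR
  let e₂ := e₁.restrOpen Ω₁ hΩ₁
  have hs₂ : e₂.source = e₁.source ∩ Ω₁ := e₁.restrOpen_source Ω₁ hΩ₁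
  have he₂ : ∀ y, e₂ y = Ψ y := fun y => rfl
  have hy₀₂ : y₀ ∈ e₂.source := by
    rw [hs₂]
    exact ⟨hΨat.mem_toOpenPartialHomeomorph_source hd₀ (by simp), hy₀, L₀, hL₀⟩
  obtain ⟨r, hr, hball⟩ := Metric.isOpen_iff.1 e₂.open_target (Ψ y₀) (e₂.map_source hy₀₂)
  have hW : Metric.ball (Ψ y₀).1 r ×ˢ Metric.ball (Ψ y₀).2 r ⊆ e₂.target := by
    rw [ball_prod_same]
    exact hball
  let e := e₂.symm.restrOpen (Metric.ball (Ψ y₀).1 r ×ˢ Metric.ball (Ψ y₀).2 r)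
    (Metric.isOpen_ball.prod Metric.isOpen_ball)
  have hsrc : e.source = Metric.ball (Ψ y₀).1 r ×ˢ Metric.ball (Ψ y₀).2 r := by
    rw [show e.source = e₂.target ∩ _ from e₂.symm.restrOpen_source _ _]
    exact inter_eq_right.2 hW
  have heq : ∀ q, e q = e₂.symm q := fun q => rfl
  have hesymm : ∀ y, e.symm y = Ψ y := fun y => rfl
  have htgt : e.target ⊆ Ω₁ := by
    intro y hy
    have h1 : e.symm y ∈ e.source := e.map_target hy
    have h2 : e (e.symm y) ∈ e₂.source := e₂.map_target (hW (hsrc ▸ h1))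
    rw [e.right_inv hy, hs₂] at h2
    exact h2.2
  have hy₀t : y₀ ∈ e.target := by
    have h1 : Ψ y₀ ∈ e.source := by
      rw [hsrc]
      exact ⟨Metric.mem_ball_self hr, Metric.mem_ball_self hr⟩
    have h2 := e.map_source h1
    have h3 : e (Ψ y₀) = y₀ := e₂.left_inv hy₀₂
    rwa [h3] at h2
  have hΨd : ∀ y ∈ Ω, DifferentiableAt ℝ Ψ y := fun y hy =>
    (hΨ.contDiffAt (hΩ.mem_nhds hy)).differentiableAt (by simp)
  have hsm : ∀ q ∈ e.source, ContDiffAt ℝ ∞ e q := by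
    intro q hq
    have hyq : e q ∈ Ω₁ := htgt (e.map_source hq)
    obtain ⟨M, hM⟩ := hyq.2
    have h1 : HasFDerivAt e₂ (M : E →L[ℝ] Euc a × Euc b) (e₂.symm q) := by
      have hM' : (M : E →L[ℝ] Euc a × Euc b) = fderiv ℝ Ψ (e q) := hM
      rw [hM']
      exact (hΨd _ hyq.1).hasFDerivAt
    exact e₂.contDiffAt_symm (hW (hsrc ▸ hq)) h1 (hΨ.contDiffAt (hΩ.mem_nhds hyq.1))
  refine ⟨e, r, hr, hsrc, hy₀t, fun y hy => (htgt hy).1,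
    fun q hq => (hsm q hq).contDiffWithinAt, ?_, ?_, ?_⟩
  · exact hΨ.mono fun y hy => (htgt hy).1
  · intro q hq v
    have hyq : e q ∈ Ω₁ := htgt (e.map_source hq)
    have h1 : HasFDerivAt (Ψ ∘ e) ((fderiv ℝ Ψ (e q)).comp (fderiv ℝ e q)) q :=
      HasFDerivAt.comp q (hΨd _ hyq.1).hasFDerivAt
        ((hsm q hq).differentiableAt (by simp)).hasFDerivAt
    have h2 : Ψ ∘ e =ᶠ[𝓝 q] id :=
      (e.open_source.eventually_mem hq).mono fun q' hq' => e.left_inv hq'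
    have h3 := h1.unique ((hasFDerivAt_id q).congr_of_eventuallyEq h2)
    exact congrArg (fun T : Euc a × Euc b →L[ℝ] Euc a × Euc b => T v) h3
  · intro y hy
    obtain ⟨M, hM⟩ := (htgt hy).2
    have hM' : (M : E →L[ℝ] Euc a × Euc b) = fderiv ℝ Ψ y := hM
    rw [← hM']
    exact M.injective

/-- Coordinates in which each vector of an adapted frame depends on one factor only. -/
theorem IsAdaptedFrame.exists_coordinates
    (hdim : Module.finrank ℝ V = Module.finrank ℝ E + 2)
    {G ξ η : E → V} {Ω : Set E} (h : IsAdaptedFrame G ξ η Ω) {y₀ : E} (hy₀ : y₀ ∈ Ω) {a b : ℕ}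
    (ha : Module.finrank ℝ (nullSpace (fderiv ℝ (fderiv ℝ G) y₀) (η y₀)) = a)
    (hb : Module.finrank ℝ (nullSpace (fderiv ℝ (fderiv ℝ G) y₀) (ξ y₀)) = b) :
    ∃ (e : OpenPartialHomeomorph (Euc a × Euc b) E) (W₁ : Set (Euc a)) (W₂ : Set (Euc b))
      (ξ' : Euc a → V) (η' : Euc b → V), W₁.Nonempty ∧ W₂.Nonempty ∧ e.source = W₁ ×ˢ W₂ ∧
      y₀ ∈ e.target ∧ e.target ⊆ Ω ∧ ContDiffOn ℝ ∞ e e.source ∧ ContDiffOn ℝ ∞ e.symm e.target ∧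
      IsSplitFrame (G ∘ e) ξ' η' W₁ W₂ ∧
      (∀ x ∈ W₁, ∀ z ∈ W₂, Function.Injective (fderiv ℝ (G ∘ e) (x, z))) ∧
      (∀ x ∈ W₁, ∀ z ∈ W₂, ξ (e (x, z)) = ξ' x) ∧
      (∀ x ∈ W₁, ∀ z ∈ W₂, η (e (x, z)) = η' z) := by
  obtain ⟨P₁, hP₁⟩ := h.exists_linearMap hdim hy₀ ha
  obtain ⟨P₂, hP₂⟩ := h.swap.exists_linearMap hdim hy₀ hb
  -- `P₁` and `P₂` pick enough components of `ξ` and `η`. A vector killed by the derivative of `Ψ`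
  -- at `y₀` lies in both null spaces, so `Ψ` is a chart there.
  let Ψ : E → Euc a × Euc b := fun y => (P₁ (ξ y), P₂ (η y))
  have hΨ : ContDiffOn ℝ ∞ Ψ Ω := (P₁.contDiff.comp_contDiffOn h.smooth_left).prodMk
    (P₂.contDiff.comp_contDiffOn h.smooth_right)
  have hΨ' : ∀ y ∈ Ω, ∀ u, fderiv ℝ Ψ y u = (P₁ (fderiv ℝ ξ y u), P₂ (fderiv ℝ η y u)) := by
    intro y hy u
    have h1 : HasFDerivAt Ψ ((P₁.comp (fderiv ℝ ξ y)).prod (P₂.comp (fderiv ℝ η y))) y :=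
      (P₁.hasFDerivAt.comp y (h.differentiableAt_left hy).hasFDerivAt).prodMk
        (P₂.hasFDerivAt.comp y (h.swap.differentiableAt_left hy).hasFDerivAt)
    rw [h1.fderiv]
    rfl
  have hinj₀ : Function.Injective (fderiv ℝ Ψ y₀) := by
    rw [injective_iff_map_eq_zero]
    intro u hu
    rw [hΨ' y₀ hy₀] at hu
    exact (Submodule.disjoint_def.1 (h.adapted y₀ hy₀).compl.disjoint) u
      (hP₁ u (congrArg Prod.fst hu)) (hP₂ u (congrArg Prod.snd hu))
  have hfr : Module.finrank ℝ E = a + b := by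
    rw [← ha, ← hb, add_comm]
    exact (Submodule.finrank_add_eq_of_isCompl (h.adapted y₀ hy₀).compl).symm
  obtain ⟨e, r, hr, hsrc, hy₀t, htgt, hsm, hsm', hid, hΨinj⟩ :=
    exists_inverse_on_product h.isOpen hΨ hy₀ hinj₀ hfr
  set W₁ := Metric.ball (Ψ y₀).1 r with hW₁
  set W₂ := Metric.ball (Ψ y₀).2 r with hW₂
  have hmem : ∀ {x z}, x ∈ W₁ → z ∈ W₂ → (x, z) ∈ e.source := by
    intro x z hx hz
    rw [hsrc]
    exact ⟨hx, hz⟩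
  have hx₀ : (Ψ y₀).1 ∈ W₁ := Metric.mem_ball_self hr
  have hz₀ : (Ψ y₀).2 ∈ W₂ := Metric.mem_ball_self hr
  have hΩ : ∀ {x z}, x ∈ W₁ → z ∈ W₂ → e (x, z) ∈ Ω := fun hx hz =>
    htgt (e.map_source (hmem hx hz))
  have hed : ∀ {q}, q ∈ e.source → DifferentiableAt ℝ e q := fun {q} hq =>
    (hsm.contDiffAt (e.open_source.mem_nhds hq)).differentiableAt (by simp)
  -- `P₁` was chosen at `y₀` only. At another `y`, write `v = s + t` with `s` null for `ξ` and `t`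
  -- null for `η`: the derivative of `ξ` kills `s` and that of `η` kills `t`, so the derivative of
  -- `Ψ` kills `t`, whence `t = 0`.
  have hker : ∀ y ∈ e.target, ∀ v, P₁ (fderiv ℝ ξ y v) = 0 →
      v ∈ nullSpace (fderiv ℝ (fderiv ℝ G) y) (ξ y) := by
    intro y hy v hv
    have hc := (h.adapted y (htgt hy)).compl
    have hv' : v ∈ nullSpace (fderiv ℝ (fderiv ℝ G) y) (ξ y) ⊔
        nullSpace (fderiv ℝ (fderiv ℝ G) y) (η y) := by
      rw [hc.sup_eq_top]
      trivial
    obtain ⟨s, hs, t, ht, rfl⟩ := Submodule.mem_sup.1 hv'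
    have hs' := h.fderiv_left_eq_zero hdim (htgt hy) hs
    have ht' := h.swap.fderiv_left_eq_zero hdim (htgt hy) ht
    have ht0 : t = 0 := by
      refine hΨinj y hy ?_
      rw [map_zero, hΨ' y (htgt hy), ht']
      rw [map_add, hs', zero_add] at hv
      rw [hv, map_zero]
      rfl
    rwa [ht0, add_zero]
  have hker' : ∀ y ∈ e.target, ∀ v, P₂ (fderiv ℝ η y v) = 0 →
      v ∈ nullSpace (fderiv ℝ (fderiv ℝ G) y) (η y) := by
    intro y hy v hv
    have hc := (h.adapted y (htgt hy)).compl
    have hv' : v ∈ nullSpace (fderiv ℝ (fderiv ℝ G) y) (ξ y) ⊔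
        nullSpace (fderiv ℝ (fderiv ℝ G) y) (η y) := by
      rw [hc.sup_eq_top]
      trivial
    obtain ⟨s, hs, t, ht, rfl⟩ := Submodule.mem_sup.1 hv'
    have hs' := h.fderiv_left_eq_zero hdim (htgt hy) hs
    have ht' := h.swap.fderiv_left_eq_zero hdim (htgt hy) ht
    have hs0 : s = 0 := by
      refine hΨinj y hy ?_
      rw [map_zero, hΨ' y (htgt hy), hs']
      rw [map_add, ht', add_zero] at hv
      rw [hv, map_zero]
      rfl
    rwa [hs0, zero_add]
  have hσ : ∀ q ∈ e.source, ∀ v, (P₁ (fderiv ℝ ξ (e q) (fderiv ℝ e q v)),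
      P₂ (fderiv ℝ η (e q) (fderiv ℝ e q v))) = v := by
    intro q hq v
    rw [← hΨ' _ (htgt (e.map_source hq))]
    exact hid q hq v
  have hσinj : ∀ q ∈ e.source, ∀ v, fderiv ℝ e q v = 0 → v = 0 := by
    intro q hq v hv
    rw [← hid q hq v, hv, map_zero]
  have hn1 : ∀ q ∈ e.source, ∀ w, fderiv ℝ e q (0, w) ∈
      nullSpace (fderiv ℝ (fderiv ℝ G) (e q)) (ξ (e q)) := fun q hq w =>
    hker _ (e.map_source hq) _ (congrArg Prod.fst (hσ q hq (0, w)))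
  have hn2 : ∀ q ∈ e.source, ∀ u, fderiv ℝ e q (u, 0) ∈
      nullSpace (fderiv ℝ (fderiv ℝ G) (e q)) (η (e q)) := fun q hq u =>
    hker' _ (e.map_source hq) _ (congrArg Prod.snd (hσ q hq (u, 0)))
  have dcomp : ∀ {g : E → V}, ∀ q ∈ e.source, DifferentiableAt ℝ g (e q) →
      HasFDerivAt (g ∘ e) ((fderiv ℝ g (e q)).comp (fderiv ℝ e q)) q := fun q hq hg =>
    HasFDerivAt.comp q hg.hasFDerivAt (hed hq).hasFDerivAt
  have dξ : ∀ {x z}, x ∈ W₁ → z ∈ W₂ → DifferentiableAt ℝ ξ (e (x, z)) := fun hx hz =>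
    h.differentiableAt_left (hΩ hx hz)
  have dη : ∀ {x z}, x ∈ W₁ → z ∈ W₂ → DifferentiableAt ℝ η (e (x, z)) := fun hx hz =>
    h.swap.differentiableAt_left (hΩ hx hz)
  have dG : ∀ {x z}, x ∈ W₁ → z ∈ W₂ → DifferentiableAt ℝ G (e (x, z)) := fun hx hz =>
    (h.smooth.contDiffAt (h.isOpen.mem_nhds (hΩ hx hz))).differentiableAt (by simp)
  -- The `z`-directions are null for `ξ`, so the Codazzi argument makes `ξ` constant in `z`.
  have cξ : ∀ x ∈ W₁, ∀ z ∈ W₂, ξ (e (x, z)) = ξ (e (x, (Ψ y₀).2)) := by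
    intro x hx z hz
    have hd : ∀ z ∈ W₂, HasFDerivAt (fun z' => (ξ ∘ e) (x, z')) _ z := fun z hz =>
      hasFDerivAt_partial_right (dcomp _ (hmem hx hz) (dξ hx hz)).differentiableAt
    refine Metric.isOpen_ball.is_const_of_fderiv_eq_zero (𝕜 := ℝ) (f := fun z' => (ξ ∘ e) (x, z'))
      (convex_ball _ r).isPreconnected
      (fun z hz => (hd z hz).differentiableAt.differentiableWithinAt) (fun z hz => ?_) hz hz₀
    rw [(hd z hz).fderiv, (dcomp _ (hmem hx hz) (dξ hx hz)).fderiv]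
    ext1 w
    exact h.fderiv_left_eq_zero hdim (hΩ hx hz) (hn1 _ (hmem hx hz) w)
  have cη : ∀ x ∈ W₁, ∀ z ∈ W₂, η (e (x, z)) = η (e ((Ψ y₀).1, z)) := by
    intro x hx z hz
    have hd : ∀ x ∈ W₁, HasFDerivAt (fun x' => (η ∘ e) (x', z)) _ x := fun x hx =>
      hasFDerivAt_partial_left (dcomp _ (hmem hx hz) (dη hx hz)).differentiableAt
    refine Metric.isOpen_ball.is_const_of_fderiv_eq_zero (𝕜 := ℝ) (f := fun x' => (η ∘ e) (x', z))
      (convex_ball _ r).isPreconnected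
      (fun x hx => (hd x hx).differentiableAt.differentiableWithinAt) (fun x hx => ?_) hx hx₀
    rw [(hd x hx).fderiv, (dcomp _ (hmem hx hz) (dη hx hz)).fderiv]
    ext1 u
    exact h.swap.fderiv_left_eq_zero hdim (hΩ hx hz) (hn2 _ (hmem hx hz) u)
  have hwein : ∀ {y}, y ∈ Ω → ∀ v, ⟪fderiv ℝ (fderiv ℝ G) y v v, ξ y⟫_ℝ =
      -⟪fderiv ℝ G y v, fderiv ℝ ξ y v⟫_ℝ := fun {y} hy v =>
    inner_fderiv_fderiv_eq_neg
      (((h.smooth.fderiv_infty h.isOpen).contDiffAt (h.isOpen.mem_nhds hy)).differentiableAt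
        (by simp)) (h.differentiableAt_left hy)
      ((h.isOpen.eventually_mem hy).mono fun z hz => (h.adapted z hz).normal_left) v v
  have hwein' : ∀ {y}, y ∈ Ω → ∀ v, ⟪fderiv ℝ (fderiv ℝ G) y v v, η y⟫_ℝ =
      -⟪fderiv ℝ G y v, fderiv ℝ η y v⟫_ℝ := fun {y} hy v =>
    inner_fderiv_fderiv_eq_neg
      (((h.smooth.fderiv_infty h.isOpen).contDiffAt (h.isOpen.mem_nhds hy)).differentiableAt
        (by simp)) (h.swap.differentiableAt_left hy)
      ((h.isOpen.eventually_mem hy).mono fun z hz => (h.adapted z hz).normal_right) v v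
  have hsymm : ∀ {y}, y ∈ Ω → ∀ u v, fderiv ℝ (fderiv ℝ G) y u v = fderiv ℝ (fderiv ℝ G) y v u :=
    fun hy => fderiv_fderiv_symm (h.smooth.contDiffAt (h.isOpen.mem_nhds hy))
  have fξ : ∀ x ∈ W₁, ∀ z ∈ W₂, ∀ u, fderiv ℝ (fun x' => ξ (e (x', (Ψ y₀).2))) x u =
      fderiv ℝ ξ (e (x, z)) (fderiv ℝ e (x, z) (u, 0)) := by
    intro x hx z hz u
    have h1 : (fun x' => ξ (e (x', (Ψ y₀).2))) =ᶠ[𝓝 x] fun x' => (ξ ∘ e) (x', z) :=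
      (Metric.isOpen_ball.eventually_mem hx).mono fun x' hx' => (cξ x' hx' z hz).symm
    have h2 := dcomp _ (hmem hx hz) (dξ hx hz)
    rw [h1.fderiv_eq, (hasFDerivAt_partial_left h2.differentiableAt).fderiv, h2.fderiv]
    rfl
  have fη : ∀ x ∈ W₁, ∀ z ∈ W₂, ∀ w, fderiv ℝ (fun z' => η (e ((Ψ y₀).1, z'))) z w =
      fderiv ℝ η (e (x, z)) (fderiv ℝ e (x, z) (0, w)) := by
    intro x hx z hz w
    have h1 : (fun z' => η (e ((Ψ y₀).1, z'))) =ᶠ[𝓝 z] fun z' => (η ∘ e) (x, z') :=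
      (Metric.isOpen_ball.eventually_mem hz).mono fun z' hz' => (cη x hx z' hz').symm
    have h2 := dcomp _ (hmem hx hz) (dη hx hz)
    rw [h1.fderiv_eq, (hasFDerivAt_partial_right h2.differentiableAt).fderiv, h2.fderiv]
    rfl
  have fG : ∀ {x z}, x ∈ W₁ → z ∈ W₂ → ∀ v, fderiv ℝ (G ∘ e) (x, z) v =
      fderiv ℝ G (e (x, z)) (fderiv ℝ e (x, z) v) := by
    intro x z hx hz v
    rw [(dcomp _ (hmem hx hz) (dG hx hz)).fderiv]
    rfl
  have smooth_comp : ∀ {g : E → V}, ContDiffOn ℝ ∞ g Ω → ContDiffOn ℝ ∞ (g ∘ e) (W₁ ×ˢ W₂) := by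
    intro g hg
    refine hg.comp (hsrc ▸ hsm) fun q hq => hΩ hq.1 hq.2
  refine ⟨e, W₁, W₂, fun x => ξ (e (x, (Ψ y₀).2)), fun z => η (e ((Ψ y₀).1, z)), ⟨_, hx₀⟩,
    ⟨_, hz₀⟩, hsrc, hy₀t, htgt, hsm, hsm', ⟨Metric.isOpen_ball, Metric.isOpen_ball,
    (convex_ball _ r).isPreconnected, (convex_ball _ r).isPreconnected, smooth_comp h.smooth,
    ?_, ?_, ?_, ?_, ?_, ?_, ?_, ?_, ?_⟩, ?_, cξ, cη⟩
  · exact (smooth_comp h.smooth_left).comp (f := fun x => (x, (Ψ y₀).2)) (by fun_prop)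
      fun x hx => ⟨hx, hz₀⟩
  · exact (smooth_comp h.smooth_right).comp (f := fun z => ((Ψ y₀).1, z)) (by fun_prop)
      fun z hz => ⟨hx₀, hz⟩
  · intro x hx z hz q
    rw [fG hx hz, ← cξ x hx z hz]
    exact (h.adapted _ (hΩ hx hz)).normal_left _
  · intro x hx z hz q
    rw [fG hx hz, ← cη x hx z hz]
    exact (h.adapted _ (hΩ hx hz)).normal_right _
  · exact fun x hx => (h.adapted _ (hΩ hx hz₀)).norm_left
  · exact fun z hz => (h.adapted _ (hΩ hx₀ hz)).norm_right
  · intro x hx z hz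
    rw [← cξ x hx z hz, ← cη x hx z hz]
    exact (h.adapted _ (hΩ hx hz)).orth
  · intro x hx z hz u hu
    rw [fG hx hz, fξ x hx z hz]
    -- The `x`-directions are null for `η`, where the form along `ξ` is positive; Weingarten turns
    -- this into negativity of the pairing with the derivative of `ξ`.
    have h1 := (h.adapted _ (hΩ hx hz)).pos_left (hsymm (hΩ hx hz)) (hn2 _ (hmem hx hz) u)
      fun h0 => hu (congrArg Prod.fst (hσinj _ (hmem hx hz) _ h0))
    rw [hwein (hΩ hx hz)] at h1
    linarith
  · intro x hx z hz w hw
    rw [fG hx hz, fη x hx z hz]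
    have h1 := (h.adapted _ (hΩ hx hz)).pos_right (hsymm (hΩ hx hz)) (hn1 _ (hmem hx hz) w)
      fun h0 => hw (congrArg Prod.snd (hσinj _ (hmem hx hz) _ h0))
    rw [hwein' (hΩ hx hz)] at h1
    linarith
  · intro x hx z hz
    rw [injective_iff_map_eq_zero]
    intro v hv
    rw [fG hx hz] at hv
    exact hσinj _ (hmem hx hz) _ (h.immersion _ (hΩ hx hz) (hv.trans (map_zero _).symm))

end AdaptedCoordinates

/-! ### Comparison of preferred charts -/

section ChartRepresentation

open Topology Filter

variable {n : ℕ} {M : Type*} [TopologicalSpace M] [ChartedSpace (Euc n) M]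

/-- The expression of `f` in the preferred chart at `p`. -/
def chartRep {d : ℕ} (f : M → Euc d) (p : M) : Euc n → Euc d := f ∘ (extChartAt (𝓡 n) p).symm

theorem diffAt_eq_fderiv_chartRep {d : ℕ} {f : M → Euc d}
    (hf : ContMDiff (𝓡 n) 𝓘(ℝ, Euc d) ∞ f) (q : M) (u : Euc n) :
    diffAt (n := n) f q u = fderiv ℝ (chartRep f q) (extChartAt (𝓡 n) q q) u := by
  have h := (hf.contMDiffAt (x := q)).mdifferentiableAt (by simp)
  unfold diffAt
  rw [h.mfderiv]
  simp only [ModelWithCorners.range_eq_univ, fderivWithin_univ]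
  rfl

theorem inner_secondFF {d : ℕ} (f : M → Euc d) (q : M) (X Y : TangentSpace (𝓡 n) q) {ζ : Euc d}
    (hζ : ζ ∈ normalSpaceAt (n := n) f q) :
    ⟪secondFF f q X Y, ζ⟫_ℝ = ⟪secondDeriv (n := n) f q X Y, ζ⟫_ℝ := by
  unfold secondFF
  rw [Submodule.inner_starProjection_left_eq_right, Submodule.starProjection_eq_self_iff.2 hζ]

variable [IsManifold (𝓡 n) ∞ M]

theorem contMDiffAt_extChartAt_symm' {p : M} {y : Euc n} (hy : y ∈ (extChartAt (𝓡 n) p).target) :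
    ContMDiffAt 𝓘(ℝ, Euc n) (𝓡 n) ∞ (extChartAt (𝓡 n) p).symm y :=
  (contMDiffOn_extChartAt_symm p).contMDiffAt ((isOpen_extChartAt_target p).mem_nhds hy)

theorem contDiffOn_chartRep {d : ℕ} {f : M → Euc d} (hf : ContMDiff (𝓡 n) 𝓘(ℝ, Euc d) ∞ f)
    (p : M) : ContDiffOn ℝ ∞ (chartRep f p) (extChartAt (𝓡 n) p).target :=
  contMDiffOn_iff_contDiffOn.1 (hf.comp_contMDiffOn (contMDiffOn_extChartAt_symm p))

/-- Change of charts. -/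
theorem exists_chart_change (p : M) {y : Euc n} (hy : y ∈ (extChartAt (𝓡 n) p).target) {q : M}
    (hq : (extChartAt (𝓡 n) p).symm y = q) :
    ∃ κ : Euc n → Euc n, ContDiffAt ℝ ∞ κ y ∧ κ y = extChartAt (𝓡 n) q q ∧
      Function.Injective (fderiv ℝ κ y) ∧
      ∀ {d : ℕ} (f : M → Euc d), chartRep f p =ᶠ[𝓝 y] chartRep f q ∘ κ := by
  have hsy := contMDiffAt_extChartAt_symm' hy
  have hqs : q ∈ (extChartAt (𝓡 n) p).source := hq ▸ (extChartAt (𝓡 n) p).map_target hy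
  have hpq : extChartAt (𝓡 n) p q = y := by rw [← hq, (extChartAt (𝓡 n) p).right_inv hy]
  have hκ : ContDiffAt ℝ ∞ (extChartAt (𝓡 n) q ∘ (extChartAt (𝓡 n) p).symm) y := by
    rw [← contMDiffAt_iff_contDiffAt]
    refine ContMDiffAt.comp y ?_ hsy
    rw [hq]
    exact contMDiffAt_extChartAt
  have hlam : ContDiffAt ℝ ∞ (extChartAt (𝓡 n) p ∘ (extChartAt (𝓡 n) q).symm)
      (extChartAt (𝓡 n) q q) := by
    rw [← contMDiffAt_iff_contDiffAt]
    refine ContMDiffAt.comp _ ?_ (contMDiffAt_extChartAt_symm' (mem_extChartAt_target q))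
    rw [extChartAt_to_inv]
    exact contMDiffAt_extChartAt' (by rwa [extChartAt_source] at hqs)
  have hmem : ∀ᶠ y' in 𝓝 y, y' ∈ (extChartAt (𝓡 n) p).target ∧
      (extChartAt (𝓡 n) p).symm y' ∈ (extChartAt (𝓡 n) q).source := by
    refine ((isOpen_extChartAt_target p).eventually_mem hy).and (hsy.continuousAt.eventually ?_)
    rw [hq]
    exact extChartAt_source_mem_nhds q
  have hκ0 : (extChartAt (𝓡 n) q ∘ (extChartAt (𝓡 n) p).symm) y = extChartAt (𝓡 n) q q := by
    rw [Function.comp_apply, hq]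
  refine ⟨extChartAt (𝓡 n) q ∘ (extChartAt (𝓡 n) p).symm, hκ, hκ0, ?_, ?_⟩
  -- The reverse transition map is a local left inverse, so the derivative of `κ` is injective.
  · have h1 : (extChartAt (𝓡 n) p ∘ (extChartAt (𝓡 n) q).symm) ∘
        (extChartAt (𝓡 n) q ∘ (extChartAt (𝓡 n) p).symm) =ᶠ[𝓝 y] id := by
      filter_upwards [hmem] with y' hy'
      simp only [Function.comp_apply, id]
      rw [(extChartAt (𝓡 n) q).left_inv hy'.2, (extChartAt (𝓡 n) p).right_inv hy'.1]
    have h2 : HasFDerivAt ((extChartAt (𝓡 n) p ∘ (extChartAt (𝓡 n) q).symm) ∘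
        (extChartAt (𝓡 n) q ∘ (extChartAt (𝓡 n) p).symm)) _ y :=
      HasFDerivAt.comp y (by
        rw [hκ0]
        exact (hlam.differentiableAt (by simp)).hasFDerivAt)
        (hκ.differentiableAt (by simp)).hasFDerivAt
    have h3 := h2.unique ((hasFDerivAt_id y).congr_of_eventuallyEq h1)
    rw [injective_iff_map_eq_zero]
    intro u hu
    have h4 := congrArg (fun T : Euc n →L[ℝ] Euc n => T u) h3
    simp only [ContinuousLinearMap.comp_apply, hu, map_zero, ContinuousLinearMap.coe_id', id] at h4
    exact h4.symm
  · intro d f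
    filter_upwards [hmem] with y' hy'
    simp only [chartRep, Function.comp_apply]
    rw [(extChartAt (𝓡 n) q).left_inv hy'.2]

/-- The first and second derivatives in an arbitrary preferred chart determine the differential
and the second fundamental form. -/
theorem exists_tangent_equiv {d : ℕ} {f : M → Euc d} (hf : ContMDiff (𝓡 n) 𝓘(ℝ, Euc d) ∞ f)
    (p : M) {y : Euc n} (hy : y ∈ (extChartAt (𝓡 n) p).target) {q : M}
    (hq : (extChartAt (𝓡 n) p).symm y = q) :
    ∃ τ : Euc n ≃ₗ[ℝ] TangentSpace (𝓡 n) q,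
      (∀ u, fderiv ℝ (chartRep f p) y u = diffAt f q (τ u)) ∧
      ∀ ζ ∈ normalSpaceAt (n := n) f q, ∀ u v,
        ⟪fderiv ℝ (fderiv ℝ (chartRep f p)) y u v, ζ⟫_ℝ = ⟪secondFF f q (τ u) (τ v), ζ⟫_ℝ := by
  obtain ⟨κ, hκ, hκy, hinj, heq⟩ := exists_chart_change p hy hq
  have heqf := heq f
  set Gq := chartRep (n := n) f q with hGq
  have hGqs : ContDiffAt ℝ ∞ Gq (κ y) := by
    rw [hκy]
    exact (contDiffOn_chartRep hf q).contDiffAt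
      ((isOpen_extChartAt_target q).mem_nhds (mem_extChartAt_target q))
  let τ : Euc n ≃ₗ[ℝ] Euc n := LinearEquiv.ofInjectiveEndo (fderiv ℝ κ y).toLinearMap hinj
  have hτ : ∀ u, τ u = fderiv ℝ κ y u := fun u => rfl
  have hev : ∀ᶠ z in 𝓝 y, fderiv ℝ (chartRep (n := n) f p) z =
      (fderiv ℝ Gq (κ z)).comp (fderiv ℝ κ z) := by
    have e1 : ∀ᶠ z in 𝓝 y, DifferentiableAt ℝ κ z :=
      ((hκ.of_le (m := 1) (by simp)).eventually (by simp)).mono fun z hz =>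
        hz.differentiableAt (by simp)
    have e2 : ∀ᶠ z in 𝓝 y, DifferentiableAt ℝ Gq (κ z) :=
      hκ.continuousAt.eventually (((hGqs.of_le (m := 1) (by simp)).eventually (by simp)).mono
        fun z hz => hz.differentiableAt (by simp))
    filter_upwards [heqf.eventuallyEq_nhds, e1, e2] with z h1 h2 h3
    rw [h1.fderiv_eq, fderiv_comp z h3 h2]
  refine ⟨τ, ?_, ?_⟩
  · intro u
    rw [hev.self_of_nhds, hκy, ContinuousLinearMap.comp_apply, ← hτ]
    exact (diffAt_eq_fderiv_chartRep hf q (τ u)).symm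
  · intro ζ hζ u v
    rw [inner_secondFF f q _ _ hζ]
    have d1 : DifferentiableAt ℝ (fderiv ℝ Gq) (κ y) :=
      (hGqs.fderiv_right (m := ∞) (by simp)).differentiableAt (by simp)
    have d2 : DifferentiableAt ℝ (fderiv ℝ κ) y :=
      (hκ.fderiv_right (m := ∞) (by simp)).differentiableAt (by simp)
    have d3 : DifferentiableAt ℝ κ y := hκ.differentiableAt (by simp)
    have h1 : HasFDerivAt (fun z => (fderiv ℝ Gq (κ z)).comp (fderiv ℝ κ z)) _ y :=
      (HasFDerivAt.comp y d1.hasFDerivAt d3.hasFDerivAt).clm_comp d2.hasFDerivAt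
    -- The chain rule produces an extra term containing the second derivative of the transition map;
    -- it is tangential and disappears against normal vectors.
    have h2 : fderiv ℝ (fderiv ℝ (chartRep (n := n) f p)) y u v =
        fderiv ℝ Gq (κ y) (fderiv ℝ (fderiv ℝ κ) y u v) +
          fderiv ℝ (fderiv ℝ Gq) (κ y) (τ u) (τ v) := by
      rw [Filter.EventuallyEq.fderiv_eq hev, h1.fderiv]
      rfl
    have h3 : ⟪fderiv ℝ Gq (κ y) (fderiv ℝ (fderiv ℝ κ) y u v), ζ⟫_ℝ = 0 := by
      rw [hκy]
      refine (Submodule.mem_orthogonal _ _).1 hζ _ ⟨fderiv ℝ (fderiv ℝ κ) y u v, ?_⟩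
      exact diffAt_eq_fderiv_chartRep hf q _
    rw [h2, inner_add_left, h3, zero_add, hκy]
    rfl

end ChartRepresentation

/-! ### The Gauss equation in local coordinates -/

section GaussEquation

open Topology Filter

variable {n d : ℕ}

theorem sum_smul_stdVec (u : Euc n) : ∑ i, u i • (stdVec i : Euc n) = u := by
  have := (EuclideanSpace.basisFun (Fin n) ℝ).sum_repr u
  simpa [stdVec] using this

/-- The Christoffel symbols of a matrix of metric coefficients. -/
def christoffelOf (γ : Euc n → Matrix (Fin n) (Fin n) ℝ) (l i j : Fin n) (y : Euc n) : ℝ :=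
  (1 / 2 : ℝ) * ∑ m, (γ y)⁻¹ l m *
    (partialD i (fun z => γ z j m) y + partialD j (fun z => γ z i m) y
      - partialD m (fun z => γ z i j) y)

theorem contDiffAt_matrix_det {ι X : Type*} [Fintype ι] [DecidableEq ι] [NormedAddCommGroup X]
    [NormedSpace ℝ X] {γ : X → Matrix ι ι ℝ} {y : X}
    (h : ∀ i j, ContDiffAt ℝ ∞ (fun z => γ z i j) y) :
    ContDiffAt ℝ ∞ (fun z => (γ z).det) y := by
  simp only [Matrix.det_apply]
  exact ContDiffAt.sum fun σ _ => ContDiffAt.const_smul _ (contDiffAt_prod fun i _ => h _ _)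

/-- Cramer's rule writes each entry of the inverse as a quotient of determinants. -/
theorem contDiffAt_matrix_inv {ι X : Type*} [Fintype ι] [DecidableEq ι] [NormedAddCommGroup X]
    [NormedSpace ℝ X] {γ : X → Matrix ι ι ℝ} {y : X}
    (h : ∀ i j, ContDiffAt ℝ ∞ (fun z => γ z i j) y) (h0 : (γ y).det ≠ 0) (k l : ι) :
    ContDiffAt ℝ ∞ (fun z => (γ z)⁻¹ k l) y := by
  have h1 : (fun z => (γ z)⁻¹ k l) = fun z => (γ z).det⁻¹ *
      ((γ z).updateRow l (Pi.single k 1)).det := by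
    funext z
    rw [Matrix.inv_def, Matrix.smul_apply, Ring.inverse_eq_inv', Matrix.adjugate_apply, smul_eq_mul]
  rw [h1]
  refine ((contDiffAt_matrix_det h).inv h0).mul (contDiffAt_matrix_det fun i j => ?_)
  by_cases hi : i = l
  · subst hi
    simp only [Matrix.updateRow_self]
    exact contDiffAt_const
  · simp only [Matrix.updateRow_ne hi]
    exact h i j

/-- The metric coefficients of an immersion `F` of an open subset of `ℝⁿ`. -/
structure IsMetricOf (F : Euc n → Euc d) (γ : Euc n → Matrix (Fin n) (Fin n) ℝ) (Ω : Set (Euc n)) :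
    Prop where
  isOpen : IsOpen Ω
  smooth : ContDiffOn ℝ ∞ F Ω
  immersion : ∀ y ∈ Ω, Function.Injective (fderiv ℝ F y)
  coeff : ∀ y ∈ Ω, ∀ i j, γ y i j = ⟪fderiv ℝ F y (stdVec i), fderiv ℝ F y (stdVec j)⟫_ℝ

namespace IsMetricOf

variable {F : Euc n → Euc d} {γ : Euc n → Matrix (Fin n) (Fin n) ℝ} {Ω : Set (Euc n)}

theorem contDiffAt_fderiv (h : IsMetricOf F γ Ω) {y : Euc n} (hy : y ∈ Ω) :
    ContDiffAt ℝ ∞ (fderiv ℝ F) y :=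
  (h.smooth.fderiv_infty h.isOpen).contDiffAt (h.isOpen.mem_nhds hy)

theorem contDiffAt_fderiv_fderiv (h : IsMetricOf F γ Ω) {y : Euc n} (hy : y ∈ Ω) :
    ContDiffAt ℝ ∞ (fderiv ℝ (fderiv ℝ F)) y :=
  ((h.smooth.fderiv_infty h.isOpen).fderiv_infty h.isOpen).contDiffAt (h.isOpen.mem_nhds hy)

theorem symm (h : IsMetricOf F γ Ω) {y : Euc n} (hy : y ∈ Ω) (u v : Euc n) :
    fderiv ℝ (fderiv ℝ F) y u v = fderiv ℝ (fderiv ℝ F) y v u :=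
  fderiv_fderiv_symm (h.smooth.contDiffAt (h.isOpen.mem_nhds hy)) u v

theorem eventuallyEq (h : IsMetricOf F γ Ω) {y : Euc n} (hy : y ∈ Ω) (i j : Fin n) :
    (fun z => γ z i j) =ᶠ[𝓝 y]
      fun z => ⟪fderiv ℝ F z (stdVec i), fderiv ℝ F z (stdVec j)⟫_ℝ :=
  (h.isOpen.eventually_mem hy).mono fun z hz => h.coeff z hz i j

theorem contDiffAt_coeff (h : IsMetricOf F γ Ω) {y : Euc n} (hy : y ∈ Ω) (i j : Fin n) :
    ContDiffAt ℝ ∞ (fun z => γ z i j) y :=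
  (((h.contDiffAt_fderiv hy).clm_apply contDiffAt_const).inner ℝ
    ((h.contDiffAt_fderiv hy).clm_apply contDiffAt_const)).congr_of_eventuallyEq
      (h.eventuallyEq hy i j)

theorem partialD_coeff (h : IsMetricOf F γ Ω) {y : Euc n} (hy : y ∈ Ω) (l i j : Fin n) :
    partialD l (fun z => γ z i j) y =
      ⟪fderiv ℝ (fderiv ℝ F) y (stdVec l) (stdVec i), fderiv ℝ F y (stdVec j)⟫_ℝ +
      ⟪fderiv ℝ F y (stdVec i), fderiv ℝ (fderiv ℝ F) y (stdVec l) (stdVec j)⟫_ℝ := by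
  have hd : DifferentiableAt ℝ (fderiv ℝ F) y := (h.contDiffAt_fderiv hy).differentiableAt (by simp)
  unfold partialD
  rw [(h.eventuallyEq hy i j).fderiv_eq, fderiv_inner_apply ℝ
    (hd.clm_apply (differentiableAt_const _)) (hd.clm_apply (differentiableAt_const _)),
    fderiv_clm_apply hd (differentiableAt_const _), fderiv_clm_apply hd (differentiableAt_const _)]
  simp
  ring

/-- A null vector of the Gram matrix yields `w` whose image is orthogonal to the image of every
basis vector, hence to itself. -/
theorem det_ne_zero (h : IsMetricOf F γ Ω) {y : Euc n} (hy : y ∈ Ω) : (γ y).det ≠ 0 := by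
  rw [Ne, ← Matrix.exists_vecMul_eq_zero_iff]
  rintro ⟨c, hc0, hc⟩
  set w : Euc n := ∑ i, c i • stdVec i with hw
  have h1 : ∀ j, ⟪fderiv ℝ F y w, fderiv ℝ F y (stdVec j)⟫_ℝ = 0 := by
    intro j
    have := congrFun hc j
    simp only [Matrix.vecMul, dotProduct, Pi.zero_apply, h.coeff y hy] at this
    rw [hw, map_sum, sum_inner, ← this]
    simp [real_inner_smul_left]
  have h2 : ⟪fderiv ℝ F y w, fderiv ℝ F y w⟫_ℝ = 0 := by
    have e : fderiv ℝ F y w = ∑ j, c j • fderiv ℝ F y (stdVec j) := by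
      rw [hw, map_sum]
      simp only [map_smul]
    refine (congrArg (inner ℝ (fderiv ℝ F y w)) e).trans ?_
    rw [inner_sum]
    exact Finset.sum_eq_zero fun j _ => by rw [real_inner_smul_right, h1, mul_zero]
  have h3 : w = 0 := h.immersion y hy ((inner_self_eq_zero.1 h2).trans (map_zero _).symm)
  refine hc0 (funext fun i => ?_)
  have h4 : w i = c i := by
    rw [hw]
    simp [stdVec, Pi.single_apply]
  rw [← h4, h3]
  rfl

/-- In the alternating sum of derivatives of the metric all terms cancel by symmetry of second
derivatives, except two equal ones that absorb the factor `1 / 2`. -/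
theorem christoffel_eq (h : IsMetricOf F γ Ω) {y : Euc n} (hy : y ∈ Ω) (l i j : Fin n) :
    christoffelOf γ l i j y = ∑ m, (γ y)⁻¹ l m *
      ⟪fderiv ℝ (fderiv ℝ F) y (stdVec i) (stdVec j), fderiv ℝ F y (stdVec m)⟫_ℝ := by
  unfold christoffelOf
  rw [Finset.mul_sum]
  refine Finset.sum_congr rfl fun m _ => ?_
  rw [h.partialD_coeff hy, h.partialD_coeff hy, h.partialD_coeff hy,
    h.symm hy (stdVec j) (stdVec i), h.symm hy (stdVec m) (stdVec i),
    h.symm hy (stdVec m) (stdVec j), real_inner_comm (fderiv ℝ F y (stdVec j))]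
  ring

/-- The Christoffel symbols are the coefficients of the tangential part of the second
derivative. -/
theorem sum_christoffel_mul (h : IsMetricOf F γ Ω) {y : Euc n} (hy : y ∈ Ω) (i j m : Fin n) :
    ∑ l, christoffelOf γ l i j y * γ y l m =
      ⟪fderiv ℝ (fderiv ℝ F) y (stdVec i) (stdVec j), fderiv ℝ F y (stdVec m)⟫_ℝ := by
  have hinv : γ y * (γ y)⁻¹ = 1 := Matrix.mul_nonsing_inv _ (isUnit_iff_ne_zero.2 (h.det_ne_zero hy))
  have hγ : ∀ a b, γ y a b = γ y b a := fun a b => by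
    rw [h.coeff y hy, h.coeff y hy, real_inner_comm]
  simp only [h.christoffel_eq hy, Finset.sum_mul]
  rw [Finset.sum_comm]
  have : ∀ m', ∑ l, (γ y)⁻¹ l m' * ⟪fderiv ℝ (fderiv ℝ F) y (stdVec i) (stdVec j),
      fderiv ℝ F y (stdVec m')⟫_ℝ * γ y l m = (1 : Matrix (Fin n) (Fin n) ℝ) m m' *
      ⟪fderiv ℝ (fderiv ℝ F) y (stdVec i) (stdVec j), fderiv ℝ F y (stdVec m')⟫_ℝ := by
    intro m'
    rw [← hinv, Matrix.mul_apply, Finset.sum_mul]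
    refine Finset.sum_congr rfl fun l _ => ?_
    rw [hγ l m]
    ring
  simp [this, Matrix.one_apply]

theorem differentiableAt_christoffel (h : IsMetricOf F γ Ω) {y : Euc n} (hy : y ∈ Ω)
    (l i j : Fin n) : DifferentiableAt ℝ (christoffelOf γ l i j) y := by
  have heq : christoffelOf γ l i j =ᶠ[𝓝 y] fun z => ∑ m, (γ z)⁻¹ l m *
      ⟪fderiv ℝ (fderiv ℝ F) z (stdVec i) (stdVec j), fderiv ℝ F z (stdVec m)⟫_ℝ :=
    (h.isOpen.eventually_mem hy).mono fun z hz => h.christoffel_eq hz l i j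
  have hc : ContDiffAt ℝ ∞ (fun z => ∑ m, (γ z)⁻¹ l m *
      ⟪fderiv ℝ (fderiv ℝ F) z (stdVec i) (stdVec j), fderiv ℝ F z (stdVec m)⟫_ℝ) y :=
    ContDiffAt.sum fun m _ =>
      (contDiffAt_matrix_inv (h.contDiffAt_coeff hy) (h.det_ne_zero hy) l m).mul
        ((((h.contDiffAt_fderiv_fderiv hy).clm_apply contDiffAt_const).clm_apply
          contDiffAt_const).inner ℝ ((h.contDiffAt_fderiv hy).clm_apply contDiffAt_const))
  exact (hc.congr_of_eventuallyEq heq).differentiableAt (by simp)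

/-- The derivative of the identity `sum_christoffel_mul`. -/
theorem sum_partialD_christoffel (h : IsMetricOf F γ Ω) {y : Euc n} (hy : y ∈ Ω)
    (i j k m : Fin n) :
    ∑ l, partialD i (christoffelOf γ l j k) y * γ y l m +
      ∑ l, christoffelOf γ l j k y * partialD i (fun z => γ z l m) y =
    ⟪fderiv ℝ (fderiv ℝ (fderiv ℝ F)) y (stdVec i) (stdVec j) (stdVec k),
        fderiv ℝ F y (stdVec m)⟫_ℝ +
      ⟪fderiv ℝ (fderiv ℝ F) y (stdVec j) (stdVec k),
        fderiv ℝ (fderiv ℝ F) y (stdVec i) (stdVec m)⟫_ℝ := by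
  have heq : (fun z => ∑ l, christoffelOf γ l j k z * γ z l m) =ᶠ[𝓝 y] fun z =>
      ⟪fderiv ℝ (fderiv ℝ F) z (stdVec j) (stdVec k), fderiv ℝ F z (stdVec m)⟫_ℝ :=
    (h.isOpen.eventually_mem hy).mono fun z hz => h.sum_christoffel_mul hz j k m
  have h1 := congrArg (fun T : Euc n →L[ℝ] ℝ => T (stdVec i)) heq.fderiv_eq
  have hd1 : DifferentiableAt ℝ (fderiv ℝ F) y := (h.contDiffAt_fderiv hy).differentiableAt (by simp)
  have hd2 : DifferentiableAt ℝ (fderiv ℝ (fderiv ℝ F)) y :=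
    (h.contDiffAt_fderiv_fderiv hy).differentiableAt (by simp)
  have hdγ : ∀ l, DifferentiableAt ℝ (fun z => γ z l m) y := fun l =>
    (h.contDiffAt_coeff hy l m).differentiableAt (by simp)
  rw [fderiv_fun_sum fun l _ => (h.differentiableAt_christoffel hy l j k).fun_mul (hdγ l),
    fderiv_inner_apply ℝ ((hd2.clm_apply (differentiableAt_const _)).clm_apply
      (differentiableAt_const _)) (hd1.clm_apply (differentiableAt_const _)),
    fderiv_clm_apply (hd2.clm_apply (differentiableAt_const _)) (differentiableAt_const _),
    fderiv_clm_apply hd2 (differentiableAt_const _),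
    fderiv_clm_apply hd1 (differentiableAt_const _)] at h1
  simp only [fun l => fderiv_fun_mul (h.differentiableAt_christoffel hy l j k) (hdγ l)] at h1
  simp [Finset.sum_add_distrib] at h1
  unfold partialD
  rw [add_comm] at h1
  rw [add_comm (inner ℝ _ _)] at h1
  rw [← h1]
  congr 1
  exact Finset.sum_congr rfl fun l _ => mul_comm _ _

/-- The Gauss equation in coordinates. -/
theorem gauss_coord (h : IsMetricOf F γ Ω) {y : Euc n} (hy : y ∈ Ω) (i j k m : Fin n) :
    ∑ l, (partialD i (christoffelOf γ l j k) y - partialD j (christoffelOf γ l i k) y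
      + ∑ p, (christoffelOf γ l i p y * christoffelOf γ p j k y
        - christoffelOf γ l j p y * christoffelOf γ p i k y)) * γ y l m =
    ⟪(fderiv ℝ F y).rangeᗮ.starProjection (fderiv ℝ (fderiv ℝ F) y (stdVec j) (stdVec k)),
        fderiv ℝ (fderiv ℝ F) y (stdVec i) (stdVec m)⟫_ℝ -
      ⟪(fderiv ℝ F y).rangeᗮ.starProjection (fderiv ℝ (fderiv ℝ F) y (stdVec i) (stdVec k)),
        fderiv ℝ (fderiv ℝ F) y (stdVec j) (stdVec m)⟫_ℝ := by
  set N := (fderiv ℝ F y).rangeᗮ with hN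
  -- The Christoffel symbols are the coefficients of the tangential part, so subtracting it leaves
  -- the normal part.
  have halpha : ∀ a b, N.starProjection (fderiv ℝ (fderiv ℝ F) y (stdVec a) (stdVec b)) =
      fderiv ℝ (fderiv ℝ F) y (stdVec a) (stdVec b) -
        ∑ l, christoffelOf γ l a b y • fderiv ℝ F y (stdVec l) := by
    intro a b
    have ht : ∑ l, christoffelOf γ l a b y • fderiv ℝ F y (stdVec l) ∈ (fderiv ℝ F y).range :=
      Submodule.sum_mem _ fun l _ => Submodule.smul_mem _ _ ⟨stdVec l, rfl⟩
    have hn : fderiv ℝ (fderiv ℝ F) y (stdVec a) (stdVec b) -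
        ∑ l, christoffelOf γ l a b y • fderiv ℝ F y (stdVec l) ∈ N := by
      rw [hN, Submodule.mem_orthogonal']
      rintro _ ⟨u, rfl⟩
      change ⟪_, fderiv ℝ F y u⟫_ℝ = 0
      rw [← sum_smul_stdVec u, map_sum, inner_sum]
      refine Finset.sum_eq_zero fun m _ => ?_
      rw [map_smul, real_inner_smul_right, inner_sub_left, sum_inner,
        ← h.sum_christoffel_mul hy a b m]
      simp [real_inner_smul_left, h.coeff y hy]
    have h0 : N.starProjection (∑ l, christoffelOf γ l a b y • fderiv ℝ F y (stdVec l)) = 0 := by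
      rw [Submodule.starProjection_apply_eq_zero_iff]
      exact Submodule.le_orthogonal_orthogonal _ ht
    have h1 := Submodule.starProjection_eq_self_iff.2 hn
    rw [map_sub, h0, sub_zero] at h1
    exact h1
  -- Half of the curvature expression: a third derivative of `F` plus a normal term. The
  -- antisymmetrization in `i, j` below cancels the third derivatives.
  have hkey : ∀ i j k, ∑ l, partialD i (christoffelOf γ l j k) y * γ y l m +
      ∑ l, (∑ p, christoffelOf γ l i p y * christoffelOf γ p j k y) * γ y l m =
      ⟪fderiv ℝ (fderiv ℝ (fderiv ℝ F)) y (stdVec i) (stdVec j) (stdVec k),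
        fderiv ℝ F y (stdVec m)⟫_ℝ +
      ⟪N.starProjection (fderiv ℝ (fderiv ℝ F) y (stdVec j) (stdVec k)),
        fderiv ℝ (fderiv ℝ F) y (stdVec i) (stdVec m)⟫_ℝ := by
    intro i j k
    have h1 := h.sum_partialD_christoffel hy i j k m
    have h2 : ∑ l, (∑ p, christoffelOf γ l i p y * christoffelOf γ p j k y) * γ y l m =
        ∑ p, christoffelOf γ p j k y *
          ⟪fderiv ℝ (fderiv ℝ F) y (stdVec i) (stdVec p), fderiv ℝ F y (stdVec m)⟫_ℝ := by
      simp only [← h.sum_christoffel_mul hy, Finset.sum_mul, Finset.mul_sum]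
      rw [Finset.sum_comm]
      exact Finset.sum_congr rfl fun p _ => Finset.sum_congr rfl fun l _ => by ring
    have h3 : ∑ l, christoffelOf γ l j k y * partialD i (fun z => γ z l m) y =
        ∑ p, christoffelOf γ p j k y *
          ⟪fderiv ℝ (fderiv ℝ F) y (stdVec i) (stdVec p), fderiv ℝ F y (stdVec m)⟫_ℝ +
        ∑ p, christoffelOf γ p j k y *
          ⟪fderiv ℝ F y (stdVec p), fderiv ℝ (fderiv ℝ F) y (stdVec i) (stdVec m)⟫_ℝ := by
      rw [← Finset.sum_add_distrib]
      refine Finset.sum_congr rfl fun l _ => ?_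
      rw [h.partialD_coeff hy, mul_add]
    have h4 : ⟪N.starProjection (fderiv ℝ (fderiv ℝ F) y (stdVec j) (stdVec k)),
        fderiv ℝ (fderiv ℝ F) y (stdVec i) (stdVec m)⟫_ℝ =
        ⟪fderiv ℝ (fderiv ℝ F) y (stdVec j) (stdVec k),
          fderiv ℝ (fderiv ℝ F) y (stdVec i) (stdVec m)⟫_ℝ -
        ∑ p, christoffelOf γ p j k y *
          ⟪fderiv ℝ F y (stdVec p), fderiv ℝ (fderiv ℝ F) y (stdVec i) (stdVec m)⟫_ℝ := by
      rw [halpha, inner_sub_left, sum_inner]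
      simp [real_inner_smul_left]
    rw [h2, h4]
    rw [h3] at h1
    linarith
  have h3 : fderiv ℝ (fderiv ℝ (fderiv ℝ F)) y (stdVec i) (stdVec j) =
      fderiv ℝ (fderiv ℝ (fderiv ℝ F)) y (stdVec j) (stdVec i) :=
    fderiv_fderiv_symm (h.contDiffAt_fderiv hy) _ _
  have e1 := hkey i j k
  have e2 := hkey j i k
  rw [h3] at e1
  have e3 : ∑ l, (partialD i (christoffelOf γ l j k) y - partialD j (christoffelOf γ l i k) y
      + ∑ p, (christoffelOf γ l i p y * christoffelOf γ p j k y
        - christoffelOf γ l j p y * christoffelOf γ p i k y)) * γ y l m =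
      (∑ l, partialD i (christoffelOf γ l j k) y * γ y l m +
        ∑ l, (∑ p, christoffelOf γ l i p y * christoffelOf γ p j k y) * γ y l m) -
      (∑ l, partialD j (christoffelOf γ l i k) y * γ y l m +
        ∑ l, (∑ p, christoffelOf γ l j p y * christoffelOf γ p i k y) * γ y l m) := by
    rw [← Finset.sum_add_distrib, ← Finset.sum_add_distrib, ← Finset.sum_sub_distrib]
    refine Finset.sum_congr rfl fun l _ => ?_
    rw [Finset.sum_sub_distrib]
    ring
  rw [e3, e1, e2]
  ring

end IsMetricOf

end GaussEquation

/-! ### The Gauss equation and nonnegative curvature on the manifold -/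

section ManifoldGauss

open Topology Filter

variable {n : ℕ}

theorem map_eq_sum_stdVec {X : Type*} [AddCommMonoid X] [Module ℝ X] (T : Euc n →ₗ[ℝ] X)
    (u : Euc n) : T u = ∑ i, u i • T (stdVec i) := by
  conv_lhs => rw [← sum_smul_stdVec u, map_sum]
  simp only [map_smul]

/-- Only linearity in the last argument is built into the type of `B`; in the other two it is
supplied by linear maps agreeing with `B`, so that any composite expression can be used. -/
theorem trilinear_expansion {X : Type*} [AddCommMonoid X] [Module ℝ X]
    (B : Euc n → Euc n → Euc n →ₗ[ℝ] X) (h1 : ∀ b c, ∃ T : Euc n →ₗ[ℝ] X, ∀ a, T a = B a b c)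
    (h2 : ∀ a c, ∃ T : Euc n →ₗ[ℝ] X, ∀ b, T b = B a b c) (a b c : Euc n) :
    B a b c = ∑ i, ∑ j, ∑ k, (a i * b j * c k) • B (stdVec i) (stdVec j) (stdVec k) := by
  obtain ⟨T1, hT1⟩ := h1 b c
  rw [← hT1, map_eq_sum_stdVec T1]
  refine Finset.sum_congr rfl fun i _ => ?_
  obtain ⟨T2, hT2⟩ := h2 (stdVec i) c
  rw [hT1, ← hT2, map_eq_sum_stdVec T2, Finset.smul_sum]
  refine Finset.sum_congr rfl fun j _ => ?_
  rw [hT2, map_eq_sum_stdVec (B (stdVec i) (stdVec j)), Finset.smul_sum, Finset.smul_sum]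
  refine Finset.sum_congr rfl fun k _ => ?_
  rw [smul_smul, smul_smul]

theorem inner_map_eq_sum_stdVec {d : ℕ} (T : Euc n →L[ℝ] Euc d) (x : Euc d) (w : Euc n) :
    ⟪x, T w⟫_ℝ = ∑ m, w m * ⟪x, T (stdVec m)⟫_ℝ := by
  refine (congrArg (inner ℝ x) (map_eq_sum_stdVec T.toLinearMap w)).trans ?_
  rw [inner_sum]
  exact Finset.sum_congr rfl fun m _ => real_inner_smul_right _ _ _

/-- A curvature-like tensor is determined by its components. -/
theorem inner_curvature_expansion {d : ℕ} (L : Euc n →L[ℝ] Euc d)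
    (Q : Euc n →L[ℝ] Euc n →L[ℝ] Euc d) (P : Euc d →L[ℝ] Euc d)
    (R : Fin n → Fin n → Fin n → Fin n → ℝ)
    (hR : ∀ i j k m, ∑ l, R l i j k * ⟪L (stdVec l), L (stdVec m)⟫_ℝ =
      ⟪P (Q (stdVec j) (stdVec k)), Q (stdVec i) (stdVec m)⟫_ℝ -
        ⟪P (Q (stdVec i) (stdVec k)), Q (stdVec j) (stdVec m)⟫_ℝ)
    (a b c w : Euc n) :
    ⟪L (WithLp.toLp 2 fun l => ∑ i, ∑ j, ∑ k, R l i j k * a i * b j * c k), L w⟫_ℝ =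
      ⟪P (Q b c), Q a w⟫_ℝ - ⟪P (Q a c), Q b w⟫_ℝ := by
  have exp : ∀ a b c w : Euc n, ⟪P (Q a b), Q c w⟫_ℝ = ∑ i, ∑ j, ∑ k, (a i * b j * c k) *
      ⟪P (Q (stdVec i) (stdVec j)), Q (stdVec k) w⟫_ℝ := by
    intro a b c w
    exact trilinear_expansion
      (fun a b => ((innerSL ℝ (P (Q a b))).comp (Q.flip w)).toLinearMap)
      (fun b c => ⟨((innerSL ℝ (Q c w)).comp (P.comp (Q.flip b))).toLinearMap,
        fun a => real_inner_comm (P (Q a b)) (Q c w)⟩)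
      (fun a c => ⟨((innerSL ℝ (Q c w)).comp (P.comp (Q a))).toLinearMap,
        fun b => real_inner_comm (P (Q a b)) (Q c w)⟩) a b c
  rw [inner_map_eq_sum_stdVec L, inner_map_eq_sum_stdVec (Q a), inner_map_eq_sum_stdVec (Q b),
    ← Finset.sum_sub_distrib]
  refine Finset.sum_congr rfl fun m _ => ?_
  rw [← mul_sub]
  congr 1
  have e1 : ⟪L (WithLp.toLp 2 fun l => ∑ i, ∑ j, ∑ k, R l i j k * a i * b j * c k),
      L (stdVec m)⟫_ℝ = ∑ i, ∑ j, ∑ k, (a i * b j * c k) *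
        ∑ l, R l i j k * ⟪L (stdVec l), L (stdVec m)⟫_ℝ := by
    rw [real_inner_comm, inner_map_eq_sum_stdVec L]
    simp only [Finset.sum_mul, Finset.mul_sum]
    rw [Finset.sum_comm]
    refine Finset.sum_congr rfl fun i _ => ?_
    rw [Finset.sum_comm]
    refine Finset.sum_congr rfl fun j _ => ?_
    rw [Finset.sum_comm]
    refine Finset.sum_congr rfl fun k _ => Finset.sum_congr rfl fun l _ => ?_
    rw [real_inner_comm]
    ring
  rw [e1, exp b c a, exp a c b]
  simp only [hR, mul_sub, Finset.sum_sub_distrib]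
  congr 1
  · rw [Finset.sum_comm]
    refine Finset.sum_congr rfl fun j _ => ?_
    rw [Finset.sum_comm]
    exact Finset.sum_congr rfl fun k _ => Finset.sum_congr rfl fun i _ => by ring
  · refine Finset.sum_congr rfl fun i _ => ?_
    rw [Finset.sum_comm]
    exact Finset.sum_congr rfl fun k _ => Finset.sum_congr rfl fun j _ => by ring

variable {M : Type*} [TopologicalSpace M] [ChartedSpace (Euc n) M] [IsManifold (𝓡 n) ∞ M]

theorem IsIsometricImmersion.injective_diffAt {g : SmoothMetric n M} {d : ℕ} {f : M → Euc d}
    (hf : IsIsometricImmersion g f) (q : M) : Function.Injective (diffAt (n := n) f q) := by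
  rw [injective_iff_map_eq_zero]
  intro u hu
  by_contra h0
  have h1 := g.pos q u h0
  rw [← hf.isometric q u u, hu, inner_zero_left] at h1
  exact lt_irrefl _ h1

/-- The chain rule; it identifies `metricCoeff` with the Gram matrix of the partial derivatives of
`chartRep`. -/
theorem diffAt_mfderiv_symm {d : ℕ} {f : M → Euc d} (hf : ContMDiff (𝓡 n) 𝓘(ℝ, Euc d) ∞ f)
    (p : M) {y : Euc n} (hy : y ∈ (extChartAt (𝓡 n) p).target) (v : Euc n) :
    diffAt f ((extChartAt (𝓡 n) p).symm y)
      (mfderiv 𝓘(ℝ, Euc n) (𝓡 n) (extChartAt (𝓡 n) p).symm y v) =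
      fderiv ℝ (chartRep f p) y v := by
  have h := mfderiv_comp y ((hf.contMDiffAt (x := (extChartAt (𝓡 n) p).symm y)).mdifferentiableAt
    (by simp)) ((contMDiffAt_extChartAt_symm' hy).mdifferentiableAt (by simp))
  rw [mfderiv_eq_fderiv] at h
  exact (congrArg (fun T : Euc n →L[ℝ] Euc d => T v) h).symm

theorem injective_fderiv_chartRep {g : SmoothMetric n M} {d : ℕ} {f : M → Euc d}
    (hf : IsIsometricImmersion g f) (p : M) {y : Euc n}
    (hy : y ∈ (extChartAt (𝓡 n) p).target) :
    Function.Injective (fderiv ℝ (chartRep f p) y) := by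
  obtain ⟨τ, hτ, -⟩ := exists_tangent_equiv hf.smooth p hy rfl
  intro u v huv
  rw [hτ, hτ] at huv
  exact τ.injective (hf.injective_diffAt _ huv)

theorem isMetricOf_chartRep {g : SmoothMetric n M} {d : ℕ} {f : M → Euc d}
    (hf : IsIsometricImmersion g f) (p : M) :
    IsMetricOf (chartRep f p) (metricCoeff g p) (extChartAt (𝓡 n) p).target where
  isOpen := isOpen_extChartAt_target p
  smooth := contDiffOn_chartRep hf.smooth p
  immersion y hy := injective_fderiv_chartRep hf p hy
  coeff y hy i j := by
    rw [← diffAt_mfderiv_symm hf.smooth p hy, ← diffAt_mfderiv_symm hf.smooth p hy, hf.isometric]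
    rfl

theorem starProjection_congr {X : Type*} [NormedAddCommGroup X] [InnerProductSpace ℝ X]
    {S R : Submodule ℝ X} [S.HasOrthogonalProjection] [R.HasOrthogonalProjection] (h : S = R)
    (x : X) : S.starProjection x = R.starProjection x := by
  subst h
  rfl

theorem normalSpaceAt_eq {d : ℕ} {f : M → Euc d} (hf : ContMDiff (𝓡 n) 𝓘(ℝ, Euc d) ∞ f)
    (p : M) {y : Euc n} (hy : y ∈ (extChartAt (𝓡 n) p).target) {q : M}
    (hq : (extChartAt (𝓡 n) p).symm y = q) :
    normalSpaceAt (n := n) f q = (fderiv ℝ (chartRep f p) y).rangeᗮ := by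
  obtain ⟨τ, hτ, -⟩ := exists_tangent_equiv hf p hy hq
  unfold normalSpaceAt
  congr 1
  ext w
  constructor
  · rintro ⟨X, rfl⟩
    refine ⟨τ.symm X, ?_⟩
    change fderiv ℝ (chartRep f p) y (τ.symm X) = _
    rw [hτ, τ.apply_symm_apply]
    rfl
  · rintro ⟨u, rfl⟩
    exact ⟨τ u, (hτ u).symm⟩

/-- The Gauss equation for an isometric immersion. -/
theorem gauss_equation {g : SmoothMetric n M} {d : ℕ} {f : M → Euc d}
    (hf : IsIsometricImmersion g f) (q : M) (u v : TangentSpace (𝓡 n) q) :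
    g.inner q (riemannTensor g q u v v) u =
      ⟪secondFF f q v v, secondFF f q u u⟫_ℝ - ⟪secondFF f q u v, secondFF f q v u⟫_ℝ := by
  have hm := isMetricOf_chartRep hf q
  have hy : extChartAt (𝓡 n) q q ∈ (extChartAt (𝓡 n) q).target := mem_extChartAt_target q
  set y := extChartAt (𝓡 n) q q with hydef
  set F : Euc n → Euc d := chartRep f q with hF
  set N := (fderiv ℝ F y).rangeᗮ with hN
  have hff : ∀ X Y : Euc n, secondFF f q X Y = N.starProjection (fderiv ℝ (fderiv ℝ F) y X Y) :=
    fun X Y => starProjection_congr (normalSpaceAt_eq hf.smooth q hy (extChartAt_to_inv q)) _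
  let u' : Euc n := u
  let v' : Euc n := v
  have hproj : ∀ x z, ⟪N.starProjection x, N.starProjection z⟫_ℝ = ⟪N.starProjection x, z⟫_ℝ := by
    intro x z
    rw [← Submodule.inner_starProjection_left_eq_right,
      Submodule.starProjection_eq_self_iff.2 (Submodule.starProjection_apply_mem _ _)]
  have hg : g.inner q (riemannTensor g q u v v) u =
      ⟪fderiv ℝ F y (riemannTensor g q u v v : Euc n), fderiv ℝ F y u'⟫_ℝ := by
    rw [← hf.isometric]
    exact congrArg₂ (inner ℝ) (diffAt_eq_fderiv_chartRep hf.smooth q _)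
      (diffAt_eq_fderiv_chartRep hf.smooth q _)
  have hR : ⟪fderiv ℝ F y (riemannTensor g q u v v : Euc n), fderiv ℝ F y u'⟫_ℝ =
      ⟪N.starProjection (fderiv ℝ (fderiv ℝ F) y v' v'), fderiv ℝ (fderiv ℝ F) y u' u'⟫_ℝ -
      ⟪N.starProjection (fderiv ℝ (fderiv ℝ F) y u' v'), fderiv ℝ (fderiv ℝ F) y v' u'⟫_ℝ := by
    refine inner_curvature_expansion (fderiv ℝ F y) (fderiv ℝ (fderiv ℝ F) y) N.starProjection
      (riemannCoeff g q) (fun i j k m => ?_) u' v' v' u'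
    simp only [← hm.coeff y hy]
    exact hm.gauss_coord hy i j k m
  have hα : ∀ a b c w : Euc n, ⟪secondFF f q a b, secondFF f q c w⟫_ℝ =
      ⟪N.starProjection (fderiv ℝ (fderiv ℝ F) y a b), fderiv ℝ (fderiv ℝ F) y c w⟫_ℝ :=
    fun a b c w => (congrArg₂ (inner ℝ) (hff a b) (hff c w)).trans (hproj _ _)
  exact hg.trans (hR.trans (congrArg₂ (fun r s : ℝ => r - s) (hα v' v' u' u') (hα u' v' v' u')).symm)

theorem secondFF_symm {d : ℕ} {f : M → Euc d} (hf : ContMDiff (𝓡 n) 𝓘(ℝ, Euc d) ∞ f)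
    (q : M) (u v : TangentSpace (𝓡 n) q) : secondFF f q u v = secondFF f q v u := by
  unfold secondFF secondDeriv
  congr 1
  exact fderiv_fderiv_symm ((contDiffOn_chartRep hf q).contDiffAt
    ((isOpen_extChartAt_target q).mem_nhds (mem_extChartAt_target q))) _ _

/-- Nonnegative sectional curvature in terms of the second fundamental form. -/
theorem inner_secondFF_nonneg {g : SmoothMetric n M} (hsec : NonnegSectionalCurv g) {d : ℕ}
    {f : M → Euc d} (hf : IsIsometricImmersion g f) (q : M) (u v : TangentSpace (𝓡 n) q) :
    0 ≤ ⟪secondFF f q u u, secondFF f q v v⟫_ℝ := by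
  by_cases hlin : LinearIndependent ℝ ![u, v]
  · have h1 := hsec q u v hlin
    unfold sectionalCurv at h1
    have hu0 : u ≠ 0 := hlin.ne_zero 0
    -- A nonzero multiple of the component of `v` orthogonal to `u`; its positive length is the
    -- strict Cauchy–Schwarz inequality, so the denominator of the sectional curvature is positive.
    have hw0 : g.inner q u u • v - g.inner q u v • u ≠ 0 := by
      intro h0
      have h2 := LinearIndependent.pair_iff.1 hlin (-g.inner q u v) (g.inner q u u) (by
        rw [neg_smul, neg_add_eq_sub]
        exact h0)
      exact (g.pos q u hu0).ne' h2.2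
    have hden : 0 < g.inner q u u * g.inner q v v - g.inner q u v ^ 2 := by
      have h2 := g.pos q _ hw0
      have h3 : g.inner q (g.inner q u u • v - g.inner q u v • u)
          (g.inner q u u • v - g.inner q u v • u) =
          g.inner q u u * (g.inner q u u * g.inner q v v - g.inner q u v ^ 2) := by
        simp only [map_sub, map_smul, sub_apply, smul_apply, smul_eq_mul, g.symm q v u]
        ring
      rw [h3] at h2
      exact (pos_iff_pos_of_mul_pos h2).1 (g.pos q u hu0)
    have h2 : 0 ≤ g.inner q (riemannTensor g q u v v) u := by
      have := mul_nonneg h1 hden.le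
      rwa [div_mul_cancel₀ _ hden.ne'] at this
    rw [gauss_equation hf, secondFF_symm hf.smooth q v u, real_inner_comm] at h2
    have h3 := real_inner_self_nonneg (x := secondFF (n := n) f q u v)
    linarith
  -- For dependent vectors there is no plane and no curvature hypothesis, but then one value of `α`
  -- is a nonnegative multiple of the other.
  · have hsm : ∀ (c : ℝ) (X : TangentSpace (𝓡 n) q),
        secondFF f q (c • X) (c • X) = (c * c) • secondFF f q X X := by
      intro c X
      have h1 : ∀ (S : Euc n →L[ℝ] Euc n →L[ℝ] Euc d) (Y : Euc n),
          S (c • Y) (c • Y) = (c * c) • S Y Y := fun S Y => by simp [smul_smul]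
      unfold secondFF
      rw [← map_smul]
      exact congrArg _ (h1 _ X)
    rw [LinearIndependent.pair_iff] at hlin
    push Not at hlin
    obtain ⟨s, t, hst, hne⟩ := hlin
    by_cases hs : s = 0
    · have ht := hne hs
      rw [hs, zero_smul, zero_add] at hst
      have hv : v = (0 : ℝ) • v := by
        rw [zero_smul]
        exact (smul_eq_zero.1 hst).resolve_left ht
      rw [hv, hsm]
      simp
    · have hu : u = (-(t / s)) • v := by
        have : s • u = -(t • v) := eq_neg_of_add_eq_zero_left hst
        rw [neg_smul, div_eq_inv_mul, mul_smul, ← smul_neg, ← this, smul_smul, inv_mul_cancel₀ hs,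
          one_smul]
      rw [hu, hsm, real_inner_smul_left]
      exact mul_nonneg (mul_self_nonneg _) real_inner_self_nonneg

end ManifoldGauss

/-! ### Frames of type `k` in terms of jets in a chart -/

section FramesInCharts

open Topology Filter

variable {n : ℕ} {M : Type*} [TopologicalSpace M] [ChartedSpace (Euc n) M]
  [IsManifold (𝓡 n) ∞ M]

/-- Positivity of `g` removes the metric from the description of the kernel, which can then be
compared with the null space of the second derivative in a chart. -/
theorem mem_ker_shapeOp {g : SmoothMetric n M} {d : ℕ} {f : M → Euc d} {q : M} {ζ : Euc d}
    {X : TangentSpace (𝓡 n) q} :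
    X ∈ LinearMap.ker (shapeOp g f q ζ) ↔
      ∀ Y : TangentSpace (𝓡 n) q, ⟪secondFF f q X Y, ζ⟫_ℝ = 0 := by
  rw [LinearMap.mem_ker]
  constructor
  · intro h Y
    rw [← metric_shapeOp g, h]
    simp
  · intro h
    by_contra h0
    have h1 := g.pos q _ h0
    rw [metric_shapeOp, h] at h1
    exact lt_irrefl _ h1

theorem finrank_tangentSpace {M : Type*} [TopologicalSpace M] [ChartedSpace (Euc n) M] (q : M) : Module.finrank ℝ (TangentSpace (𝓡 n) q) = n :=
  finrank_euclideanSpace_fin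

theorem finrank_range_shapeOp_add (g : SmoothMetric n M) {d : ℕ} (f : M → Euc d) (q : M)
    (ζ : Euc d) :
    Module.finrank ℝ (LinearMap.range (shapeOp g f q ζ)) +
      Module.finrank ℝ (LinearMap.ker (shapeOp g f q ζ)) = n :=
  (LinearMap.finrank_range_add_finrank_ker (shapeOp g f q ζ)).trans (finrank_tangentSpace q)

theorem isCompl_map_equiv {R X Y : Type*} [Semiring R] [AddCommMonoid X] [AddCommMonoid Y]
    [Module R X] [Module R Y] (τ : X ≃ₗ[R] Y) {S S' : Submodule R X} :
    IsCompl (S.map (τ : X →ₗ[R] Y)) (S'.map (τ : X →ₗ[R] Y)) ↔ IsCompl S S' :=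
  ((Submodule.orderIsoMapComap τ).isCompl_iff).symm

theorem isCompl_iff_inf_eq_bot {K X : Type*} [Field K] [AddCommGroup X] [Module K X]
    [FiniteDimensional K X] {S R : Submodule K X}
    (h : Module.finrank K S + Module.finrank K R = Module.finrank K X) :
    IsCompl S R ↔ S ⊓ R = ⊥ := by
  refine ⟨fun h => h.inf_eq_bot, fun h0 => ?_⟩
  exact (Submodule.isCompl_iff_disjoint S R h.ge).2 (disjoint_iff.2 h0)

section

variable {g : SmoothMetric n M} {d : ℕ} {f : M → Euc d}

/-- The null spaces of the second derivative in a chart are the kernels of the shape operators. -/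
theorem exists_equiv_map_nullSpace
    (hf : IsIsometricImmersion g f) (p : M) {y : Euc n} (hy : y ∈ (extChartAt (𝓡 n) p).target)
    {q : M} (hq : (extChartAt (𝓡 n) p).symm y = q) :
    ∃ τ : Euc n ≃ₗ[ℝ] TangentSpace (𝓡 n) q, ∀ ζ ∈ normalSpaceAt (n := n) f q,
      (nullSpace (fderiv ℝ (fderiv ℝ (chartRep f p)) y) ζ).map
        (τ : Euc n →ₗ[ℝ] TangentSpace (𝓡 n) q) = LinearMap.ker (shapeOp g f q ζ) := by
  obtain ⟨τ, -, hτ⟩ := exists_tangent_equiv hf.smooth p hy hq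
  refine ⟨τ, fun ζ hζ => ?_⟩
  ext X
  rw [mem_ker_shapeOp]
  constructor
  · rintro ⟨u, hu, rfl⟩ Y
    have h := hτ ζ hζ u (τ.symm Y)
    rw [τ.apply_symm_apply] at h
    exact h.symm.trans (hu _)
  · intro h
    refine ⟨τ.symm X, fun v => ?_, τ.apply_symm_apply X⟩
    rw [hτ ζ hζ, τ.apply_symm_apply]
    exact h _

theorem mem_normalSpaceAt_iff
    (hf : IsIsometricImmersion g f) (p : M) {y : Euc n} (hy : y ∈ (extChartAt (𝓡 n) p).target)
    {q : M} (hq : (extChartAt (𝓡 n) p).symm y = q)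
    {ζ : Euc d} :
    ζ ∈ normalSpaceAt (n := n) f q ↔ ∀ u, ⟪fderiv ℝ (chartRep f p) y u, ζ⟫_ℝ = 0 := by
  rw [normalSpaceAt_eq hf.smooth p hy hq, Submodule.mem_orthogonal]
  exact ⟨fun h u => h _ ⟨u, rfl⟩, by rintro h _ ⟨u, rfl⟩; exact h u⟩

/-- A normal vector is determined by its pairings with normal vectors, so the comparison of pairings
in `exists_tangent_equiv` is a comparison of normal parts. -/
theorem exists_equiv_starProjection
    (hf : IsIsometricImmersion g f) (p : M) {y : Euc n} (hy : y ∈ (extChartAt (𝓡 n) p).target)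
    {q : M} (hq : (extChartAt (𝓡 n) p).symm y = q) :
    ∃ τ : Euc n ≃ₗ[ℝ] TangentSpace (𝓡 n) q, ∀ u v,
      (fderiv ℝ (chartRep f p) y).rangeᗮ.starProjection
        (fderiv ℝ (fderiv ℝ (chartRep f p)) y u v) = secondFF f q (τ u) (τ v) := by
  obtain ⟨τ, -, hτ⟩ := exists_tangent_equiv hf.smooth p hy hq
  refine ⟨τ, fun u v => ?_⟩
  rw [← starProjection_congr (normalSpaceAt_eq hf.smooth p hy hq)]
  set N := normalSpaceAt (n := n) f q
  have h1 : secondFF f q (τ u) (τ v) ∈ N := Submodule.starProjection_apply_mem _ _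
  refine Submodule.eq_starProjection_of_mem_of_inner_eq_zero h1 fun w hw => ?_
  rw [inner_sub_left, hτ w hw, sub_self]

theorem nonnegGauss_chartRep
    (hf : IsIsometricImmersion g f) (p : M) {y : Euc n} (hy : y ∈ (extChartAt (𝓡 n) p).target)
    {q : M} (hq : (extChartAt (𝓡 n) p).symm y = q)
    (hsec : NonnegSectionalCurv g) :
    NonnegGauss (fderiv ℝ (chartRep f p) y) (fderiv ℝ (fderiv ℝ (chartRep f p)) y) := by
  obtain ⟨τ, hτ⟩ := exists_equiv_starProjection hf p hy hq
  intro u v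
  rw [hτ, hτ]
  exact inner_secondFF_nonneg hsec hf q _ _

theorem isCompl_nullSpace_iff
    (hf : IsIsometricImmersion g f) (p : M) {y : Euc n} (hy : y ∈ (extChartAt (𝓡 n) p).target)
    {q : M} (hq : (extChartAt (𝓡 n) p).symm y = q)
    {ξ η : Euc d} (hξ : ξ ∈ normalSpaceAt (n := n) f q)
    (hη : η ∈ normalSpaceAt (n := n) f q) :
    IsCompl (nullSpace (fderiv ℝ (fderiv ℝ (chartRep f p)) y) ξ)
      (nullSpace (fderiv ℝ (fderiv ℝ (chartRep f p)) y) η) ↔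
    IsCompl (LinearMap.ker (shapeOp g f q ξ)) (LinearMap.ker (shapeOp g f q η)) := by
  obtain ⟨τ, hτ⟩ := exists_equiv_map_nullSpace hf p hy hq
  rw [← hτ ξ hξ, ← hτ η hη]
  exact (isCompl_map_equiv τ).symm

theorem nullSpace_inf_eq_bot_iff
    (hf : IsIsometricImmersion g f) (p : M) {y : Euc n} (hy : y ∈ (extChartAt (𝓡 n) p).target)
    {q : M} (hq : (extChartAt (𝓡 n) p).symm y = q)
    {ξ η : Euc d} (hξ : ξ ∈ normalSpaceAt (n := n) f q)
    (hη : η ∈ normalSpaceAt (n := n) f q) :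
    nullSpace (fderiv ℝ (fderiv ℝ (chartRep f p)) y) ξ ⊓
      nullSpace (fderiv ℝ (fderiv ℝ (chartRep f p)) y) η = ⊥ ↔
    LinearMap.ker (shapeOp g f q ξ) ⊓ LinearMap.ker (shapeOp g f q η) = ⊥ := by
  obtain ⟨τ, hτ⟩ := exists_equiv_map_nullSpace hf p hy hq
  rw [← hτ ξ hξ, ← hτ η hη, ← Submodule.map_inf _ τ.injective]
  exact (Submodule.map_eq_bot_iff (e := τ)).symm

theorem finrank_nullSpace_eq
    (hf : IsIsometricImmersion g f) (p : M) {y : Euc n} (hy : y ∈ (extChartAt (𝓡 n) p).target)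
    {q : M} (hq : (extChartAt (𝓡 n) p).symm y = q)
    {ζ : Euc d} (hζ : ζ ∈ normalSpaceAt (n := n) f q) :
    Module.finrank ℝ (nullSpace (fderiv ℝ (fderiv ℝ (chartRep f p)) y) ζ) =
      Module.finrank ℝ (LinearMap.ker (shapeOp g f q ζ)) := by
  obtain ⟨τ, hτ⟩ := exists_equiv_map_nullSpace hf p hy hq
  rw [← hτ ζ hζ]
  exact (LinearEquiv.finrank_map_eq τ _).symm

theorem nonneg_chartRep_iff
    (hf : IsIsometricImmersion g f) (p : M) {y : Euc n} (hy : y ∈ (extChartAt (𝓡 n) p).target)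
    {q : M} (hq : (extChartAt (𝓡 n) p).symm y = q)
    {ζ : Euc d} (hζ : ζ ∈ normalSpaceAt (n := n) f q) :
    (∀ u, 0 ≤ ⟪fderiv ℝ (fderiv ℝ (chartRep f p)) y u u, ζ⟫_ℝ) ↔
      ∀ X : TangentSpace (𝓡 n) q, 0 ≤ g.inner q (shapeOp g f q ζ X) X := by
  obtain ⟨τ, -, hτ⟩ := exists_tangent_equiv hf.smooth p hy hq
  constructor
  · intro h X
    have h1 := h (τ.symm X)
    rw [hτ ζ hζ, τ.apply_symm_apply] at h1
    rw [metric_shapeOp]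
    exact h1
  · intro h u
    rw [hτ ζ hζ, ← metric_shapeOp g]
    exact h _

end

variable {g : SmoothMetric n M} {f : M → Euc (n + 2)}

theorem isNonnegFrame_iff
    (hf : IsIsometricImmersion g f) (p : M) {y : Euc n} (hy : y ∈ (extChartAt (𝓡 n) p).target)
    {q : M} (hq : (extChartAt (𝓡 n) p).symm y = q)
    {ξ η : Euc (n + 2)} : IsNonnegFrame g f q ξ η ↔
    NonnegPair (fderiv ℝ (chartRep f p) y) (fderiv ℝ (fderiv ℝ (chartRep f p)) y) ξ η := by
  constructor
  · intro h
    exact ⟨(mem_normalSpaceAt_iff hf p hy hq).1 h.mem_ξ, (mem_normalSpaceAt_iff hf p hy hq).1 h.mem_η,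
      h.norm_ξ, h.norm_η, h.orth, (nonneg_chartRep_iff hf p hy hq h.mem_ξ).2 h.nonneg_ξ,
      (nonneg_chartRep_iff hf p hy hq h.mem_η).2 h.nonneg_η⟩
  · intro h
    have hξ := (mem_normalSpaceAt_iff hf p hy hq).2 h.normal_left
    have hη := (mem_normalSpaceAt_iff hf p hy hq).2 h.normal_right
    exact ⟨hξ, hη, h.norm_left, h.norm_right, h.orth,
      (nonneg_chartRep_iff hf p hy hq hξ).1 h.nonneg_left,
      (nonneg_chartRep_iff hf p hy hq hη).1 h.nonneg_right⟩

theorem wideJet_chartRep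
    (hf : IsIsometricImmersion g f) (p : M) {y : Euc n} (hy : y ∈ (extChartAt (𝓡 n) p).target)
    {q : M} (hq : (extChartAt (𝓡 n) p).symm y = q)
    (hwide : IsLocallyWide g f) :
    WideJet (fderiv ℝ (chartRep f p) y) (fderiv ℝ (fderiv ℝ (chartRep f p)) y) := by
  intro ξ η h
  have h' := (isNonnegFrame_iff hf p hy hq).2 h
  exact (hwide q ξ η h').imp
    (mt (nullSpace_inf_eq_bot_iff hf p hy hq h'.mem_ξ h'.mem_η).1)
    fun h1 => (isCompl_nullSpace_iff hf p hy hq h'.mem_ξ h'.mem_η).2 h1.1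

/-- By rank-nullity the ranks `n - k` and `k` become null space dimensions `k` and `n - k`; `k ≤ n`
makes the truncated subtraction harmless. The dimensions add up to `n`, so trivial intersection
amounts to being complementary. -/
theorem isFrameOfType_iff
    (hf : IsIsometricImmersion g f) (p : M) {y : Euc n} (hy : y ∈ (extChartAt (𝓡 n) p).target)
    {q : M} (hq : (extChartAt (𝓡 n) p).symm y = q)
    {k : ℕ} (hk : k ≤ n) {ξ η : Euc (n + 2)} :
    IsFrameOfType g f k q ξ η ↔
      AdaptedPair (fderiv ℝ (chartRep f p) y) (fderiv ℝ (fderiv ℝ (chartRep f p)) y) ξ η ∧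
      Module.finrank ℝ (nullSpace (fderiv ℝ (fderiv ℝ (chartRep f p)) y) ξ) = k ∧
      Module.finrank ℝ (nullSpace (fderiv ℝ (fderiv ℝ (chartRep f p)) y) η) = n - k := by
  have rξ := finrank_range_shapeOp_add g f q ξ
  have rη := finrank_range_shapeOp_add g f q η
  constructor
  · intro h
    have eξ := finrank_nullSpace_eq hf p hy hq h.mem_ξ
    have eη := finrank_nullSpace_eq hf p hy hq h.mem_η
    rw [h.rank_ξ] at rξ
    rw [h.rank_η] at rη
    refine ⟨⟨(isNonnegFrame_iff hf p hy hq).1 h.toIsNonnegFrame, ?_⟩, by omega, by omega⟩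
    rw [isCompl_nullSpace_iff hf p hy hq h.mem_ξ h.mem_η]
    refine (isCompl_iff_inf_eq_bot ?_).2 h.ker_inf
    rw [finrank_tangentSpace]
    omega
  · rintro ⟨h, hξ, hη⟩
    have h' := (isNonnegFrame_iff hf p hy hq).2 h.toNonnegPair
    have eξ := finrank_nullSpace_eq hf p hy hq h'.mem_ξ
    have eη := finrank_nullSpace_eq hf p hy hq h'.mem_η
    exact ⟨h', by omega, by omega,
      (nullSpace_inf_eq_bot_iff hf p hy hq h'.mem_ξ h'.mem_η).1 h.compl.inf_eq_bot⟩

end FramesInCharts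

/-! ### Parametrizations of the manifold and the induced metric -/

section LocalProduct

open Topology Filter

variable {n : ℕ} {M : Type*} [TopologicalSpace M] [ChartedSpace (Euc n) M]
  [IsManifold (𝓡 n) ∞ M]

/-- The inverse of the preferred chart at `p` composed with a parametrization `e` of an open part
of its target. -/
def chartParam {X : Type*} [NormedAddCommGroup X] [NormedSpace ℝ X] (p : M)
    (e : OpenPartialHomeomorph X (Euc n)) (he : e.target ⊆ (extChartAt (𝓡 n) p).target)
    (hs : ContDiffOn ℝ ∞ e e.source) (hs' : ContDiffOn ℝ ∞ e.symm e.target) :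
    PartialDiffeomorph 𝓘(ℝ, X) (𝓡 n) X M ∞ where
  toFun := (extChartAt (𝓡 n) p).symm ∘ e
  invFun := e.symm ∘ extChartAt (𝓡 n) p
  source := e.source
  target := (extChartAt (𝓡 n) p).source ∩ extChartAt (𝓡 n) p ⁻¹' e.target
  map_source' x hx := by
    have h := he (e.map_source hx)
    refine ⟨(extChartAt (𝓡 n) p).map_target h, ?_⟩
    rw [mem_preimage, Function.comp_apply, (extChartAt (𝓡 n) p).right_inv h]
    exact e.map_source hx
  map_target' q hq := e.map_target hq.2
  left_inv' x hx := by
    simp only [Function.comp_apply]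
    rw [(extChartAt (𝓡 n) p).right_inv (he (e.map_source hx)), e.left_inv hx]
  right_inv' q hq := by
    simp only [Function.comp_apply]
    rw [e.right_inv hq.2, (extChartAt (𝓡 n) p).left_inv hq.1]
  open_source := e.open_source
  open_target := (continuousOn_extChartAt p).isOpen_inter_preimage (isOpen_extChartAt_source p)
    e.open_target
  contMDiffOn_toFun := (contMDiffOn_extChartAt_symm p).comp (contMDiffOn_iff_contDiffOn.2 hs)
    fun x hx => he (e.map_source hx)
  contMDiffOn_invFun := (contMDiffOn_iff_contDiffOn.2 hs').comp
    ((contMDiffOn_extChartAt (x := p)).mono fun q hq => by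
      rw [← extChartAt_source (𝓡 n)]
      exact hq.1) fun q hq => hq.2

/-- The metric of an isometrically immersed manifold in a parametrization. -/
theorem inner_mfderiv_mfderiv {X : Type*} [NormedAddCommGroup X] [NormedSpace ℝ X]
    {g : SmoothMetric n M} {d : ℕ} {f : M → Euc d} (hf : IsIsometricImmersion g f) {Φ : X → M}
    {x : X} (hΦ : ContMDiffAt 𝓘(ℝ, X) (𝓡 n) ∞ Φ x) (u v : X) :
    g.inner (Φ x) (mfderiv 𝓘(ℝ, X) (𝓡 n) Φ x u) (mfderiv 𝓘(ℝ, X) (𝓡 n) Φ x v) =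
      ⟪fderiv ℝ (f ∘ Φ) x u, fderiv ℝ (f ∘ Φ) x v⟫_ℝ := by
  have h := mfderiv_comp x ((hf.smooth.contMDiffAt (x := Φ x)).mdifferentiableAt (by simp))
    (hΦ.mdifferentiableAt (by simp))
  rw [mfderiv_eq_fderiv] at h
  have h' : ∀ w, fderiv ℝ (f ∘ Φ) x w = diffAt f (Φ x) (mfderiv 𝓘(ℝ, X) (𝓡 n) Φ x w) :=
    fun w => congrArg (fun T : X →L[ℝ] Euc d => T w) h
  rw [← hf.isometric, h', h']

end LocalProduct

end

/-! ### The product decomposition -/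

theorem mainTheorem8 {n : ℕ} {M : Type*} [TopologicalSpace M] [ChartedSpace (Euc n) M]
    [IsManifold (𝓡 n) ∞ M] (hn : 3 ≤ n)
    (g : SmoothMetric n M) (hsec : NonnegSectionalCurv g)
    (f : M → Euc (n + 2)) (hf : IsIsometricImmersion g f) (hwide : IsLocallyWide g f)
    (k : ℕ) (hk : 2 ≤ k) (hkn : k ≤ n / 2)
    (p : M) (hp : p ∈ stratumU g f k)
    (ξ η : Euc (n + 2)) (hframe : IsFrameOfType g f k p ξ η) :
    ∃ (W₁ : Set (Euc (n - k))) (W₂ : Set (Euc k))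
      (Φ : PartialDiffeomorph 𝓘(ℝ, Euc (n - k) × Euc k) (𝓡 n) (Euc (n - k) × Euc k) M ∞)
      (h₁ N₁ : Euc (n - k) → Euc (n - k + 1)) (h₂ N₂ : Euc k → Euc (k + 1))
      (T : WithLp 2 (Euc (n - k + 1) × Euc (k + 1)) ≃ₗᵢ[ℝ] Euc (n + 2)),
      -- the two strictly convex hypersurfaces
      IsStrictlyConvexHypersurface W₁ h₁ N₁ ∧ IsStrictlyConvexHypersurface W₂ h₂ N₂ ∧
      -- `Φ` identifies `W₁ × W₂` with an open neighbourhood of `p` contained in `U_k`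
      Φ.source = W₁ ×ˢ W₂ ∧ p ∈ Φ.target ∧ Φ.target ⊆ stratumU g f k ∧
      -- `Φ` is an isometry for the product of the metrics induced by `h₁` and `h₂`
      (∀ x ∈ W₁, ∀ y ∈ W₂, ∀ u v : Euc (n - k) × Euc k,
        g.inner (Φ (x, y)) (mfderiv 𝓘(ℝ, Euc (n - k) × Euc k) (𝓡 n) Φ (x, y) u)
            (mfderiv 𝓘(ℝ, Euc (n - k) × Euc k) (𝓡 n) Φ (x, y) v) =
          ⟪fderiv ℝ h₁ x u.1, fderiv ℝ h₁ x v.1⟫_ℝ + ⟪fderiv ℝ h₂ y u.2, fderiv ℝ h₂ y v.2⟫_ℝ) ∧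
      -- `f` is the product immersion `h₁ × h₂`
      (∀ x ∈ W₁, ∀ y ∈ W₂, f (Φ (x, y)) = T (WithLp.toLp 2 (h₁ x, h₂ y))) ∧
      -- the normals of the factors form the frame of the definition of `U_k` ...
      (∀ x ∈ W₁, ∀ y ∈ W₂, IsFrameOfType g f k (Φ (x, y))
        (T (WithLp.toLp 2 (N₁ x, 0))) (T (WithLp.toLp 2 (0, N₂ y)))) ∧
      -- ... and at `p` they are the given vectors `ξ` and `η`
      (∀ x ∈ W₁, ∀ y ∈ W₂, Φ (x, y) = p →
        T (WithLp.toLp 2 (N₁ x, 0)) = ξ ∧ T (WithLp.toLp 2 (0, N₂ y)) = η) := by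
  have hkn' : k ≤ n := hkn.trans (Nat.div_le_self n 2)
  have hy₀ : extChartAt (𝓡 n) p p ∈ (extChartAt (𝓡 n) p).target := mem_extChartAt_target p
  have hdim : Module.finrank ℝ (Euc (n + 2)) = Module.finrank ℝ (Euc n) + 2 := by simp
  obtain ⟨hpair, hrξ, hrη⟩ :=
    (isFrameOfType_iff hf p hy₀ (extChartAt_to_inv p) hkn').1 hframe
  -- The null spaces have dimensions `k` and `n - k`, and `n - k ≥ k ≥ 2` because `k ≤ n / 2`.
  obtain ⟨ξ', η', Ω, hF, hΩ, hyΩ, hξ₀, hη₀, hdξ, hdη⟩ := exists_isAdaptedFrame hdim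
    (isOpen_extChartAt_target p) (contDiffOn_chartRep hf.smooth p)
    (fun y hy => injective_fderiv_chartRep hf p hy)
    (fun y hy => nonnegGauss_chartRep hf p hy rfl hsec)
    (fun y hy => wideJet_chartRep hf p hy rfl hwide) hy₀ hpair (by omega) (by omega)
  -- The factor carrying `ξ` has the dimension `n - k` of the null space of `η`, and the factor
  -- carrying `η` the dimension `k` of the null space of `ξ`.
  obtain ⟨e, W₁, W₂, ξ₁, η₁, hW₁, hW₂, hsrc, hye, heΩ, hes, hes', hsplit, hinj, hξ₁, hη₁⟩ :=
    hF.exists_coordinates hdim hyΩ ((hdη _ hyΩ).trans hrη) ((hdξ _ hyΩ).trans hrξ)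
  obtain ⟨h₁, N₁, h₂, N₂, T, hh₁, hh₂, hmet, hprod, hN₁, hN₂⟩ :=
    hsplit.exists_product (by rw [finrank_euclideanSpace_fin]; omega) hW₁ hW₂ hinj
  have het : e.target ⊆ (extChartAt (𝓡 n) p).target := heΩ.trans hΩ
  have htype : ∀ y ∈ e.target,
      IsFrameOfType g f k ((extChartAt (𝓡 n) p).symm y) (ξ' y) (η' y) := fun y hy =>
    (isFrameOfType_iff hf p (het hy) rfl hkn').2 ⟨hF.adapted y (heΩ hy),
      (hdξ y (heΩ hy)).trans hrξ, (hdη y (heΩ hy)).trans hrη⟩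
  have hmem : ∀ x ∈ W₁, ∀ z ∈ W₂, (x, z) ∈ e.source := fun x hx z hz => hsrc ▸ ⟨hx, hz⟩
  refine ⟨W₁, W₂, chartParam p e het hes hes', h₁, N₁, h₂, N₂, T, hh₁, hh₂, hsrc,
    ⟨mem_extChartAt_source p, hye⟩, ?_, ?_, hprod, ?_, ?_⟩
  · rintro q ⟨hq, hqe⟩
    have h := htype _ hqe
    rw [(extChartAt (𝓡 n) p).left_inv hq] at h
    exact ⟨_, _, h⟩
  · intro x hx z hz u v
    rw [← hmet x hx z hz]
    exact inner_mfderiv_mfderiv hf (((chartParam p e het hes hes').contMDiffOn_toFun).contMDiffAt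
      ((chartParam p e het hes hes').open_source.mem_nhds (hmem x hx z hz))) u v
  · intro x hx z hz
    have h := htype _ (e.map_source (hmem x hx z hz))
    rw [hξ₁ x hx z hz, hη₁ x hx z hz] at h
    rw [hN₁ x hx, hN₂ z hz]
    exact h
  · intro x hx z hz hp'
    -- The extended frame equals the given one at the coordinate of `p`, so it suffices to identify
    -- that coordinate.
    have h : e (x, z) = extChartAt (𝓡 n) p p := by
      rw [← (extChartAt (𝓡 n) p).right_inv (het (e.map_source (hmem x hx z hz)))]
      exact congrArg (extChartAt (𝓡 n) p) hp'
    rw [hN₁ x hx, hN₂ z hz, ← hξ₁ x hx z hz, ← hη₁ x hx z hz, h]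
    exact ⟨hξ₀, hη₀⟩
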